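/- Let $\mathcal{E}$ be a locally cartesian closed category with a terminal object (hence with finite limits) which is (finitary) extensive, in particular has finite sums, and which has W-types: for every polynomial $1 \leftarrow B \to A \to 1$ the associated polynomial endofunctor of $\mathcal{E}/1$ has an initial algebra. For $f : B \to A$ let $\Sigma_f \dashv f^* \dashv \Pi_f$ denote dependent sum, pullback and dependent product between the slices $\mathcal{E}/B$ and $\mathcal{E}/A$, each with its canonical tensorial strength $K \otimes F(X) \to F(K \otimes X)$, where $K \in \mathcal{E}$ and $K \otimes (X \to I) = (K \times X \to X \to I)$. A *polynomial functor* $\mathcal{E}/I \to \mathcal{E}/J$ is a strong functor that is isomorphic, by a strong natural isomorphism, to $\Sigma_t \Pi_f s^*$ for some diagram $I \xleftarrow{s} B \xrightarrow{f} A \xrightarrow{t} J$. A natural transformation is *cartesian* if all its naturality squares are pullbacks. A *polynomial monad* on $\mathcal{E}/I$ is a monad $(T,\eta,\mu)$ with $T$ a polynomial functor and $\eta$, $\mu$ cartesian strong natural transformations. Let $\mathrm{PolyEnd}_{\mathcal{E}}$ be the category whose objects are pairs $(I,P)$ with $I \in \mathcal{E}$ and $P$ a polynomial endofunctor of $\mathcal{E}/I$,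 and whose morphisms $(I',P') \to (I,P)$ are pairs $(u,\phi)$ of a map $u : I' \to I$ in $\mathcal{E}$ and a cartesian strong natural transformation $\phi : \Sigma_u P' \Rightarrow P\,\Sigma_u$; composition is vertical pasting. Let $\mathrm{PolyMnd}_{\mathcal{E}}$ be the category whose objects are pairs $(I,T)$ with $T$ a polynomial monad on $\mathcal{E}/I$, and whose morphisms $(I',T') \to (I,T)$ are the morphisms $(u,\phi)$ as above that satisfy $$\phi \circ \Sigma_u \eta' = \eta\, \Sigma_u, \qquad \phi \circ \Sigma_u \mu' = \mu\,\Sigma_u \circ T\phi \circ \phi\, T'.$$ Then the forgetful functor $U : \mathrm{PolyMnd}_{\mathcal{E}} \to \mathrm{PolyEnd}_{\mathcal{E}}$ has a left adjoint. Moreover the left adjoint is given by free monads: every polynomial endofunctor $P$ of a slice $\mathcal{E}/I$ has a free monad $\alpha : P \Rightarrow T$ (every natural transformation from $P$ to a monad on $\mathcal{E}/I$ factors through $\alpha$ by a unique monad morphism) such that $T$ is a polynomial monad, $\alpha$ is cartesian and strong, and for every polynomial monad $(I',T')$ and every morphism $(u,\phi) : (I,P) \to U(I',T')$ in $\mathrm{PolyEnd}_{\mathcal{E}}$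 there is a unique morphism $\psi : (I,T) \to (I',T')$ in $\mathrm{PolyMnd}_{\mathcal{E}}$ with $U(\psi) \circ (\mathrm{id}_I, \alpha) = (u,\phi)$. -/

import Mathlib

open CategoryTheory CategoryTheory.Limits

universe v u

set_option linter.unusedSectionVars false

namespace PolynomialFunctors

noncomputable section

variable {E : Type u} [Category.{v} E] [HasFiniteLimits E]

/-- The tensor `K ⊗ X` of an object `X` of the slice over `I` by an object `K` of `E`: it is
`K × X ⟶ X ⟶ I`. -/
def tensorObj {I : E} (K : E) (X : Over I) : Over I :=
  Over.mk (prod.snd ≫ X.hom : K ⨯ X.left ⟶ I)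

/-- The projection `K ⊗ X ⟶ K` in `E`. -/
def tensorFst {I : E} (K : E) (X : Over I) : (tensorObj K X).left ⟶ K :=
  (prod.fst : K ⨯ X.left ⟶ K)

/-- The projection of `K ⊗ X` to the domain of `X`, as a map of `E`. -/
def tensorSnd {I : E} (K : E) (X : Over I) : (tensorObj K X).left ⟶ X.left :=
  (prod.snd : K ⨯ X.left ⟶ X.left)

/-- The map into `K ⊗ X` with the two given components. -/
def tensorLift {I : E} {K : E} {W : E} {X : Over I} (a : W ⟶ K) (b : W ⟶ X.left) :
    W ⟶ (tensorObj K X).left :=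
  prod.lift a b

@[simp] lemma tensorLift_fst {I : E} {K : E} {W : E} {X : Over I} (a : W ⟶ K) (b : W ⟶ X.left) :
    tensorLift a b ≫ tensorFst K X = a := prod.lift_fst _ _

@[simp] lemma tensorLift_fst_assoc {I : E} {K : E} {W : E} {X : Over I} (a : W ⟶ K) (b : W ⟶ X.left)
    {Z : E} (z : _ ⟶ Z) : tensorLift a b ≫ tensorFst K X ≫ z = a ≫ z := by
  rw [← Category.assoc, tensorLift_fst]

@[simp] lemma tensorLift_snd {I : E} {K : E} {W : E} {X : Over I} (a : W ⟶ K) (b : W ⟶ X.left) :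
    tensorLift a b ≫ tensorSnd K X = b := prod.lift_snd _ _

@[simp] lemma tensorLift_snd_assoc {I : E} {K : E} {W : E} {X : Over I} (a : W ⟶ K) (b : W ⟶ X.left)
    {Z : E} (z : _ ⟶ Z) : tensorLift a b ≫ tensorSnd K X ≫ z = b ≫ z := by
  rw [← Category.assoc, tensorLift_snd]

@[simp] lemma tensorSnd_hom {I : E} (K : E) (X : Over I) :
    tensorSnd K X ≫ X.hom = (tensorObj K X).hom := rfl

@[simp] lemma tensorSnd_hom_assoc {I : E} (K : E) (X : Over I)
    {Z : E} (z : _ ⟶ Z) : tensorSnd K X ≫ X.hom ≫ z = (tensorObj K X).hom ≫ z := by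
  rw [← Category.assoc, tensorSnd_hom]

@[simp] lemma tensorLift_hom {I : E} {K : E} {W : E} {X : Over I} (a : W ⟶ K) (b : W ⟶ X.left) :
    tensorLift a b ≫ (tensorObj K X).hom = b ≫ X.hom := by
  rw [← tensorSnd_hom, tensorLift_snd_assoc]

@[simp] lemma tensorLift_hom_assoc {I : E} {K : E} {W : E} {X : Over I} (a : W ⟶ K) (b : W ⟶ X.left)
    {Z : E} (z : _ ⟶ Z) : tensorLift a b ≫ (tensorObj K X).hom ≫ z = (b ≫ X.hom) ≫ z := by
  rw [← Category.assoc, tensorLift_hom]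

/-- The projection `K ⊗ X ⟶ X` in the slice; for `K = 1` it is the unit isomorphism. -/
def tensorProj {I : E} (K : E) (X : Over I) : tensorObj K X ⟶ X :=
  Over.homMk (tensorSnd K X) (tensorSnd_hom K X)

@[simp] lemma tensorProj_left {I : E} (K : E) (X : Over I) :
    (tensorProj K X).left = tensorSnd K X := rfl

lemma tensor_hom_ext {I : E} {K : E} {W : E} {X : Over I} {a b : W ⟶ (tensorObj K X).left}
    (h₁ : a ≫ tensorFst K X = b ≫ tensorFst K X)
    (h₂ : a ≫ tensorSnd K X = b ≫ tensorSnd K X) : a = b :=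
  Limits.prod.hom_ext h₁ h₂

/-- Functoriality of `K ⊗ X` in both variables. -/
def tensorMap {I : E} {K K' : E} (k : K ⟶ K') {X X' : Over I} (g : X ⟶ X') :
    tensorObj K X ⟶ tensorObj K' X' :=
  Over.homMk (tensorLift (tensorFst K X ≫ k) (tensorSnd K X ≫ g.left))

@[simp] lemma tensorMap_fst {I : E} {K K' : E} (k : K ⟶ K') {X X' : Over I} (g : X ⟶ X') :
    (tensorMap k g).left ≫ tensorFst K' X' = tensorFst K X ≫ k := by
  simp [tensorMap]

@[simp] lemma tensorMap_fst_assoc {I : E} {K K' : E} (k : K ⟶ K') {X X' : Over I} (g : X ⟶ X')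
    {Z : E} (z : _ ⟶ Z) : (tensorMap k g).left ≫ tensorFst K' X' ≫ z = (tensorFst K X ≫ k) ≫ z := by
  rw [← Category.assoc, tensorMap_fst]

@[simp] lemma tensorMap_snd {I : E} {K K' : E} (k : K ⟶ K') {X X' : Over I} (g : X ⟶ X') :
    (tensorMap k g).left ≫ tensorSnd K' X' = tensorSnd K X ≫ g.left := by
  simp [tensorMap]

@[simp] lemma tensorMap_snd_assoc {I : E} {K K' : E} (k : K ⟶ K') {X X' : Over I} (g : X ⟶ X')
    {Z : E} (z : _ ⟶ Z) : (tensorMap k g).left ≫ tensorSnd K' X' ≫ z = (tensorSnd K X ≫ g.left) ≫ z := by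
  rw [← Category.assoc, tensorMap_snd]

/-- The associativity isomorphism `(K × L) ⊗ X ≅ K ⊗ (L ⊗ X)`. -/
def tensorAssoc {I : E} (K L : E) (X : Over I) :
    tensorObj (K ⨯ L) X ⟶ tensorObj K (tensorObj L X) :=
  Over.homMk (tensorLift (tensorFst (K ⨯ L) X ≫ prod.fst)
    (tensorLift (tensorFst (K ⨯ L) X ≫ prod.snd) (tensorSnd (K ⨯ L) X)))

lemma tensorMap_comp {I : E} {K K' K'' : E} (k : K ⟶ K') (k' : K' ⟶ K'')
    {X X' X'' : Over I} (g : X ⟶ X') (g' : X' ⟶ X'') :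
    tensorMap (k ≫ k') (g ≫ g') = tensorMap k g ≫ tensorMap k' g' := by
  ext; apply tensor_hom_ext <;> simp

lemma tensorMap_id {I : E} (K : E) (X : Over I) : tensorMap (𝟙 K) (𝟙 X) = 𝟙 _ := by
  ext; apply tensor_hom_ext <;> simp

/-- A tensorial strength on a functor between slices: a family `K ⊗ F X ⟶ F (K ⊗ X)`, natural in
`K` and `X`, satisfying the unit and the associativity axiom. -/
structure Strength {I J : E} (F : Over I ⥤ Over J) where
  app (K : E) (X : Over I) : tensorObj K (F.obj X) ⟶ F.obj (tensorObj K X)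
  naturality {K K' : E} (k : K ⟶ K') {X X' : Over I} (g : X ⟶ X') :
    tensorMap k (F.map g) ≫ app K' X' = app K X ≫ F.map (tensorMap k g)
  unit (X : Over I) : app (⊤_ E) X ≫ F.map (tensorProj (⊤_ E) X) = tensorProj (⊤_ E) (F.obj X)
  assoc (K L : E) (X : Over I) :
    app (K ⨯ L) X ≫ F.map (tensorAssoc K L X) =
      tensorAssoc K L (F.obj X) ≫ tensorMap (𝟙 K) (app L X) ≫ app K (tensorObj L X)

namespace Strength

/-- The strength of an identity functor. -/
def id (I : E) : Strength (𝟭 (Over I)) where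
  app K X := 𝟙 (tensorObj K X)
  naturality k _ _ g := by simp
  unit X := by simp
  assoc K L X := by simp [tensorMap_id]

/-- The strength of a composite of strong functors. -/
def comp {I J L : E} {F : Over I ⥤ Over J} {G : Over J ⥤ Over L}
    (σ : Strength F) (τ : Strength G) : Strength (F ⋙ G) where
  app K X := τ.app K (F.obj X) ≫ G.map (σ.app K X)
  naturality k _ _ g := by
    dsimp
    rw [← Category.assoc, τ.naturality, Category.assoc, ← G.map_comp, σ.naturality]
    simp
  unit X := by
    dsimp
    rw [Category.assoc, ← G.map_comp, σ.unit, τ.unit]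
  assoc K L X := by
    dsimp
    rw [Category.assoc, ← G.map_comp, σ.assoc, ← Category.comp_id (𝟙 K), tensorMap_comp]
    simp only [Functor.map_comp, Category.assoc]
    rw [← Category.assoc (τ.app _ _), τ.assoc]
    simp only [Category.assoc]
    rw [← Category.assoc (τ.app _ _) , ← τ.naturality]
    simp

/-- The canonical strength of the dependent sum functor `Σ_t = Over.map t` (postcomposition with
`t`); on underlying objects it is the identity of `K × X`. -/
def depSum {I J : E} (t : I ⟶ J) : Strength (Over.map t) where
  app K X := Over.homMk
    (tensorLift (tensorFst K ((Over.map t).obj X)) (tensorSnd K ((Over.map t).obj X)))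
    (by simpa using tensorSnd_hom K ((Over.map t).obj X))
  naturality k _ _ g := by
    ext; apply tensor_hom_ext <;> simp
  unit X := by ext; simp
  assoc K L X := by
    ext; apply tensor_hom_ext
    · simp [tensorAssoc]
    · apply tensor_hom_ext <;> simp [tensorAssoc]

/-- The projection from the pulled back object `f^* X` to `X`. -/
def pullbackFst {I J : E} (f : I ⟶ J) (X : Over J) : ((Over.pullback f).obj X).left ⟶ X.left :=
  pullback.fst X.hom f

lemma pullbackFst_hom {I J : E} (f : I ⟶ J) (X : Over J) :
    pullbackFst f X ≫ X.hom = ((Over.pullback f).obj X).hom ≫ f :=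
  pullback.condition

lemma pullbackFst_hom_assoc {I J : E} (f : I ⟶ J) (X : Over J)
    {Z : E} (z : _ ⟶ Z) : pullbackFst f X ≫ X.hom ≫ z = (((Over.pullback f).obj X).hom ≫ f) ≫ z := by
  rw [← Category.assoc, pullbackFst_hom]

@[simp] lemma pullback_map_fst {I J : E} (f : I ⟶ J) {X Y : Over J} (g : X ⟶ Y) :
    ((Over.pullback f).map g).left ≫ pullbackFst f Y = pullbackFst f X ≫ g.left :=
  pullback.lift_fst _ _ _

@[simp] lemma pullback_map_fst_assoc {I J : E} (f : I ⟶ J) {X Y : Over J} (g : X ⟶ Y)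
    {Z : E} (z : _ ⟶ Z) : ((Over.pullback f).map g).left ≫ pullbackFst f Y ≫ z = (pullbackFst f X ≫ g.left) ≫ z := by
  rw [← Category.assoc, pullback_map_fst]

/-- The map into `f^* X` over `I` induced by a map to `X` over `f`. -/
def pullbackLift {I J : E} (f : I ⟶ J) {W : Over I} {X : Over J} (a : W.left ⟶ X.left)
    (h : a ≫ X.hom = W.hom ≫ f) : W ⟶ (Over.pullback f).obj X :=
  Over.homMk (pullback.lift a W.hom h) (pullback.lift_snd _ _ _)

@[simp] lemma pullbackLift_fst {I J : E} (f : I ⟶ J) {W : Over I} {X : Over J} (a : W.left ⟶ X.left)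
    (h : a ≫ X.hom = W.hom ≫ f) : (pullbackLift f a h).left ≫ pullbackFst f X = a :=
  pullback.lift_fst _ _ _

@[simp] lemma pullbackLift_fst_assoc {I J : E} (f : I ⟶ J) {W : Over I} {X : Over J} (a : W.left ⟶ X.left)
    (h : a ≫ X.hom = W.hom ≫ f)
    {Z : E} (z : _ ⟶ Z) : (pullbackLift f a h).left ≫ pullbackFst f X ≫ z = a ≫ z := by
  rw [← Category.assoc, pullbackLift_fst]

lemma pullback_hom_ext_left {I J : E} {f : I ⟶ J} {W : E} {X : Over J}
    {a b : W ⟶ ((Over.pullback f).obj X).left}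
    (h : a ≫ pullbackFst f X = b ≫ pullbackFst f X)
    (h' : a ≫ ((Over.pullback f).obj X).hom = b ≫ ((Over.pullback f).obj X).hom) : a = b :=
  pullback.hom_ext h h'

lemma pullback_hom_ext {I J : E} {f : I ⟶ J} {W : Over I} {X : Over J}
    {a b : W ⟶ (Over.pullback f).obj X}
    (h : a.left ≫ pullbackFst f X = b.left ≫ pullbackFst f X) : a = b :=
  Over.OverMorphism.ext (pullback.hom_ext h ((Over.w a).trans (Over.w b).symm))


/-- The canonical map `f^* (K ⊗ X) ⟶ K ⊗ f^* X`; it is inverse to the strength of `f^*`. -/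
def pullbackInv {I J : E} (f : I ⟶ J) (K : E) (X : Over J) :
    (Over.pullback f).obj (tensorObj K X) ⟶ tensorObj K ((Over.pullback f).obj X) :=
  Over.homMk
    (tensorLift (pullbackFst f _ ≫ tensorFst K X) ((Over.pullback f).map (tensorProj K X)).left)
    (by rw [tensorLift_hom, Over.w])

/-- The canonical strength of the pullback functor `f^*` (a Beck-Chevalley isomorphism). -/
def pullback {I J : E} (f : I ⟶ J) : Strength (Over.pullback f) where
  app K X := pullbackLift f
    (tensorLift (tensorFst K _) (tensorSnd K _ ≫ pullbackFst f X))
    (by simp [pullbackFst_hom, tensorSnd_hom_assoc, -Over.pullback_obj_hom])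
  naturality k _ _ g := by
    apply pullback_hom_ext; apply tensor_hom_ext <;> simp [-Over.pullback_map_left]
  unit X := by apply pullback_hom_ext;  simp [-Over.pullback_map_left]
  assoc K L X := by
    apply pullback_hom_ext; apply tensor_hom_ext
    · simp [tensorAssoc, -Over.pullback_map_left]
    · apply tensor_hom_ext <;> simp [tensorAssoc, -Over.pullback_map_left]

lemma pullback_app_pullbackInv {I J : E} (f : I ⟶ J) (K : E) (X : Over J) :
    (pullback f).app K X ≫ pullbackInv f K X = 𝟙 _ := by
  ext; apply tensor_hom_ext
  · simp [pullback, pullbackInv, -Over.pullback_map_left]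
  · apply pullback_hom_ext_left <;>
      simp [pullback, pullbackInv, -Over.pullback_map_left, -Over.pullback_obj_hom]

lemma pullbackInv_pullback_app {I J : E} (f : I ⟶ J) (K : E) (X : Over J) :
    pullbackInv f K X ≫ (pullback f).app K X = 𝟙 _ := by
  apply pullback_hom_ext; apply tensor_hom_ext <;>
    simp [pullback, pullbackInv, -Over.pullback_map_left]

lemma pullbackInv_naturality {I J : E} (f : I ⟶ J) {K K' : E} (k : K ⟶ K') {X X' : Over J}
    (g : X ⟶ X') :
    (Over.pullback f).map (tensorMap k g) ≫ pullbackInv f K' X' =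
      pullbackInv f K X ≫ tensorMap k ((Over.pullback f).map g) := by
  have := pullback_app_pullbackInv f K' X'
  have h := (pullback f).naturality k g
  rw [← Category.id_comp ((Over.pullback f).map _), ← pullbackInv_pullback_app]
  simp only [Category.assoc]
  rw [← reassoc_of% h, this, Category.comp_id]

lemma pullbackInv_unit {I J : E} (f : I ⟶ J) (X : Over J) :
    pullbackInv f (⊤_ E) X ≫ tensorProj _ _ = (Over.pullback f).map (tensorProj _ X) := by
  rw [← (pullback f).unit, ← Category.assoc, pullbackInv_pullback_app, Category.id_comp]

lemma pullbackInv_assoc {I J : E} (f : I ⟶ J) (K L : E) (X : Over J) :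
    (Over.pullback f).map (tensorAssoc K L X) ≫ pullbackInv f K (tensorObj L X) ≫
        tensorMap (𝟙 K) (pullbackInv f L X) =
      pullbackInv f (K ⨯ L) X ≫ tensorAssoc K L ((Over.pullback f).obj X) := by
  have h := (pullback f).assoc K L X
  rw [← Category.id_comp ((Over.pullback f).map _), ← pullbackInv_pullback_app]
  simp only [Category.assoc]
  rw [reassoc_of% h, reassoc_of% (pullback_app_pullbackInv f K (tensorObj L X)),
    ← tensorMap_comp, pullback_app_pullbackInv, Category.comp_id, tensorMap_id, Category.comp_id]

end Strength

/-- A natural transformation between strong functors is strong if it is compatible with the given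
strengths. -/
def IsStrong {I J : E} {F G : Over I ⥤ Over J} (σ : Strength F) (τ : Strength G) (φ : F ⟶ G) :
    Prop :=
  ∀ (K : E) (X : Over I),
    tensorMap (𝟙 K) (φ.app X) ≫ τ.app K X = σ.app K X ≫ φ.app (tensorObj K X)

namespace IsStrong
variable {I J L M : E}

lemma comp {F G H : Over I ⥤ Over J} {σ : Strength F} {τ : Strength G} {ρ : Strength H}
    {φ : F ⟶ G} {ψ : G ⟶ H} (hφ : IsStrong σ τ φ) (hψ : IsStrong τ ρ ψ) :
    IsStrong σ ρ (φ ≫ ψ) := fun K X ↦ by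
  rw [NatTrans.comp_app, ← Category.comp_id (𝟙 K), tensorMap_comp, Category.assoc, hψ,
    ← Category.assoc, hφ, Category.assoc, NatTrans.comp_app]

lemma inv {F G : Over I ⥤ Over J} {σ : Strength F} {τ : Strength G} {e : F ≅ G}
    (h : IsStrong σ τ e.hom) : IsStrong τ σ e.inv := fun K X ↦ by
  rw [← cancel_mono (e.hom.app _), Category.assoc, ← h, ← Category.assoc, ← tensorMap_comp]
  simp [tensorMap_id]

lemma whiskerLeft {F : Over I ⥤ Over J} {G H : Over J ⥤ Over L} (σ : Strength F) {τ : Strength G}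
    {ρ : Strength H} {ψ : G ⟶ H} (h : IsStrong τ ρ ψ) :
    IsStrong (σ.comp τ) (σ.comp ρ) (Functor.whiskerLeft F ψ) := fun K X ↦ by
  simp only [Strength.comp, Functor.whiskerLeft_app, Category.assoc, ψ.naturality]
  rw [← Category.assoc, h, Category.assoc]

lemma whiskerRight {F G : Over I ⥤ Over J} {H : Over J ⥤ Over L} {σ : Strength F} {τ : Strength G}
    {φ : F ⟶ G} (h : IsStrong σ τ φ) (ρ : Strength H) :
    IsStrong (σ.comp ρ) (τ.comp ρ) (Functor.whiskerRight φ H) := fun K X ↦ by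
  simp only [Strength.comp, Functor.whiskerRight_app, Category.assoc]
  rw [← H.map_comp, ← h, H.map_comp, ← Category.assoc, ρ.naturality, Category.assoc]

lemma associator {F : Over I ⥤ Over J} {G : Over J ⥤ Over L} {H : Over L ⥤ Over M}
    (σ : Strength F) (τ : Strength G) (ρ : Strength H) :
    IsStrong ((σ.comp τ).comp ρ) (σ.comp (τ.comp ρ)) (Functor.associator F G H).hom :=
  fun K X ↦ by simp [Strength.comp, tensorMap_id]

lemma leftUnitor {F : Over I ⥤ Over J} (σ : Strength F) :
    IsStrong ((Strength.id I).comp σ) σ F.leftUnitor.hom :=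
  fun K X ↦ by simp [Strength.comp, Strength.id, tensorMap_id]

lemma rightUnitor {F : Over I ⥤ Over J} (σ : Strength F) :
    IsStrong (σ.comp (Strength.id J)) σ F.rightUnitor.hom :=
  fun K X ↦ by simp [Strength.comp, Strength.id, tensorMap_id]

lemma mapId (I : E) : IsStrong (Strength.depSum (𝟙 I)) (Strength.id I) (Over.mapId I).hom :=
  fun K X ↦ by
    ext; apply tensor_hom_ext <;> simp [Strength.depSum, Strength.id]

lemma mapComp (u : I ⟶ J) (v : J ⟶ L) :
    IsStrong (Strength.depSum (u ≫ v)) ((Strength.depSum u).comp (Strength.depSum v))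
      (Over.mapComp u v).hom :=
  fun K X ↦ by
    ext; apply tensor_hom_ext <;> simp [Strength.depSum, Strength.comp]

end IsStrong
/-- `E` is locally cartesian closed: every pullback functor `f^*` has a right adjoint. -/
class LocallyCartesianClosed (E : Type u) [Category.{v} E] [HasFiniteLimits E] : Prop where
  isLeftAdjoint {A B : E} (f : B ⟶ A) : (Over.pullback f).IsLeftAdjoint

attribute [instance] LocallyCartesianClosed.isLeftAdjoint

variable [LocallyCartesianClosed E]

/-- The dependent product functor `Π_f`, the right adjoint of `f^*`. -/
def depProd {A B : E} (f : B ⟶ A) : Over B ⥤ Over A := (Over.pullback f).rightAdjoint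

/-- The adjunction between `f^*` and `Π_f`. -/
def depProdAdj {A B : E} (f : B ⟶ A) : Over.pullback f ⊣ depProd f :=
  Adjunction.ofIsLeftAdjoint (Over.pullback f)

namespace Strength

/-- The counit `f^* Π_f X ⟶ X`. -/
def ev {A B : E} (f : B ⟶ A) (X : Over B) : (Over.pullback f).obj ((depProd f).obj X) ⟶ X :=
  (depProdAdj f).counit.app X

lemma ev_naturality {A B : E} (f : B ⟶ A) {X Y : Over B} (g : X ⟶ Y) :
    (Over.pullback f).map ((PolynomialFunctors.depProd f).map g) ≫ ev f Y = ev f X ≫ g :=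
  (depProdAdj f).counit.naturality g

/-- The transpose `Y ⟶ Π_f X` of a map `f^* Y ⟶ X`. -/
def curry {A B : E} (f : B ⟶ A) {Y : Over A} {X : Over B}
    (g : (Over.pullback f).obj Y ⟶ X) : Y ⟶ (PolynomialFunctors.depProd f).obj X :=
  (depProdAdj f).homEquiv Y X g

lemma curry_ev {A B : E} (f : B ⟶ A) {Y : Over A} {X : Over B}
    (g : (Over.pullback f).obj Y ⟶ X) : (Over.pullback f).map (curry f g) ≫ ev f X = g :=
  ((depProdAdj f).homEquiv_counit _ _ _).symm.trans (((depProdAdj f).homEquiv Y X).symm_apply_apply g)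

lemma depProd_hom_ext {A B : E} (f : B ⟶ A) {Y : Over A} {X : Over B}
    {a b : Y ⟶ (PolynomialFunctors.depProd f).obj X}
    (h : (Over.pullback f).map a ≫ ev f X = (Over.pullback f).map b ≫ ev f X) : a = b :=
  ((depProdAdj f).homEquiv Y X).symm.injective
    ((((depProdAdj f).homEquiv_counit _ _ _).trans h).trans ((depProdAdj f).homEquiv_counit _ _ _).symm)

/-- The strength map `K ⊗ Π_f X ⟶ Π_f (K ⊗ X)`: the transpose of the composite
`f^* (K ⊗ Π_f X) ≅ K ⊗ f^* Π_f X ⟶ K ⊗ X`. -/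
def depProdApp {A B : E} (f : B ⟶ A) (K : E) (X : Over B) :
    tensorObj K ((PolynomialFunctors.depProd f).obj X) ⟶
      (PolynomialFunctors.depProd f).obj (tensorObj K X) :=
  curry f (pullbackInv f K _ ≫ tensorMap (𝟙 K) (ev f X))

lemma depProdApp_ev {A B : E} (f : B ⟶ A) (K : E) (X : Over B) :
    (Over.pullback f).map (depProdApp f K X) ≫ ev f _ =
      pullbackInv f K _ ≫ tensorMap (𝟙 K) (ev f X) := curry_ev f _

/-- The canonical strength of the dependent product functor. -/
def depProd {A B : E} (f : B ⟶ A) : Strength (depProd f) where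
  app K X := depProdApp f K X
  naturality k X X' g := by
    apply depProd_hom_ext
    simp only [Functor.map_comp, Category.assoc, depProdApp_ev, ev_naturality]
    rw [← Category.assoc, pullbackInv_naturality, Category.assoc, ← tensorMap_comp,
      ev_naturality, reassoc_of% (depProdApp_ev f), ← tensorMap_comp]
    simp
  unit X := by
    apply depProd_hom_ext
    simp only [Functor.map_comp, Category.assoc, ev_naturality]
    rw [reassoc_of% (depProdApp_ev f), ← pullbackInv_unit, Category.assoc]
    congr 1
    ext; simp [-Over.pullback_obj_left]
  assoc K L X := by
    apply depProd_hom_ext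
    simp only [Functor.map_comp, Category.assoc, ev_naturality, depProdApp_ev]
    rw [reassoc_of% (depProdApp_ev f), ← Category.assoc ((Over.pullback f).map (tensorMap _ _)),
      pullbackInv_naturality]
    simp only [Category.assoc]
    rw [← tensorMap_comp, depProdApp_ev, tensorMap_comp, reassoc_of% pullbackInv_assoc]
    congr 1
    ext; apply tensor_hom_ext
    · simp [tensorAssoc]
    · apply tensor_hom_ext <;> simp [tensorAssoc]

end Strength

/-- A polynomial from `I` to `J`: a diagram `I ⟵ B ⟶ A ⟶ J` with legs `s`, `f`, `t`. -/
structure Poly (I J : E) where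
  B : E
  A : E
  s : B ⟶ I
  f : B ⟶ A
  t : A ⟶ J

namespace Poly

/-- The extension `Σ_t Π_f s^*` of a polynomial. -/
def extension {I J : E} (p : Poly I J) : Over I ⥤ Over J :=
  Over.pullback p.s ⋙ depProd p.f ⋙ Over.map p.t

/-- The canonical strength of the extension of a polynomial. -/
def strength {I J : E} (p : Poly I J) : Strength p.extension :=
  (Strength.pullback p.s).comp ((Strength.depProd p.f).comp (Strength.depSum p.t))
end Poly

/-- A strong functor between slices is a polynomial functor if it is isomorphic, by a strong natural
isomorphism, to the extension of a polynomial. -/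
def IsPolynomial {I J : E} {F : Over I ⥤ Over J} (σ : Strength F) : Prop :=
  ∃ (p : Poly I J) (e : p.extension ≅ F), IsStrong p.strength σ e.hom

variable (E) in
/-- `E` has W-types: every polynomial functor in a single variable (the extension of a polynomial
`1 ⟵ B ⟶ A ⟶ 1`) has an initial algebra. -/
class HasWTypes : Prop where
  hasInitial (p : Poly (⊤_ E) (⊤_ E)) : HasInitial (Endofunctor.Algebra p.extension)

lemma isPullback_map {I J : E} (u : I ⟶ J) {W X Y Z : Over I} {a : W ⟶ X} {b : W ⟶ Y}
    {c : X ⟶ Z} {d : Y ⟶ Z} (h : IsPullback a b c d) :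
    IsPullback ((Over.map u).map a) ((Over.map u).map b) ((Over.map u).map c)
      ((Over.map u).map d) := by
  have h' := h.map (Over.forget I)
  have h2 : CommSq ((Over.map u).map a) ((Over.map u).map b) ((Over.map u).map c)
      ((Over.map u).map d) := h.toCommSq.map (Over.map u)
  exact IsPullback.of_map (Over.forget J) h2.w h'

lemma equifibered_whiskerRight_map {I J L : E} {F G : Over I ⥤ Over J} {φ : F ⟶ G}
    (h : NatTrans.Equifibered φ) (u : J ⟶ L) :
    NatTrans.Equifibered (Functor.whiskerRight φ (Over.map u)) :=
  fun _ _ f ↦ isPullback_map u (h f)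

variable (E) in
/-- An object of the category of polynomial endofunctors: an object `base` of `E` and a polynomial
endofunctor (with its strength) of the slice over it. -/
structure PolyEnd where
  base : E
  functor : Over base ⥤ Over base
  strength : Strength functor
  isPolynomial : IsPolynomial strength

namespace PolyEnd

/-- A morphism `(I', P') ⟶ (I, P)` of polynomial endofunctors: a map `u : I' ⟶ I` of `E` and a
cartesian strong natural transformation `φ : Σ_u P' ⟶ P Σ_u`. A natural transformation is cartesian
if all its naturality squares are pullbacks, which is `NatTrans.Equifibered`. -/
structure Hom (P Q : PolyEnd E) where
  base : P.base ⟶ Q.base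
  nat : P.functor ⋙ Over.map base ⟶ Over.map base ⋙ Q.functor
  cartesian : NatTrans.Equifibered nat
  strong : IsStrong (P.strength.comp (Strength.depSum base))
    ((Strength.depSum base).comp Q.strength) nat

lemma Hom.ext_of_app {P Q : PolyEnd E} {f g : Hom P Q} (h : f.base = g.base)
    (h' : ∀ X, f.nat.app X ≫ Q.functor.map ((Over.mapCongr _ _ h).hom.app X) =
      (Over.mapCongr _ _ h).hom.app (P.functor.obj X) ≫ g.nat.app X) : f = g := by
  obtain ⟨u, φ, _, _⟩ := f
  obtain ⟨v, ψ, _, _⟩ := g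
  obtain rfl : u = v := h
  obtain rfl : φ = ψ := by
    ext X : 2
    have e (Y : Over P.base) : (Over.mapCongr u u rfl).hom.app Y = 𝟙 _ := by ext; simp
    have := h' X
    rw [e, e, Q.functor.map_id] at this
    exact (Category.comp_id _).symm.trans (this.trans (Category.id_comp _))
  rfl

/-- A cartesian strong natural transformation between polynomial endofunctors of the same slice,
as a morphism over the identity map (up to the canonical isomorphism of `Σ_id` with the identity
functor). -/
def Hom.ofFibre {I : E} {F G : Over I ⥤ Over I} {σ : Strength F} {τ : Strength G}
    (hF : IsPolynomial σ) (hG : IsPolynomial τ) (α : F ⟶ G) (hc : NatTrans.Equifibered α)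
    (hs : IsStrong σ τ α) : Hom ⟨I, F, σ, hF⟩ ⟨I, G, τ, hG⟩ where
  base := 𝟙 I
  nat := Functor.whiskerLeft F (Over.mapId I).hom ≫ F.rightUnitor.hom ≫ α ≫
    G.leftUnitor.inv ≫ Functor.whiskerRight (Over.mapId I).inv G
  cartesian := (NatTrans.Equifibered.of_isIso _).comp <| (NatTrans.Equifibered.of_isIso _).comp <|
    hc.comp <| (NatTrans.Equifibered.of_isIso _).comp <| NatTrans.Equifibered.of_isIso _
  strong := ((IsStrong.mapId I).whiskerLeft σ).comp <| (IsStrong.rightUnitor σ).comp <|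
    hs.comp <| (IsStrong.leftUnitor τ).inv.comp <| (IsStrong.mapId I).inv.whiskerRight τ

/-- Vertical pasting of squares: `Σ_v Σ_u P ⟶ Σ_v Q Σ_u ⟶ R Σ_v Σ_u`, up to the canonical
isomorphism of `Σ_(u ≫ v)` with the composite of `Σ_u` and `Σ_v`. -/
def Hom.comp {P Q R : PolyEnd E} (f : Hom P Q) (g : Hom Q R) : Hom P R where
  base := f.base ≫ g.base
  nat := Functor.whiskerLeft P.functor (Over.mapComp f.base g.base).hom ≫
    (Functor.associator _ _ _).inv ≫ Functor.whiskerRight f.nat (Over.map g.base) ≫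
    (Functor.associator _ _ _).hom ≫ Functor.whiskerLeft (Over.map f.base) g.nat ≫
    (Functor.associator _ _ _).inv ≫
    Functor.whiskerRight (Over.mapComp f.base g.base).inv R.functor
  cartesian := (NatTrans.Equifibered.of_isIso _).comp <| (NatTrans.Equifibered.of_isIso _).comp <|
    (equifibered_whiskerRight_map f.cartesian g.base).comp <|
    (NatTrans.Equifibered.of_isIso _).comp <| (g.cartesian.whiskerLeft _).comp <|
    (NatTrans.Equifibered.of_isIso _).comp <| NatTrans.Equifibered.of_isIso _
  strong := ((IsStrong.mapComp f.base g.base).whiskerLeft P.strength).comp <|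
    (IsStrong.associator _ _ _).inv.comp <| (f.strong.whiskerRight _).comp <|
    (IsStrong.associator _ _ _).comp <| (g.strong.whiskerLeft _).comp <|
    (IsStrong.associator _ _ _).inv.comp <| (IsStrong.mapComp f.base g.base).inv.whiskerRight _

lemma Hom.comp_app {P Q R : PolyEnd E} (f : Hom P Q) (g : Hom Q R) (X : Over P.base) :
    (f.comp g).nat.app X = (Over.mapComp f.base g.base).hom.app (P.functor.obj X) ≫
      (Over.map g.base).map (f.nat.app X) ≫ g.nat.app ((Over.map f.base).obj X) ≫
      R.functor.map ((Over.mapComp f.base g.base).inv.app X) := by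
  simp [Hom.comp]

lemma Hom.ofFibre_app {I : E} {F G : Over I ⥤ Over I} {σ : Strength F} {τ : Strength G}
    (hF : IsPolynomial σ) (hG : IsPolynomial τ) (α : F ⟶ G) (hc : NatTrans.Equifibered α)
    (hs : IsStrong σ τ α) (X : Over I) :
    (Hom.ofFibre hF hG α hc hs).nat.app X = (Over.mapId I).hom.app (F.obj X) ≫ α.app X ≫
      G.map ((Over.mapId I).inv.app X) := by
  simp [Hom.ofFibre]

/-- The identity morphism of a polynomial endofunctor. -/
def Hom.id (P : PolyEnd E) : Hom P P :=
  Hom.ofFibre P.isPolynomial P.isPolynomial (𝟙 P.functor) (.of_isIso _)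
    (fun K X ↦ by simp [tensorMap_id])

lemma Hom.id_app (P : PolyEnd E) (X : Over P.base) :
    (Hom.id P).nat.app X = (Over.mapId P.base).hom.app (P.functor.obj X) ≫
      P.functor.map ((Over.mapId P.base).inv.app X) := by
  simp [Hom.id, Hom.ofFibre]

lemma Hom.nat_naturality {P Q : PolyEnd E} (f : Hom P Q) {X Y : Over P.base} (k : X ⟶ Y) :
    (Over.map f.base).map (P.functor.map k) ≫ f.nat.app Y =
      f.nat.app X ≫ Q.functor.map ((Over.map f.base).map k) :=
  f.nat.naturality k

lemma coh_id_left {I J : E} (u : I ⟶ J) (Y : Over I) :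
    (Over.mapComp (𝟙 I) u).hom.app Y ≫ (Over.map u).map ((Over.mapId I).hom.app Y) =
      (Over.mapCongr _ _ (Category.id_comp u)).hom.app Y := by
  ext; simp

lemma coh_id_left_inv {I J : E} (u : I ⟶ J) (Y : Over I) :
    (Over.map u).map ((Over.mapId I).inv.app Y) ≫ (Over.mapComp (𝟙 I) u).inv.app Y ≫
      (Over.mapCongr _ _ (Category.id_comp u)).hom.app Y = 𝟙 _ := by
  ext; simp

lemma coh_id_right {I J : E} (u : I ⟶ J) (Y : Over I) {Z : Over J} (k : (Over.map u).obj Y ⟶ Z) :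
    (Over.mapComp u (𝟙 J)).hom.app Y ≫ (Over.map (𝟙 J)).map k ≫ (Over.mapId J).hom.app Z =
      (Over.mapCongr _ _ (Category.comp_id u)).hom.app Y ≫ k := by
  ext; simp

lemma coh_id_right_inv {I J : E} (u : I ⟶ J) (Y : Over I) :
    (Over.mapId J).inv.app ((Over.map u).obj Y) ≫ (Over.mapComp u (𝟙 J)).inv.app Y ≫
      (Over.mapCongr _ _ (Category.comp_id u)).hom.app Y = 𝟙 _ := by
  ext; simp

lemma coh_assoc {I J K L : E} (u : I ⟶ J) (v : J ⟶ K) (w : K ⟶ L) (Y : Over I) {Z : Over J}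
    (k : (Over.map u).obj Y ⟶ Z) :
    (Over.mapComp (u ≫ v) w).hom.app Y ≫ (Over.map w).map ((Over.mapComp u v).hom.app Y) ≫
        (Over.map w).map ((Over.map v).map k) =
      (Over.mapCongr _ _ (Category.assoc u v w)).hom.app Y ≫
        (Over.mapComp u (v ≫ w)).hom.app Y ≫ (Over.map (v ≫ w)).map k ≫
        (Over.mapComp v w).hom.app Z := by
  ext; simp

lemma coh_assoc_inv {I J K L : E} (u : I ⟶ J) (v : J ⟶ K) (w : K ⟶ L) (Y : Over I) :
    (Over.map w).map ((Over.mapComp u v).inv.app Y) ≫ (Over.mapComp (u ≫ v) w).inv.app Y ≫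
        (Over.mapCongr _ _ (Category.assoc u v w)).hom.app Y =
      (Over.mapComp v w).inv.app ((Over.map u).obj Y) ≫ (Over.mapComp u (v ≫ w)).inv.app Y := by
  ext; simp

instance : Category (PolyEnd E) where
  Hom := Hom
  id := Hom.id
  comp := Hom.comp
  id_comp {P Q} f := by
    refine Hom.ext_of_app (Category.id_comp f.base) fun X ↦ ?_
    rw [Hom.comp_app, Hom.id_app]
    dsimp only [Hom.comp, Hom.id, Hom.ofFibre]
    simp only [Functor.map_comp, Category.assoc]
    rw [reassoc_of% (f.nat_naturality), ← Functor.map_comp, ← Functor.map_comp, ← Category.assoc,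
      coh_id_left, coh_id_left_inv]
    exact congrArg _ ((congrArg _ (Q.functor.map_id _)).trans (Category.comp_id _))
  comp_id {P Q} f := by
    refine Hom.ext_of_app (Category.comp_id f.base) fun X ↦ ?_
    rw [Hom.comp_app, Hom.id_app]
    dsimp only [Hom.comp, Hom.id, Hom.ofFibre]
    simp only [Category.assoc]
    rw [reassoc_of% (coh_id_right f.base (P.functor.obj X) (f.nat.app X)), ← Functor.map_comp,
      ← Functor.map_comp]
    have h := coh_id_right_inv f.base X
    rw [h]
    exact congrArg _ ((congrArg _ (Q.functor.map_id _)).trans (Category.comp_id _))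
  assoc {P Q R S} f g h := by
    refine Hom.ext_of_app (Category.assoc f.base g.base h.base) fun X ↦ ?_
    rw [Hom.comp_app, Hom.comp_app, Hom.comp_app, Hom.comp_app]
    dsimp only [Hom.comp, Hom.id, Hom.ofFibre]
    simp only [Functor.map_comp, Category.assoc]
    rw [reassoc_of% (h.nat_naturality)]
    rw [reassoc_of% (coh_assoc f.base g.base h.base (P.functor.obj X) (f.nat.app X))]
    simp only [← Functor.map_comp]
    rw [coh_assoc_inv]

end PolyEnd

/-- A polynomial monad on the slice over `I`: a monad whose functor is a (strong) polynomial functor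
and whose unit and multiplication are cartesian strong natural transformations. -/
structure PolynomialMonad (I : E) where
  monad : CategoryTheory.Monad (Over I)
  strength : Strength monad.toFunctor
  isPolynomial : IsPolynomial strength
  unit_cartesian : NatTrans.Equifibered monad.η
  mul_cartesian : NatTrans.Equifibered monad.μ
  unit_strong : IsStrong (Strength.id I) strength monad.η
  mul_strong : IsStrong (strength.comp strength) strength monad.μ

variable (E) in
/-- An object of the category of polynomial monads: an object `base` of `E` and a polynomial monad
on the slice over it. -/
structure PolyMnd where
  base : E
  mon : PolynomialMonad base

namespace PolyMnd

/-- The underlying polynomial endofunctor of a polynomial monad. -/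
def toPolyEnd (T : PolyMnd E) : PolyEnd E where
  base := T.base
  functor := T.mon.monad.toFunctor
  strength := T.mon.strength
  isPolynomial := T.mon.isPolynomial

/-- The underlying monad. -/
abbrev monad (T : PolyMnd E) : CategoryTheory.Monad (Over T.base) := T.mon.monad

/-- The monad map axioms for `φ : Σ_u S ⟶ T Σ_u`:
`φ ∘ Σ_u η = η Σ_u` and `φ ∘ Σ_u μ = μ Σ_u ∘ T φ ∘ φ S`. -/
def IsMonadMap {S T : PolyMnd E} (u : S.base ⟶ T.base)
    (φ : S.monad.toFunctor ⋙ Over.map u ⟶ Over.map u ⋙ T.monad.toFunctor) : Prop :=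
  (∀ X : Over S.base,
    (Over.map u).map (S.monad.η.app X) ≫ φ.app X = T.monad.η.app ((Over.map u).obj X)) ∧
  (∀ X : Over S.base,
    (Over.map u).map (S.monad.μ.app X) ≫ φ.app X =
      φ.app (S.monad.obj X) ≫ T.monad.map (φ.app X) ≫ T.monad.μ.app ((Over.map u).obj X))

/-- A morphism of polynomial monads: a morphism of the underlying polynomial endofunctors satisfying
the monad map axioms. -/
@[ext]
structure Hom (S T : PolyMnd E) where
  toHom : S.toPolyEnd ⟶ T.toPolyEnd
  isMonadMap : IsMonadMap toHom.base toHom.nat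

lemma monad_map_unit_id {I : E} (T : CategoryTheory.Monad (Over I)) (X : Over I) :
    (Over.map (𝟙 I)).map (T.η.app X) ≫ (Over.mapId I).hom.app (T.obj X) ≫
      T.map ((Over.mapId I).inv.app X) = T.η.app ((Over.map (𝟙 I)).obj X) := by
  have h := (Over.mapId I).hom.naturality (T.η.app X)
  have h' := T.η.naturality ((Over.mapId I).inv.app X)
  dsimp at h h'
  rw [reassoc_of% h, ← h', Iso.hom_inv_id_app_assoc]

lemma monad_map_mul_id {I : E} (T : CategoryTheory.Monad (Over I)) (X : Over I)
    (φ : (Over.map (𝟙 I)).obj (T.obj X) ⟶ T.obj ((Over.map (𝟙 I)).obj X))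
    (hφ : φ = (Over.mapId I).hom.app (T.obj X) ≫ T.map ((Over.mapId I).inv.app X))
    (ψ : (Over.map (𝟙 I)).obj (T.obj (T.obj X)) ⟶ T.obj ((Over.map (𝟙 I)).obj (T.obj X)))
    (hψ : ψ = (Over.mapId I).hom.app (T.obj (T.obj X)) ≫
      T.map ((Over.mapId I).inv.app (T.obj X))) :
    (Over.map (𝟙 I)).map (T.μ.app X) ≫ φ =
      ψ ≫ T.map φ ≫ T.μ.app ((Over.map (𝟙 I)).obj X) := by
  subst hφ hψ
  have h := (Over.mapId I).hom.naturality (T.μ.app X)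
  have h' := T.μ.naturality ((Over.mapId I).inv.app X)
  dsimp at h h'
  rw [reassoc_of% h, ← h']
  simp only [Functor.map_comp, Category.assoc]
  rw [← T.map_comp_assoc ((Over.mapId I).inv.app _), Iso.inv_hom_id_app]
  simp

lemma IsMonadMap.id (T : PolyMnd E) :
    IsMonadMap (S := T) (T := T) (PolyEnd.Hom.id T.toPolyEnd).base
      (PolyEnd.Hom.id T.toPolyEnd).nat :=
  ⟨fun X ↦ (congrArg _ (PolyEnd.Hom.id_app T.toPolyEnd X)).trans (monad_map_unit_id T.monad X),
    fun X ↦ monad_map_mul_id T.monad X _ (PolyEnd.Hom.id_app T.toPolyEnd X) _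
      (PolyEnd.Hom.id_app T.toPolyEnd (T.monad.obj X))⟩

lemma IsMonadMap.comp {S T R : PolyMnd E} (f : PolyEnd.Hom S.toPolyEnd T.toPolyEnd)
    (g : PolyEnd.Hom T.toPolyEnd R.toPolyEnd) (hf : IsMonadMap f.base f.nat)
    (hg : IsMonadMap g.base g.nat) :
    IsMonadMap (S := S) (T := R) (f.comp g).base (f.comp g).nat := by
  have key (X : Over S.base) := PolyEnd.Hom.comp_app f g X
  obtain ⟨u, φ, hc, hs⟩ := f
  obtain ⟨v, ψ, hc', hs'⟩ := g
  set χ := (PolyEnd.Hom.comp ⟨u, φ, hc, hs⟩ ⟨v, ψ, hc', hs'⟩).nat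
  change S.base ⟶ T.base at u
  change T.base ⟶ R.base at v
  change S.monad.toFunctor ⋙ Over.map u ⟶ Over.map u ⋙ T.monad.toFunctor at φ
  change T.monad.toFunctor ⋙ Over.map v ⟶ Over.map v ⋙ R.monad.toFunctor at ψ
  change S.monad.toFunctor ⋙ Over.map (u ≫ v) ⟶ Over.map (u ≫ v) ⋙ R.monad.toFunctor at χ
  change ∀ X : Over S.base, χ.app X = (Over.mapComp u v).hom.app (S.monad.obj X) ≫
      (Over.map v).map (φ.app X) ≫ ψ.app ((Over.map u).obj X) ≫
      R.monad.map ((Over.mapComp u v).inv.app X) at key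
  change IsMonadMap (S := S) (T := R) (u ≫ v) χ
  change IsMonadMap (S := S) (T := T) u φ at hf
  change IsMonadMap (S := T) (T := R) v ψ at hg
  constructor
  · intro X
    have h := (Over.mapComp u v).hom.naturality (S.monad.η.app X)
    have h' := R.monad.η.naturality ((Over.mapComp u v).inv.app X)
    dsimp at h h'
    rw [key, reassoc_of% h, ← Functor.map_comp_assoc, hf.1, reassoc_of% (hg.1), ← h',
      Iso.hom_inv_id_app_assoc]
  · intro X
    have h := (Over.mapComp u v).hom.naturality (S.monad.μ.app X)
    have h' := R.monad.μ.naturality ((Over.mapComp u v).inv.app X)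
    have h₂ := ψ.naturality (φ.app X)
    dsimp at h h' h₂
    rw [key, key, reassoc_of% h, ← Functor.map_comp_assoc, hf.2]
    simp only [Functor.map_comp, Category.assoc]
    rw [reassoc_of% (hg.2), ← h']
    rw [← R.monad.map_comp_assoc ((Over.mapComp u v).inv.app _), Iso.inv_hom_id_app]
    have e := R.monad.map_id ((Over.map v).obj ((Over.map u).obj (S.monad.obj X)))
    dsimp only [Functor.comp_obj]
    rw [e, Category.id_comp, reassoc_of% h₂]

instance : Category (PolyMnd E) where
  Hom := Hom
  id T := ⟨𝟙 T.toPolyEnd, IsMonadMap.id T⟩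
  comp f g := ⟨f.toHom ≫ g.toHom, IsMonadMap.comp _ _ f.isMonadMap g.isMonadMap⟩
  id_comp f := Hom.ext (Category.id_comp f.toHom)
  comp_id f := Hom.ext (Category.comp_id f.toHom)
  assoc f g h := Hom.ext (Category.assoc f.toHom g.toHom h.toHom)

end PolyMnd

variable (E) in
/-- The forgetful functor from polynomial monads to polynomial endofunctors. -/
def polyForget : PolyMnd E ⥤ PolyEnd E where
  obj T := T.toPolyEnd
  map f := f.toHom

/-- `T`, with `α : P ⟶ T`, is the free monad on the endofunctor `P` of `C`: every natural
transformation from `P` to a monad factors through `α` by a unique monad morphism. -/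
def IsFreeMonad {C : Type u} [Category.{v} C] (P : C ⥤ C) (T : CategoryTheory.Monad C)
    (α : P ⟶ T.toFunctor) : Prop :=
  ∀ (T' : CategoryTheory.Monad C) (φ : P ⟶ T'.toFunctor),
    ∃! ψ : T ⟶ T', α ≫ ψ.toNatTrans = φ

end

end PolynomialFunctors

open PolynomialFunctors

/-! ### Pullback squares in slices, and generalized elements of dependent products. -/

namespace PolynomialFunctors

noncomputable section

variable {E : Type u} [Category.{v} E] [HasFiniteLimits E]

/-! The free monad on `P` sends `X` to the free `P`-algebra on `X`, the initial algebra of `X + P`,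
whose elements are well-founded trees of operations of `P` with leaves in `X`. It must be shown that
these algebras exist, that they form a polynomial functor, and that the universal property holds for
morphisms that change the base, inside the cartesian strong transformations.

The main tool is `existsUnique_rec`. If a structure `c` lies over a free algebra `W`, and the parts
of `c` over the constructors of `W` are pullbacks, then maps out of `c` may be defined by recursion.
The structure may live in another slice and over another functor, as long as a cartesian
transformation relates the two functors. The proof needs only local cartesian closure: the recursion
is run on `W`, with values in functions on the fibres of `c`.

Existence. W-types are assumed in one variable only. Forgetting types gives a one-variable
polynomial, and the trees over `I` are cut out of its W-type by an equalizer: a tree is well typed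
when labelling its nodes by their own types agrees with labelling them by the types their parents
expect (`Poly.exists_isInitialAlgebra`). By extensivity `X + P` is again polynomial, so free
algebras exist (`Poly.exists_isFreeAlgebra`).

Polynomiality. Let `W` be the free algebra on the terminal object of the slice, the object of tree
shapes. The leaves of shapes are themselves a free algebra, in the slice over `W`, for the functor
saying that a leaf of a composite tree is a leaf of one of its immediate subtrees
(`Poly.exists_leaves`). The polynomial `q` with shapes as labels and leaves as positions computes
free algebras: `q X` lies over `W`, with unit and action pulled back from those of `W`, so recursion
applies (`Poly.Leaves.nonempty_freeFunctor`).

Universal property. Given `φ : Σ_u P ⟶ T' Σ_u`, the adjunction `Σ_u ⊣ u^*` makes `u^* T' Σ_u X` a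
`P`-algebra under `X`, and the induced map from the free algebra transposes to the extension of `φ`
(`FreeFunctor.extend`). The monad map axioms together with compatibility with `φ` are equivalent to
the recursion equations (`FreeFunctor.isMonadMap_iff`), which gives uniqueness. The extension is
cartesian because certain pullbacks of free algebras are again free (`FreeFunctor.lift_cartesian`),
and strong because `K ⊗ T X` lies over `T X` in the way recursion requires
(`FreeFunctor.lift_strong`). The universal arrows assemble to the left adjoint. -/

/-- A square of a slice is a pullback if its image in the base category is one. -/
lemma isPullback_of_left {I : E} {W X Y Z : Over I} {a : W ⟶ X} {b : W ⟶ Y}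
    {c : X ⟶ Z} {d : Y ⟶ Z} (h : IsPullback a.left b.left c.left d.left) :
    IsPullback a b c d :=
  IsPullback.of_map (Over.forget I) (Over.OverMorphism.ext h.w) h

/-- The image in the base category of a pullback square of a slice. -/
lemma isPullback_left {I : E} {W X Y Z : Over I} {a : W ⟶ X} {b : W ⟶ Y}
    {c : X ⟶ Z} {d : Y ⟶ Z} (h : IsPullback a b c d) :
    IsPullback a.left b.left c.left d.left :=
  h.map (Over.forget I)

/-- A square is a pullback as soon as it has the universal property. -/
lemma isPullback_of_exists {C : Type*} [Category* C] {W X Y Z : C} {a : W ⟶ X} {b : W ⟶ Y}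
    {c : X ⟶ Z} {d : Y ⟶ Z} (w : a ≫ c = b ≫ d)
    (hex : ∀ {V : C} (x : V ⟶ X) (y : V ⟶ Y), x ≫ c = y ≫ d → ∃ k : V ⟶ W, k ≫ a = x ∧ k ≫ b = y)
    (huniq : ∀ {V : C} (k k' : V ⟶ W), k ≫ a = k' ≫ a → k ≫ b = k' ≫ b → k = k') :
    IsPullback a b c d := by
  refine ⟨⟨w⟩, ⟨PullbackCone.IsLimit.mk _ (fun s ↦ (hex s.fst s.snd s.condition).choose)
    (fun s ↦ (hex s.fst s.snd s.condition).choose_spec.1)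
    (fun s ↦ (hex s.fst s.snd s.condition).choose_spec.2) fun s m h₁ h₂ ↦ ?_⟩⟩
  exact huniq _ _ (h₁.trans (hex s.fst s.snd s.condition).choose_spec.1.symm)
    (h₂.trans (hex s.fst s.snd s.condition).choose_spec.2.symm)

variable [LocallyCartesianClosed E]

/-- The map into the domain of `f^* X` with the two given components. -/
def pbLift {A B : E} {f : B ⟶ A} {X : Over A} {N : E} (n : N ⟶ X.left) (b : N ⟶ B)
    (h : n ≫ X.hom = b ≫ f) : N ⟶ ((Over.pullback f).obj X).left :=
  pullback.lift n b h

@[simp] lemma pbLift_fst {A B : E} {f : B ⟶ A} {X : Over A} {N : E} (n : N ⟶ X.left) (b : N ⟶ B)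
    (h : n ≫ X.hom = b ≫ f) : pbLift n b h ≫ Strength.pullbackFst f X = n :=
  pullback.lift_fst _ _ _

@[simp] lemma pbLift_hom {A B : E} {f : B ⟶ A} {X : Over A} {N : E} (n : N ⟶ X.left) (b : N ⟶ B)
    (h : n ≫ X.hom = b ≫ f) : pbLift n b h ≫ ((Over.pullback f).obj X).hom = b :=
  pullback.lift_snd _ _ _

lemma pbLift_map {A B : E} {f : B ⟶ A} {X Y : Over A} {N : E} (n : N ⟶ X.left) (b : N ⟶ B)
    (h : n ≫ X.hom = b ≫ f) (k : X ⟶ Y) :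
    pbLift n b h ≫ ((Over.pullback f).map k).left = pbLift (n ≫ k.left) b (by simpa using h) := by
  apply Strength.pullback_hom_ext_left
  · rw [Category.assoc, Strength.pullback_map_fst, ← Category.assoc, pbLift_fst, pbLift_fst]
  · rw [Category.assoc, Over.w, pbLift_hom, pbLift_hom]

lemma comp_pbLift {A B : E} {f : B ⟶ A} {X : Over A} {M N : E} (m : M ⟶ N) (n : N ⟶ X.left)
    (b : N ⟶ B) (h : n ≫ X.hom = b ≫ f) :
    m ≫ pbLift n b h = pbLift (m ≫ n) (m ≫ b) (by simp [h]) := by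
  apply Strength.pullback_hom_ext_left
  · rw [Category.assoc, pbLift_fst, pbLift_fst]
  · rw [Category.assoc, pbLift_hom, pbLift_hom]

/-- The value of an element of a dependent product. -/
def piApp {A B : E} {f : B ⟶ A} {Y : Over B} {N : E} (n : N ⟶ ((depProd f).obj Y).left)
    (b : N ⟶ B) (h : n ≫ ((depProd f).obj Y).hom = b ≫ f) : N ⟶ Y.left :=
  pbLift n b h ≫ (Strength.ev f Y).left

lemma piApp_hom {A B : E} {f : B ⟶ A} {Y : Over B} {N : E} (n : N ⟶ ((depProd f).obj Y).left)
    (b : N ⟶ B) (h : n ≫ ((depProd f).obj Y).hom = b ≫ f) : piApp n b h ≫ Y.hom = b := by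
  rw [piApp, Category.assoc, Over.w, pbLift_hom]

lemma piApp_comp {A B : E} {f : B ⟶ A} {D : Over A} {Y : Over B} {N : E}
    (k : D ⟶ (depProd f).obj Y) (m : N ⟶ D.left) (b : N ⟶ B)
    (h : (m ≫ k.left) ≫ ((depProd f).obj Y).hom = b ≫ f) :
    piApp (m ≫ k.left) b h = pbLift m b (by simpa using h) ≫
      ((Over.pullback f).map k ≫ Strength.ev f Y).left := by
  rw [piApp, Over.comp_left, ← Category.assoc, pbLift_map]

lemma comp_piApp {A B : E} {f : B ⟶ A} {Y : Over B} {M N : E} (m : M ⟶ N)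
    (n : N ⟶ ((depProd f).obj Y).left)
    (b : N ⟶ B) (h : n ≫ ((depProd f).obj Y).hom = b ≫ f) :
    m ≫ piApp n b h = piApp (m ≫ n) (m ≫ b) (by simp [h]) := by
  rw [piApp, piApp, ← Category.assoc, comp_pbLift]

/-- Maps into a dependent product are determined by their transposes, and the transpose is the value
at the generic argument, the pair of projections of `f^* D`. -/
lemma pi_ext {A B : E} {f : B ⟶ A} {D : Over A} {Y : Over B} {k k' : D ⟶ (depProd f).obj Y}
    (h : ∀ {N : E} (m : N ⟶ D.left) (b : N ⟶ B)
      (h : (m ≫ k.left) ≫ ((depProd f).obj Y).hom = b ≫ f)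
      (h' : (m ≫ k'.left) ≫ ((depProd f).obj Y).hom = b ≫ f),
      piApp (m ≫ k.left) b h = piApp (m ≫ k'.left) b h') : k = k' := by
  apply Strength.depProd_hom_ext
  ext
  have hc : Strength.pullbackFst f D ≫ D.hom = ((Over.pullback f).obj D).hom ≫ f :=
    Strength.pullbackFst_hom f D
  have e := h (Strength.pullbackFst f D) ((Over.pullback f).obj D).hom (by simpa using hc)
    (by simpa using hc)
  have hid : pbLift (Strength.pullbackFst f D) ((Over.pullback f).obj D).hom hc = 𝟙 _ := by
    apply Strength.pullback_hom_ext_left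
    · rw [pbLift_fst, Category.id_comp]
    · rw [pbLift_hom, Category.id_comp]
  rw [piApp_comp, piApp_comp, hid, Category.id_comp, Category.id_comp] at e
  exact e

/-! ### Elements of a polynomial functor as labels with values at positions. -/

namespace Poly

variable {I J : E} (p : Poly I J)

/-- The fibrewise part of the extension of a polynomial, an object over `p.A`. -/
abbrev pi (X : Over I) : Over p.A := (depProd p.f).obj ((Over.pullback p.s).obj X)

/-- The label of an element of the extension of a polynomial. -/
def lab (X : Over I) : (p.extension.obj X).left ⟶ p.A :=
  (p.pi X).hom

@[simp] lemma lab_t (X : Over I) : p.lab X ≫ p.t = (p.extension.obj X).hom := rfl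

variable {p}

/-- The value of an element of the extension of a polynomial at a position. -/
def app {X : Over I} {N : E} (n : N ⟶ (p.extension.obj X).left) (b : N ⟶ p.B)
    (h : n ≫ p.lab X = b ≫ p.f) : N ⟶ X.left :=
  piApp (f := p.f) (Y := (Over.pullback p.s).obj X) n b h ≫ Strength.pullbackFst p.s X

@[simp] lemma app_hom {X : Over I} {N : E} (n : N ⟶ (p.extension.obj X).left) (b : N ⟶ p.B)
    (h : n ≫ p.lab X = b ≫ p.f) : app n b h ≫ X.hom = b ≫ p.s := by
  rw [app, Category.assoc, Strength.pullbackFst_hom, ← Category.assoc]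
  exact congrArg (· ≫ p.s) (piApp_hom (f := p.f) (Y := (Over.pullback p.s).obj X) n b h)

lemma comp_app {X : Over I} {M N : E} (m : M ⟶ N) (n : N ⟶ (p.extension.obj X).left) (b : N ⟶ p.B)
    (h : n ≫ p.lab X = b ≫ p.f) :
    m ≫ app n b h = app (m ≫ n) (m ≫ b) (by simp [h]) := by
  unfold app
  rw [← Category.assoc]
  exact congrArg (· ≫ Strength.pullbackFst p.s X)
    (comp_piApp (f := p.f) (Y := (Over.pullback p.s).obj X) m n b h)

lemma app_congr {X : Over I} {N : E} {n n' : N ⟶ (p.extension.obj X).left} {b b' : N ⟶ p.B}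
    (hn : n = n') (hb : b = b') (h : n ≫ p.lab X = b ≫ p.f) :
    app n b h = app n' b' (by rw [← hn, ← hb, h]) := by
  subst hn hb; rfl

/-- The element of the extension with the given label and the given values. -/
def lam {X : Over I} {Z : E} (z : Z ⟶ p.A) (g : pullback z p.f ⟶ X.left)
    (hg : g ≫ X.hom = pullback.snd z p.f ≫ p.s) : Z ⟶ (p.extension.obj X).left :=
  (Strength.curry p.f (Y := Over.mk z)
    (Strength.pullbackLift p.s (W := (Over.pullback p.f).obj (Over.mk z)) g hg)).left

@[simp] lemma lam_lab {X : Over I} {Z : E} (z : Z ⟶ p.A) (g : pullback z p.f ⟶ X.left)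
    (hg : g ≫ X.hom = pullback.snd z p.f ≫ p.s) : lam z g hg ≫ p.lab X = z :=
  Over.w (Strength.curry p.f (Y := Over.mk z) _)

@[simp] lemma lam_lab_assoc {X : Over I} {Z : E} (z : Z ⟶ p.A) (g : pullback z p.f ⟶ X.left)
    (hg : g ≫ X.hom = pullback.snd z p.f ≫ p.s) {M : E} (m : p.A ⟶ M) :
    lam z g hg ≫ p.lab X ≫ m = z ≫ m := by
  rw [← Category.assoc, lam_lab]

lemma app_lam {X : Over I} {Z N : E} (z : Z ⟶ p.A) (g : pullback z p.f ⟶ X.left)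
    (hg : g ≫ X.hom = pullback.snd z p.f ≫ p.s) (m : N ⟶ Z) (b : N ⟶ p.B)
    (h : (m ≫ lam z g hg) ≫ p.lab X = b ≫ p.f) :
    app (m ≫ lam z g hg) b h = pullback.lift m b (by simpa using h) ≫ g := by
  have e := piApp_comp (D := Over.mk z) (Strength.curry p.f (Y := Over.mk z)
    (Strength.pullbackLift p.s (W := (Over.pullback p.f).obj (Over.mk z)) g hg)) m b h
  rw [Strength.curry_ev] at e
  refine (congrArg (· ≫ Strength.pullbackFst p.s X) e).trans ?_
  rw [Category.assoc, Strength.pullbackLift_fst]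
  rfl

/-- The element of the extension with a given label and with values given on an arbitrary pullback
of the positions. -/
lemma exists_lam {X : Over I} {Z : Over J} (z : Z.left ⟶ p.A) (hz : z ≫ p.t = Z.hom) {N : E}
    {n : N ⟶ Z.left} {b : N ⟶ p.B} (hN : IsPullback n b z p.f) (g : N ⟶ X.left)
    (hg : g ≫ X.hom = b ≫ p.s) :
    ∃ k : Z ⟶ p.extension.obj X, k.left ≫ p.lab X = z ∧
      ∀ {M : E} (m : M ⟶ Z.left) (b' : M ⟶ p.B) (h : m ≫ z = b' ≫ p.f)
        (h' : (m ≫ k.left) ≫ p.lab X = b' ≫ p.f), app (m ≫ k.left) b' h' = hN.lift m b' h ≫ g := by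
  have hg' : (hN.lift (pullback.fst z p.f) (pullback.snd z p.f) pullback.condition ≫ g) ≫ X.hom =
      pullback.snd z p.f ≫ p.s := by
    rw [Category.assoc, hg, IsPullback.lift_snd_assoc]
  refine ⟨Over.homMk (lam z _ hg') ((lam_lab_assoc z _ hg' p.t).trans hz), lam_lab z _ hg',
    fun m b' h h' ↦ (app_lam z _ hg' m b' h').trans ?_⟩
  rw [← Category.assoc]
  congr 1
  apply hN.hom_ext
  · rw [Category.assoc, IsPullback.lift_fst, IsPullback.lift_fst]
    exact pullback.lift_fst _ _ _
  · rw [Category.assoc, IsPullback.lift_snd, IsPullback.lift_snd]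
    exact pullback.lift_snd _ _ _

/-- Two elements of the extension are equal if they have the same labels and values. -/
lemma ext_elem {X : Over I} {Z : E} {k k' : Z ⟶ (p.extension.obj X).left}
    (hl : k ≫ p.lab X = k' ≫ p.lab X)
    (ha : ∀ {N : E} (m : N ⟶ Z) (b : N ⟶ p.B) (h : (m ≫ k) ≫ p.lab X = b ≫ p.f)
      (h' : (m ≫ k') ≫ p.lab X = b ≫ p.f), app (m ≫ k) b h = app (m ≫ k') b h') : k = k' := by
  let Y : Over p.A := Over.mk (k ≫ p.lab X)
  let κ : Y ⟶ p.pi X := Over.homMk k rfl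
  let κ' : Y ⟶ p.pi X := Over.homMk k' hl.symm
  suffices κ = κ' from congrArg (fun x ↦ x.left) this
  refine pi_ext fun m b h h' ↦ ?_
  refine Strength.pullback_hom_ext_left (f := p.s) (ha m b h h') ?_
  rw [piApp_hom, piApp_hom]

@[simp] lemma map_lab {X Y : Over I} (g : X ⟶ Y) :
    (p.extension.map g).left ≫ p.lab Y = p.lab X :=
  Over.w ((depProd p.f).map ((Over.pullback p.s).map g))

@[simp] lemma map_lab_assoc {X Y : Over I} (g : X ⟶ Y) {M : E} (m : p.A ⟶ M) :
    (p.extension.map g).left ≫ p.lab Y ≫ m = p.lab X ≫ m := by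
  rw [← Category.assoc, map_lab]

lemma app_map {X Y : Over I} (g : X ⟶ Y) {N : E} (n : N ⟶ (p.extension.obj X).left) (b : N ⟶ p.B)
    (h : (n ≫ (p.extension.map g).left) ≫ p.lab Y = b ≫ p.f) :
    app (n ≫ (p.extension.map g).left) b h = app n b (by simpa using h) ≫ g.left := by
  have e := piApp_comp ((depProd p.f).map ((Over.pullback p.s).map g)) n b h
  rw [Strength.ev_naturality, Over.comp_left, ← Category.assoc] at e
  refine (congrArg (· ≫ Strength.pullbackFst p.s Y) e).trans ?_
  rw [Category.assoc, Strength.pullback_map_fst, ← Category.assoc]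
  rfl

/-- Two maps to the extension are equal if they have the same labels and values. -/
lemma hom_ext {X : Over I} {Z : Over J} {k k' : Z ⟶ p.extension.obj X}
    (hl : k.left ≫ p.lab X = k'.left ≫ p.lab X)
    (ha : ∀ {N : E} (m : N ⟶ Z.left) (b : N ⟶ p.B) (h : (m ≫ k.left) ≫ p.lab X = b ≫ p.f)
      (h' : (m ≫ k'.left) ≫ p.lab X = b ≫ p.f),
      app (m ≫ k.left) b h = app (m ≫ k'.left) b h') : k = k' :=
  Over.OverMorphism.ext (ext_elem hl ha)

/-- The factor of the strength coming from `Σ_t` is an identity of `E`, so only the factors from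
`Π_f` and `s^*` remain. -/
lemma strength_app_left (K : E) (X : Over I) :
    (p.strength.app K X).left =
      (Strength.depProdApp p.f K ((Over.pullback p.s).obj X) ≫
        (depProd p.f).map ((Strength.pullback p.s).app K X)).left := by
  have : ((Strength.depSum p.t).app K (p.pi X)).left = 𝟙 (tensorObj K (p.pi X)).left := by
    apply tensor_hom_ext (I := J) (X := (Over.map p.t).obj (p.pi X))
    · exact (tensorLift_fst _ _).trans (Category.id_comp _).symm
    · exact (tensorLift_snd _ _).trans (Category.id_comp _).symm
  refine (congrArg (fun t ↦ (t ≫ (Strength.depProdApp p.f K ((Over.pullback p.s).obj X)).left) ≫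
    ((depProd p.f).map ((Strength.pullback p.s).app K X)).left) this).trans ?_
  exact congrArg (· ≫ ((depProd p.f).map ((Strength.pullback p.s).app K X)).left)
    (Category.id_comp (Strength.depProdApp p.f K ((Over.pullback p.s).obj X)).left)

@[simp] lemma strength_lab (K : E) (X : Over I) :
    (p.strength.app K X).left ≫ p.lab (tensorObj K X) =
      tensorSnd K (p.extension.obj X) ≫ p.lab X := by
  rw [strength_app_left]
  exact Over.w (Strength.depProdApp p.f K ((Over.pullback p.s).obj X) ≫
        (depProd p.f).map ((Strength.pullback p.s).app K X))

lemma piApp_strength (K : E) (X : Over I) {N : E} (n : N ⟶ (tensorObj K (p.pi X)).left)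
    (b : N ⟶ p.B) (h : n ≫ (tensorObj K (p.pi X)).hom = b ≫ p.f) :
    piApp (n ≫ (Strength.depProdApp p.f K ((Over.pullback p.s).obj X) ≫
        (depProd p.f).map ((Strength.pullback p.s).app K X)).left) b (by simpa using h) ≫
        Strength.pullbackFst p.s (tensorObj K X) =
      tensorLift (n ≫ tensorFst K _) (piApp (n ≫ tensorSnd K (p.pi X)) b (by simpa using h) ≫
        Strength.pullbackFst p.s X) := by
  have e : (Over.pullback p.f).map (Strength.depProdApp p.f K ((Over.pullback p.s).obj X) ≫
        (depProd p.f).map ((Strength.pullback p.s).app K X)) ≫ Strength.ev p.f _ =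
      Strength.pullbackInv p.f K _ ≫ tensorMap (𝟙 K) (Strength.ev p.f _) ≫
        (Strength.pullback p.s).app K X := by
    rw [Functor.map_comp, Category.assoc, Strength.ev_naturality,
      reassoc_of% (Strength.depProdApp_ev p.f)]
  rw [piApp_comp, e]
  simp only [Over.comp_left, Category.assoc]
  have e₂ : ((Strength.pullback p.s).app K X).left ≫ Strength.pullbackFst p.s (tensorObj K X) =
      tensorLift (tensorFst K _) (tensorSnd K _ ≫ Strength.pullbackFst p.s X) :=
    Strength.pullbackLift_fst _ _ _
  rw [e₂]
  apply tensor_hom_ext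
  · simp only [Category.assoc, tensorLift_fst, tensorMap_fst, Category.comp_id]
    simp only [Strength.pullbackInv, Over.homMk_left, tensorLift_fst]
    rw [← Category.assoc, pbLift_fst]
  · simp only [Category.assoc, tensorLift_snd, tensorMap_snd_assoc]
    simp only [Strength.pullbackInv, Over.homMk_left, tensorLift_snd_assoc]
    rw [piApp, ← Category.assoc, pbLift_map]
    simp only [Category.assoc]
    rfl

/-- The strength copies the element of `K` to every position. With `strength_lab`, this lets
strongness be checked on labels and values. -/
lemma app_strength (K : E) (X : Over I) {N : E} (n : N ⟶ (tensorObj K (p.extension.obj X)).left)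
    (b : N ⟶ p.B) (h : (n ≫ (p.strength.app K X).left) ≫ p.lab (tensorObj K X) = b ≫ p.f) :
    app (n ≫ (p.strength.app K X).left) b h =
      tensorLift (n ≫ tensorFst K _) (app (n ≫ tensorSnd K _) b (by simpa using h)) := by
  have h₀ : n ≫ (tensorObj K (p.pi X)).hom = b ≫ p.f := by
    rw [Category.assoc, strength_lab] at h
    exact h
  refine (app_congr (congrArg (n ≫ ·) (strength_app_left K X)) rfl h).trans ?_
  exact piApp_strength K X n b h₀

end Poly
end
end PolynomialFunctors

/-! ### Recursion over structures that lie over a free algebra. -/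

namespace PolynomialFunctors

noncomputable section

variable {E : Type u} [Category.{v} E] [HasFiniteLimits E]

/-- A functor preserves pullback squares. -/
def PreservesPullbacks {C D : Type*} [Category* C] [Category* D] (F : C ⥤ D) : Prop :=
  ∀ ⦃W X Y Z : C⦄ ⦃a : W ⟶ X⦄ ⦃b : W ⟶ Y⦄ ⦃c : X ⟶ Z⦄ ⦃d : Y ⟶ Z⦄, IsPullback a b c d →
    IsPullback (F.map a) (F.map b) (F.map c) (F.map d)

lemma preservesPullbacks_of_isRightAdjoint {C D : Type*} [Category* C] [Category* D] (F : C ⥤ D)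
    [F.IsRightAdjoint] : PreservesPullbacks F := by
  have : PreservesLimitsOfSize.{0, 0} F :=
    (Adjunction.ofIsRightAdjoint F).rightAdjoint_preservesLimits
  exact fun _ _ _ _ _ _ _ _ h ↦ h.map F

lemma PreservesPullbacks.comp {C D D' : Type*} [Category* C] [Category* D] [Category* D']
    {F : C ⥤ D} {G : D ⥤ D'} (hF : PreservesPullbacks F) (hG : PreservesPullbacks G) :
    PreservesPullbacks (F ⋙ G) := fun _ _ _ _ _ _ _ _ h ↦ hG (hF h)

lemma PreservesPullbacks.of_iso {C D : Type*} [Category* C] [Category* D]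
    {F G : C ⥤ D} (hF : PreservesPullbacks F) (e : F ≅ G) :
    PreservesPullbacks G := fun _ _ _ _ _ _ _ _ h ↦
  (hF h).of_iso (e.app _) (e.app _) (e.app _) (e.app _) (e.hom.naturality _)
    (e.hom.naturality _) (e.hom.naturality _) (e.hom.naturality _)

lemma PreservesPullbacks.equifibered_whiskerRight {C D D' : Type*} [Category* C] [Category* D]
    [Category* D'] {F G : C ⥤ D} {φ : F ⟶ G} (h : NatTrans.Equifibered φ) {H : D ⥤ D'}
    (hH : PreservesPullbacks H) : NatTrans.Equifibered (Functor.whiskerRight φ H) :=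
  fun _ _ f ↦ hH (h f)

/-- `W` with `w : Q W ⟶ W` is an initial algebra of the endofunctor `Q`. -/
def IsInitialAlgebra {C : Type*} [Category* C] (Q : C ⥤ C) {W : C} (w : Q.obj W ⟶ W) : Prop :=
  ∀ (Y : C) (y : Q.obj Y ⟶ Y), ∃! k : W ⟶ Y, w ≫ k = Q.map k ≫ y

/-- `W` with `d : D ⟶ W` and `w : Q W ⟶ W` is a free algebra on `D`. -/
def IsFreeAlgebra {C : Type*} [Category* C] (Q : C ⥤ C) {D W : C} (d : D ⟶ W)
    (w : Q.obj W ⟶ W) : Prop :=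
  ∀ (Y : C) (y₀ : D ⟶ Y) (y : Q.obj Y ⟶ Y), ∃! k : W ⟶ Y, d ≫ k = y₀ ∧ w ≫ k = Q.map k ≫ y

/-- `W` with `d i : D i ⟶ W` and `w : Q W ⟶ W` is initial among such data. -/
def IsFreeAlgebraFamily {C : Type*} [Category* C] (Q : C ⥤ C) {ι : Type} {D : ι → C} {W : C}
    (d : ∀ i, D i ⟶ W) (w : Q.obj W ⟶ W) : Prop :=
  ∀ (Y : C) (y₀ : ∀ i, D i ⟶ Y) (y : Q.obj Y ⟶ Y),
    ∃! k : W ⟶ Y, (∀ i, d i ≫ k = y₀ i) ∧ w ≫ k = Q.map k ≫ y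

variable [LocallyCartesianClosed E]

lemma preservesPullbacks_map {I J : E} (u : I ⟶ J) : PreservesPullbacks (Over.map u) :=
  fun _ _ _ _ _ _ _ _ h ↦ isPullback_map u h

lemma preservesPullbacks_pullback {I J : E} (u : I ⟶ J) : PreservesPullbacks (Over.pullback u) :=
  have : (Over.pullback u).IsRightAdjoint := (Over.mapPullbackAdj u).isRightAdjoint
  preservesPullbacks_of_isRightAdjoint _

lemma Poly.preservesPullbacks {I J : E} (p : Poly I J) : PreservesPullbacks p.extension :=
  have : (depProd p.f).IsRightAdjoint := (depProdAdj p.f).isRightAdjoint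
  (preservesPullbacks_pullback p.s).comp
    ((preservesPullbacks_of_isRightAdjoint _).comp (preservesPullbacks_map p.t))

/-- Recursion over a structure that lies over an initial algebra `W`. The structure is an object `c`
with a map to `W` such that the part of `c` over `Q W` has a map to `P c` compatible with the map
to `W`. The proof applies initiality of `W` to the object of fibrewise maps from `c` to `Y`. -/
theorem existsUnique_rec {I J : E} (u : I ⟶ J) {P : Over I ⥤ Over I} {Q : Over J ⥤ Over J}
    (θ : P ⋙ Over.map u ⟶ Over.map u ⋙ Q) (hθ : NatTrans.Equifibered θ)
    (hQ : PreservesPullbacks Q) {ι : Type} {D : ι → Over J} {W : Over J} {d : ∀ i, D i ⟶ W}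
    {w : Q.obj W ⟶ W} (hW : IsFreeAlgebraFamily Q d w) {c c₁ : Over I} {c₀ : ι → Over I}
    (h : (Over.map u).obj c ⟶ W)
    {i₀ : ∀ i, c₀ i ⟶ c} {h₀ : ∀ i, (Over.map u).obj (c₀ i) ⟶ D i}
    (hp₀ : ∀ i, IsPullback (h₀ i) ((Over.map u).map (i₀ i)) (d i) h)
    {i₁ : c₁ ⟶ c} {h₁ : (Over.map u).obj c₁ ⟶ Q.obj W}
    (hp₁ : IsPullback h₁ ((Over.map u).map i₁) w h)
    (γ : c₁ ⟶ P.obj c) (hγ : (Over.map u).map γ ≫ θ.app c ≫ Q.map h = h₁)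
    {Y : Over I} (x : ∀ i, c₀ i ⟶ Y) (y : P.obj Y ⟶ Y) :
    ∃! k : c ⟶ Y, (∀ i, i₀ i ≫ k = x i) ∧ i₁ ≫ k = γ ≫ P.map k ≫ y := by
  have hl₀ (i) : IsPullback (h₀ i).left (i₀ i).left (d i).left h.left := isPullback_left (hp₀ i)
  have hl₁ : IsPullback h₁.left i₁.left w.left h.left := isPullback_left hp₁
  have hh : h.left ≫ W.hom = c.hom ≫ u := Over.w h
  -- The extension of `q` at `Y` has as elements a point of `W` with a typed function to `Y` on the
  -- fibre of `c` over it. Hence sections of `π` are the same as maps `c ⟶ Y`.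
  let q : Poly I J := ⟨c.left, W.left, c.hom, h.left, W.hom⟩
  let H : Over J := q.extension.obj Y
  let π : H ⟶ W := Over.homMk (q.lab Y) (q.lab_t Y)
  -- `V` consists of a fibrewise function and a point of its domain; the map `e` below is
  -- evaluation.
  obtain ⟨V, pV, qV, hV⟩ : ∃ (V : Over I) (pV : V ⟶ c) (qV : (Over.map u).obj V ⟶ H),
      IsPullback qV ((Over.map u).map pV) π h := by
    refine ⟨Over.mk (pullback.snd (q.lab Y) h.left ≫ c.hom),
      Over.homMk (pullback.snd (q.lab Y) h.left) rfl,
      Over.homMk (pullback.fst (q.lab Y) h.left) ?_,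
      isPullback_of_left (IsPullback.of_hasPullback (q.lab Y) h.left)⟩
    have e : pullback.fst (q.lab Y) h.left ≫ q.lab Y = pullback.snd (q.lab Y) h.left ≫ h.left :=
      pullback.condition
    change _ ≫ q.lab Y ≫ W.hom = (_ ≫ c.hom) ≫ u
    rw [reassoc_of% e, hh, Category.assoc]
  have hVl : IsPullback qV.left pV.left (q.lab Y) h.left := isPullback_left hV
  let e : V ⟶ Y := Over.homMk (Poly.app (p := q) qV.left pV.left hVl.w)
    ((Poly.app_hom _ _ _).trans (Over.w pV))
  -- Cartesianness of `θ` enters here: an element of `P V` is an element of `P c` and an element of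
  -- `Q H` with the same image in `Q W`.
  have hPV : IsPullback (θ.app V ≫ Q.map qV) ((Over.map u).map (P.map pV)) (Q.map π)
      (θ.app c ≫ Q.map h) := ((hθ pV).flip.paste_horiz (hQ hV))
  have hPVl : IsPullback (θ.app V ≫ Q.map qV).left (P.map pV).left (Q.map π).left
      (θ.app c ≫ Q.map h).left := isPullback_left hPV
  have hγl : γ.left ≫ (θ.app c ≫ Q.map h).left = h₁.left := congrArg (fun t ↦ t.left) hγ
  -- the algebra structure on the object of fibrewise maps
  have ha₀ (i) := Poly.exists_lam (p := q) (X := Y) (Z := D i) (d i).left (Over.w (d i)) (hl₀ i)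
    (x i).left ((Over.w (x i)).trans (Over.w (i₀ i)).symm)
  choose a₀ ha₀l ha₀ using ha₀
  have hN := IsPullback.of_hasPullback (Q.map π ≫ w).left h.left
  have hn₁ : (pullback.fst (Q.map π ≫ w).left h.left ≫ (Q.map π).left) ≫ w.left =
      pullback.snd (Q.map π ≫ w).left h.left ≫ h.left := by
    rw [Category.assoc]; exact pullback.condition
  have hn₂ : pullback.fst (Q.map π ≫ w).left h.left ≫ (Q.map π).left =
      (hl₁.lift _ _ hn₁ ≫ γ.left) ≫ (θ.app c ≫ Q.map h).left := by
    rw [Category.assoc, hγl, IsPullback.lift_fst]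
  -- The function attached to `t` in `Q H` acts on a point of `c` over the composite tree as
  -- follows: by `hp₁` the point comes from `c₁`, `γ` sends it to `P c`, `hPV` joins it with `t` to
  -- an element of `P V`, and `P e` followed by `y` gives the value.
  obtain ⟨a₁, ha₁l, ha₁⟩ := Poly.exists_lam (p := q) (X := Y) (Z := Q.obj H) (Q.map π ≫ w).left
    (Over.w (Q.map π ≫ w)) hN (hPVl.lift _ _ hn₂ ≫ (P.map e ≫ y).left) (by
      rw [Category.assoc, Over.w, ← Over.w (P.map pV), IsPullback.lift_snd_assoc, Category.assoc,
        Over.w, ← Over.w i₁, IsPullback.lift_snd_assoc])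
  have ha₀π (i) : a₀ i ≫ π = d i := Over.OverMorphism.ext (ha₀l i)
  have ha₁π : a₁ ≫ π = Q.map π ≫ w := Over.OverMorphism.ext ha₁l
  have hsec (l : W ⟶ H) (hl : l ≫ π = 𝟙 W) : l.left ≫ q.lab Y = 𝟙 _ :=
    congrArg (fun t ↦ t.left) hl
  have hk (l : W ⟶ H) (hl : l ≫ π = 𝟙 W) : (h.left ≫ l.left) ≫ q.lab Y = 𝟙 _ ≫ h.left := by
    rw [Category.assoc, hsec l hl, Category.comp_id, Category.id_comp]
  let K (l : W ⟶ H) (hl : l ≫ π = 𝟙 W) : c ⟶ Y :=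
    Over.homMk (Poly.app (p := q) (h.left ≫ l.left) (𝟙 _) (hk l hl))
      ((Poly.app_hom _ _ _).trans (Category.id_comp _))
  -- For a section `l` with associated map `K l`, the algebra structure on `H`, composed with `Q l`,
  -- evaluates to the right-hand side of the recursion equation. Both existence and uniqueness rest
  -- on this.
  have key (l : W ⟶ H) (hl : l ≫ π = 𝟙 W) {M : E} (m : M ⟶ (Q.obj W).left) (b : M ⟶ c.left)
      (hmb : m ≫ w.left = b ≫ h.left)
      (hmb' : (m ≫ (Q.map l ≫ a₁).left) ≫ q.lab Y = b ≫ q.f) :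
      Poly.app (p := q) (m ≫ (Q.map l ≫ a₁).left) b hmb' =
        hl₁.lift m b hmb ≫ (γ ≫ P.map (K l hl) ≫ y).left := by
    let v : c ⟶ V := Over.homMk (hVl.lift (h.left ≫ l.left) (𝟙 _) (hk l hl)) (by
      rw [← Over.w pV, IsPullback.lift_snd_assoc, Category.id_comp])
    have hvp : v ≫ pV = 𝟙 c := Over.OverMorphism.ext (IsPullback.lift_snd _ _ _ _)
    have hvq : (Over.map u).map v ≫ qV = h ≫ l :=
      Over.OverMorphism.ext (IsPullback.lift_fst _ _ _ _)
    have hve : v ≫ e = K l hl := by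
      ext
      refine (Poly.comp_app _ _ _ _).trans ?_
      exact Poly.app_congr (IsPullback.lift_fst _ _ _ _) (IsPullback.lift_snd _ _ _ _) _
    have hQl : (Q.map l).left ≫ (Q.map π).left = 𝟙 _ := by
      rw [← Over.comp_left, ← Q.map_comp, hl, Q.map_id, Over.id_left]
    have hmb₂ : (m ≫ (Q.map l).left) ≫ (Q.map π ≫ w).left = b ≫ h.left := by
      rw [Over.comp_left, Category.assoc, reassoc_of% hQl, hmb]
    have e₀ : m ≫ (Q.map l ≫ a₁).left = (m ≫ (Q.map l).left) ≫ a₁.left := by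
      rw [Over.comp_left, Category.assoc]
    refine (Poly.app_congr e₀ rfl hmb').trans ?_
    rw [ha₁ _ _ hmb₂, ← hve, P.map_comp]
    have e₄ : (γ ≫ (P.map v ≫ P.map e) ≫ y).left =
        (γ.left ≫ (P.map v).left) ≫ (P.map e ≫ y).left := by
      simp only [Over.comp_left, Category.assoc]
    rw [e₄, ← Category.assoc, ← Category.assoc]
    congr 1
    apply hPVl.hom_ext
    · simp only [Category.assoc]
      rw [IsPullback.lift_fst, IsPullback.lift_fst]
      have e₁ : (γ.left ≫ (P.map v).left) ≫ (θ.app V ≫ Q.map qV).left = h₁.left ≫ (Q.map l).left := by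
        have e₂ := congrArg (fun t ↦ t.left) (θ.naturality v)
        have e₃ : (P.map v).left ≫ (θ.app V).left = (θ.app c).left ≫
          (Q.map ((Over.map u).map v)).left := e₂
        rw [Over.comp_left, Category.assoc, reassoc_of% e₃, ← Over.comp_left _ _ _ (Q.map _),
          ← Q.map_comp, hvq, Q.map_comp, ← hγl, Over.comp_left, Over.comp_left]
        simp only [Category.assoc]
      rw [← Category.assoc γ.left, e₁, IsPullback.lift_fst_assoc]
    · simp only [Category.assoc]
      have e₁ : (P.map v).left ≫ (P.map pV).left = 𝟙 _ := by
        rw [← Over.comp_left, ← P.map_comp, hvp, P.map_id, Over.id_left]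
      rw [e₁, Category.comp_id, IsPullback.lift_snd, ← Category.assoc]
      congr 1
      apply hl₁.hom_ext
      · rw [Category.assoc, IsPullback.lift_fst, IsPullback.lift_fst, IsPullback.lift_fst_assoc,
          Category.assoc, hQl, Category.comp_id]
      · rw [Category.assoc, IsPullback.lift_snd, IsPullback.lift_snd, IsPullback.lift_snd]
  obtain ⟨l, ⟨hl₀', hl₁'⟩, hlu⟩ := hW H a₀ a₁
  -- `π` is an algebra map, so `l ≫ π` and the identity are algebra endomorphisms of `W` and agree
  -- by uniqueness.
  have hlπ : l ≫ π = 𝟙 W := by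
    obtain ⟨l', -, hu'⟩ := hW W d w
    refine (hu' _ ⟨fun i ↦ ?_, ?_⟩).trans (hu' _ ⟨fun i ↦ ?_, ?_⟩).symm
    · rw [reassoc_of% (hl₀' i), ha₀π]
    · rw [reassoc_of% hl₁', ha₁π, Q.map_comp, Category.assoc]
    · simp
    · simp
  refine ⟨K l hlπ, ⟨fun i ↦ ?_, ?_⟩, fun k hk' ↦ ?_⟩
  · ext
    refine (Poly.comp_app _ _ _ _).trans ?_
    have hi : (h₀ i).left ≫ (d i).left = (i₀ i).left ≫ h.left := (hl₀ i).w
    refine (Poly.app_congr (n' := (h₀ i).left ≫ (a₀ i).left) (b' := (i₀ i).left) ?_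
      (Category.comp_id _) _).trans ?_
    · rw [← reassoc_of% hi, ← Over.comp_left, hl₀' i]
    rw [ha₀ _ _ _ hi]
    refine (congrArg (· ≫ (x i).left) ?_).trans (Category.id_comp _)
    apply (hl₀ i).hom_ext
    · rw [IsPullback.lift_fst, Category.id_comp]
    · rw [IsPullback.lift_snd, Category.id_comp]
  · ext
    refine (Poly.comp_app _ _ _ _).trans ?_
    have e₁ : i₁.left ≫ h.left ≫ l.left = h₁.left ≫ (Q.map l ≫ a₁).left := by
      rw [← hl₁', Over.comp_left, ← Category.assoc, ← hl₁.w, Category.assoc]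
    have e₂ : (h₁.left ≫ (Q.map l ≫ a₁).left) ≫ q.lab Y = i₁.left ≫ q.f := by
      rw [← e₁, Category.assoc, Category.assoc, hsec l hlπ, Category.comp_id]
    refine (Poly.app_congr e₁ (Category.comp_id _) _).trans ?_
    rw [key l hlπ h₁.left i₁.left hl₁.w e₂]
    refine (congrArg (· ≫ (γ ≫ P.map (K l hlπ) ≫ y).left) ?_).trans (Category.id_comp _)
    apply hl₁.hom_ext
    · rw [IsPullback.lift_fst, Category.id_comp]
    · rw [IsPullback.lift_snd, Category.id_comp]
  · obtain ⟨hk₀, hk₁⟩ := hk'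
    obtain ⟨l', hl'l, hl'⟩ := Poly.exists_lam (p := q) (X := Y) (Z := W) (𝟙 _)
      (Category.id_comp _) (IsPullback.of_vert_isIso ⟨(Category.comp_id _).trans
        (Category.id_comp _).symm⟩ : IsPullback h.left (𝟙 _) (𝟙 _) h.left) k.left
      ((Over.w k).trans (Category.id_comp _).symm)
    have hl'π : l' ≫ π = 𝟙 W := Over.OverMorphism.ext hl'l
    have happ {M : E} (m : M ⟶ W.left) (b : M ⟶ c.left) (hmb : (m ≫ l'.left) ≫ q.lab Y = b ≫ q.f) :
        Poly.app (p := q) (m ≫ l'.left) b hmb = b ≫ k.left := by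
      have hmb' : m ≫ 𝟙 _ = b ≫ h.left := by rw [← hl'l, ← Category.assoc]; exact hmb
      rw [hl' _ _ hmb']
      congr 1
      refine (Category.comp_id _).symm.trans (IsPullback.lift_snd _ _ _ _)
    have hK : K l' hl'π = k := by
      ext
      exact (happ h.left (𝟙 _) _).trans (Category.id_comp _)
    suffices hll : l' = l by subst hll; exact hK.symm
    refine hlu l' ⟨fun i ↦ ?_, ?_⟩
    · refine Poly.hom_ext (p := q) ?_ ?_
      · rw [ha₀l, Over.comp_left, Category.assoc, hsec l' hl'π, Category.comp_id]
      · intro M m b hm hm'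
        refine (Poly.app_congr (n' := (m ≫ (d i).left) ≫ l'.left) (b' := b)
          (Category.assoc _ _ _).symm rfl _).trans ?_
        have hmb : m ≫ (d i).left = b ≫ h.left := by
          rw [← ha₀l i, ← Category.assoc]; exact hm'
        rw [happ, ha₀ i m b hmb, ← hk₀ i, Over.comp_left, IsPullback.lift_snd_assoc]
    · refine Poly.hom_ext (p := q) ?_ ?_
      · have e₁ : (w ≫ l') ≫ π = (Q.map l' ≫ a₁) ≫ π := by
          rw [Category.assoc, hl'π, Category.assoc, ha₁π, ← Q.map_comp_assoc, hl'π]; simp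
        exact congrArg (fun t ↦ t.left) e₁
      · intro M m b hm hm'
        have hmb : m ≫ w.left = b ≫ h.left := by
          refine Eq.trans ?_ hm
          rw [Over.comp_left, Category.assoc, Category.assoc, hsec l' hl'π, Category.comp_id]
        refine Eq.trans ?_ (key l' hl'π m b hmb hm').symm
        rw [hK, ← hk₁, Over.comp_left _ _ _ i₁, IsPullback.lift_snd_assoc]
        refine (Poly.app_congr (n' := (m ≫ w.left) ≫ l'.left) (b' := b)
          (Category.assoc _ _ _).symm rfl _).trans ?_
        rw [happ]

/-- Recursion over a structure that lies over an initial algebra. -/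
theorem IsInitialAlgebra.existsUnique_rec {I J : E} (u : I ⟶ J) {P : Over I ⥤ Over I}
    {Q : Over J ⥤ Over J}
    (θ : P ⋙ Over.map u ⟶ Over.map u ⋙ Q) (hθ : NatTrans.Equifibered θ)
    (hQ : PreservesPullbacks Q) {W : Over J} {w : Q.obj W ⟶ W} (hW : IsInitialAlgebra Q w)
    {c c₁ : Over I} (h : (Over.map u).obj c ⟶ W)
    {i₁ : c₁ ⟶ c} {h₁ : (Over.map u).obj c₁ ⟶ Q.obj W}
    (hp₁ : IsPullback h₁ ((Over.map u).map i₁) w h)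
    (γ : c₁ ⟶ P.obj c) (hγ : (Over.map u).map γ ≫ θ.app c ≫ Q.map h = h₁)
    {Y : Over I} (y : P.obj Y ⟶ Y) : ∃! k : c ⟶ Y, i₁ ≫ k = γ ≫ P.map k ≫ y := by
  have hW' : IsFreeAlgebraFamily Q (ι := Empty) (D := fun i ↦ i.elim) (fun i ↦ i.elim) w :=
    fun Z _ z ↦ by
      obtain ⟨k, hk, hk'⟩ := hW Z z
      exact ⟨k, ⟨fun i ↦ i.elim, hk⟩, fun l hl ↦ hk' l hl.2⟩
  obtain ⟨k, hk, hk'⟩ := PolynomialFunctors.existsUnique_rec u θ hθ hQ hW' (c₀ := fun i ↦ i.elim) h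
    (i₀ := fun i ↦ i.elim) (h₀ := fun i ↦ i.elim) (fun i ↦ i.elim) hp₁ γ hγ (fun i ↦ i.elim) y
  exact ⟨k, hk.2, fun l hl ↦ hk' l ⟨fun i ↦ i.elim, hl⟩⟩

/-- Recursion over a structure that lies over a free algebra. -/
theorem IsFreeAlgebra.existsUnique_rec {I : E} {P : Over I ⥤ Over I}
    (hP : PreservesPullbacks P) {D W : Over I} {d : D ⟶ W} {w : P.obj W ⟶ W}
    (hW : IsFreeAlgebra P d w) {c c₀ c₁ : Over I} (h : c ⟶ W)
    {i₀ : c₀ ⟶ c} {h₀ : c₀ ⟶ D} (hp₀ : IsPullback h₀ i₀ d h)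
    {i₁ : c₁ ⟶ c} {h₁ : c₁ ⟶ P.obj W} (hp₁ : IsPullback h₁ i₁ w h)
    (γ : c₁ ⟶ P.obj c) (hγ : γ ≫ P.map h = h₁)
    {Y : Over I} (x : c₀ ⟶ Y) (y : P.obj Y ⟶ Y) :
    ∃! k : c ⟶ Y, i₀ ≫ k = x ∧ i₁ ≫ k = γ ≫ P.map k ≫ y := by
  have hW' : IsFreeAlgebraFamily P (ι := Unit) (D := fun _ ↦ D) (fun _ ↦ d) w :=
    fun Z z₀ z ↦ by
      obtain ⟨k, hk, hk'⟩ := hW Z (z₀ ()) z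
      exact ⟨k, ⟨fun _ ↦ hk.1, hk.2⟩, fun l hl ↦ hk' l ⟨hl.1 (), hl.2⟩⟩
  -- `Over.map (𝟙 I)` is the identity functor only up to isomorphism, so the general theorem is
  -- applied with the canonical isomorphism `θ` and the squares are transported along `ν`.
  let ν := (Over.mapId I)
  let θ : P ⋙ Over.map (𝟙 I) ⟶ Over.map (𝟙 I) ⋙ P :=
    Functor.whiskerLeft P ν.hom ≫ P.rightUnitor.hom ≫ P.leftUnitor.inv ≫
      Functor.whiskerRight ν.inv P
  have hθ (Z : Over I) : θ.app Z = ν.hom.app (P.obj Z) ≫ P.map (ν.inv.app Z) := by simp [θ]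
  have hsq {a b a' b' : Over I} {f : a ⟶ b} {g : a ⟶ a'} {f' : a' ⟶ b'} {g' : b ⟶ b'}
      (hs : IsPullback f g g' f') :
      IsPullback (ν.hom.app a ≫ f) ((Over.map (𝟙 I)).map g) g' (ν.hom.app a' ≫ f') :=
    (IsPullback.of_horiz_isIso ⟨(ν.hom.naturality g).symm⟩ :
      IsPullback (ν.hom.app a) ((Over.map (𝟙 I)).map g) g (ν.hom.app a')).paste_horiz hs
  obtain ⟨k, hk, hk'⟩ := PolynomialFunctors.existsUnique_rec (𝟙 I) θ (.of_isIso _) hP hW'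
    (c₀ := fun _ ↦ c₀) (ν.hom.app c ≫ h) (i₀ := fun _ ↦ i₀) (h₀ := fun _ ↦ ν.hom.app c₀ ≫ h₀)
    (fun _ ↦ hsq hp₀) (h₁ := ν.hom.app c₁ ≫ h₁) (hsq hp₁) γ (by
      have e : P.map (ν.inv.app c) ≫ P.map (ν.hom.app c ≫ h) = P.map h := by
        rw [← P.map_comp]
        exact congrArg P.map (Iso.inv_hom_id_app_assoc _ _ _)
      have e' : (Over.map (𝟙 I)).map γ ≫ ν.hom.app (P.obj c) = ν.hom.app c₁ ≫ γ :=
        ν.hom.naturality γ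
      rw [hθ, Category.assoc, e, reassoc_of% e', hγ]) (fun _ ↦ x) y
  exact ⟨k, ⟨hk.1 (), hk.2⟩, fun l hl ↦ hk' l ⟨fun _ ↦ hl.1, hl.2⟩⟩

end
end PolynomialFunctors

/-! ### Forgetting types. -/

namespace PolynomialFunctors

noncomputable section

variable {E : Type u} [Category.{v} E] [HasFiniteLimits E] [LocallyCartesianClosed E]

namespace Poly

variable {I J : E}

/-- The polynomial with the same positions and labels, pushed forward to the terminal object. -/
abbrev untyped (p : Poly I J) : Poly (⊤_ E) (⊤_ E) :=
  ⟨p.B, p.A, terminal.from _, p.f, terminal.from _⟩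

/-- The functor forgetting the type. -/
abbrev forgetType (I : E) : Over I ⥤ Over (⊤_ E) := Over.map (terminal.from I)

/-- An element of the extension of a polynomial, with types forgotten. -/
def toUntypedApp (p : Poly I I) (X : Over I) :
    (p.extension.obj X).left ⟶ (p.untyped.extension.obj ((forgetType I).obj X)).left :=
  lam (p := p.untyped) (X := (forgetType I).obj X) (p.lab X)
    (app (X := X) (pullback.fst (p.lab X) p.f) (pullback.snd (p.lab X) p.f) pullback.condition)
    (terminal.hom_ext _ _)

@[simp] lemma toUntypedApp_lab (p : Poly I I) (X : Over I) :
    p.toUntypedApp X ≫ p.untyped.lab _ = p.lab X := lam_lab _ _ _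

lemma app_toUntypedApp {p : Poly I I} {X : Over I} {N : E} (m : N ⟶ (p.extension.obj X).left)
    (b : N ⟶ p.B) (h : m ≫ p.lab X = b ≫ p.f)
    (h' : (m ≫ p.toUntypedApp X) ≫ p.untyped.lab _ = b ≫ p.untyped.f) :
    app (p := p.untyped) (m ≫ p.toUntypedApp X) b h' = app (p := p) m b h := by
  refine (app_lam _ _ _ _ _ _).trans ((comp_app _ _ _ _).trans ?_)
  exact app_congr (pullback.lift_fst _ _ _) (pullback.lift_snd _ _ _) _

/-- Forgetting the types of the elements of the extension of a polynomial. -/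
def toUntyped (p : Poly I I) :
    p.extension ⋙ forgetType I ⟶ forgetType I ⋙ p.untyped.extension where
  app X := Over.homMk (p.toUntypedApp X) (terminal.hom_ext _ _)
  naturality X Y k := by
    refine Poly.hom_ext (p := p.untyped) (X := (forgetType I).obj Y) ?_ ?_
    · simp only [Over.comp_left, Category.assoc, Functor.comp_map]
      refine (congrArg ((p.extension.map k).left ≫ ·) (p.toUntypedApp_lab Y)).trans ?_
      refine (p.map_lab k).trans ?_
      refine Eq.trans ?_ (congrArg (p.toUntypedApp X ≫ ·) (p.untyped.map_lab _)).symm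
      exact (p.toUntypedApp_lab X).symm
    · intro N m b h h'
      have e : m ≫ p.lab X = b ≫ p.f := by
        refine Eq.trans ?_ h
        refine (congrArg (m ≫ ·) (p.map_lab k).symm).trans ?_
        simp only [Over.comp_left, Category.assoc]
        exact congrArg (fun t ↦ m ≫ (p.extension.map k).left ≫ t) (p.toUntypedApp_lab Y).symm
      have e' : (m ≫ (p.extension.map k).left) ≫ p.lab Y = b ≫ p.f := by
        rw [Category.assoc, map_lab, e]
      refine (app_congr (p := p.untyped) (Category.assoc _ _ _).symm rfl h).trans ?_
      refine (app_toUntypedApp (m ≫ (p.extension.map k).left) b e' _).trans ?_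
      refine (app_map k m b e').trans ?_
      refine Eq.trans ?_ (app_congr (p := p.untyped) (Category.assoc _ _ _).symm rfl h').symm
      refine Eq.trans ?_ (app_map (p := p.untyped) ((forgetType I).map k)
        (m ≫ p.toUntypedApp X) b _).symm
      exact congrArg (· ≫ k.left) (app_toUntypedApp m b e _).symm

/-- Let `k : X ⟶ Y` be a map over `I`. If untyped values in `X` become, under `k`, the values of a
typed element over `Y`, they were already of the right types, because `k` preserves types. -/
lemma toUntyped_equifibered (p : Poly I I) : NatTrans.Equifibered p.toUntyped := by
  intro X Y k
  refine isPullback_of_left (isPullback_of_exists (congrArg (fun t ↦ t.left)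
    (p.toUntyped.naturality k)) ?_ ?_)
  · intro V x y hxy
    change V ⟶ (p.extension.obj Y).left at x
    change V ⟶ (p.untyped.extension.obj ((forgetType I).obj X)).left at y
    change x ≫ p.toUntypedApp Y = y ≫ (p.untyped.extension.map ((forgetType I).map k)).left at hxy
    have hl : y ≫ p.untyped.lab _ = x ≫ p.lab Y := by
      rw [← p.toUntypedApp_lab Y, reassoc_of% hxy, map_lab]
    have happ {N : E} (m : N ⟶ V) (b : N ⟶ p.B) (hb : (m ≫ x) ≫ p.lab Y = b ≫ p.f)
        (hb' : (m ≫ y) ≫ p.untyped.lab _ = b ≫ p.f) :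
        app (p := p.untyped) (m ≫ y) b hb' ≫ k.left = app (p := p) (m ≫ x) b hb := by
      have h₁ : ((m ≫ y) ≫ (p.untyped.extension.map ((forgetType I).map k)).left) ≫
          p.untyped.lab _ = b ≫ p.f := by rw [Category.assoc, map_lab, hb']
      refine (app_map (p := p.untyped) ((forgetType I).map k) (m ≫ y) b h₁).symm.trans ?_
      have h₂ : ((m ≫ x) ≫ p.toUntypedApp Y) ≫ p.untyped.lab _ = b ≫ p.f := by
        rw [Category.assoc, toUntypedApp_lab, hb]
      refine (app_congr ?_ rfl h₁).trans (app_toUntypedApp (m ≫ x) b hb h₂)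
      rw [Category.assoc, Category.assoc, hxy]
    have hc : (pullback.fst (y ≫ p.untyped.lab _) p.f ≫ y) ≫ p.untyped.lab _ =
        pullback.snd _ p.f ≫ p.f := by rw [Category.assoc]; exact pullback.condition
    have hc' : (pullback.fst (y ≫ p.untyped.lab _) p.f ≫ x) ≫ p.lab Y =
        pullback.snd _ p.f ≫ p.f := by rw [Category.assoc, ← hl]; exact pullback.condition
    have hs : app (p := p.untyped) (pullback.fst (y ≫ p.untyped.lab _) p.f ≫ y)
        (pullback.snd _ p.f) hc ≫ X.hom = pullback.snd _ p.f ≫ p.s := by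
      rw [← Over.w k]
      refine (Category.assoc _ _ _).symm.trans ?_
      refine (congrArg (· ≫ Y.hom) (happ _ _ hc' hc)).trans ?_
      exact app_hom _ _ _
    obtain ⟨ℓ, hℓ, hℓa⟩ := exists_lam (p := p) (X := X)
      (Z := Over.mk ((y ≫ p.untyped.lab _) ≫ p.t)) (y ≫ p.untyped.lab _) rfl
      (IsPullback.of_hasPullback _ _) _ hs
    replace ⟨ℓ, hℓ, hℓa⟩ : ∃ ℓ : V ⟶ (p.extension.obj X).left, ℓ ≫ p.lab X = y ≫ p.untyped.lab _ ∧
        ∀ {N : E} (m : N ⟶ V) (b : N ⟶ p.B) (hb : (m ≫ y) ≫ p.untyped.lab _ = b ≫ p.f)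
        (hb' : (m ≫ ℓ) ≫ p.lab X = b ≫ p.f),
        app (p := p) (m ≫ ℓ) b hb' = app (p := p.untyped) (m ≫ y) b hb := by
      refine ⟨ℓ.left, hℓ, fun m b hb hb' ↦ ?_⟩
      have hb₂ := (Category.assoc _ _ _).symm.trans hb
      refine (hℓa m b hb₂ hb').trans ((comp_app (p := p.untyped) _ _ _ _).trans ?_)
      exact app_congr (p := p.untyped) ((Category.assoc _ _ _).symm.trans
        (congrArg (· ≫ y) (IsPullback.lift_fst _ _ _ hb₂))) (IsPullback.lift_snd _ _ _ hb₂) _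
    refine ⟨ℓ, ?_, ?_⟩
    · change ℓ ≫ (p.extension.map k).left = x
      refine ext_elem (p := p) ?_ ?_
      · rw [Category.assoc, map_lab, hℓ, hl]
      · intro N m b h h'
        have h₁ : (m ≫ y) ≫ p.untyped.lab _ = b ≫ p.f := by
          rw [Category.assoc, hl, ← h', Category.assoc]
        have h₂ : (m ≫ ℓ) ≫ p.lab X = b ≫ p.f := by
          rw [Category.assoc, hℓ, ← Category.assoc, h₁]
        have h₃ : ((m ≫ ℓ) ≫ (p.extension.map k).left) ≫ p.lab Y = b ≫ p.f := by
          rw [Category.assoc, map_lab, h₂]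
        rw [← happ m b h' h₁, ← hℓa m b h₁ h₂, ← app_map k (m ≫ ℓ) b h₃]
        exact app_congr (Category.assoc _ _ _).symm rfl _
    · change ℓ ≫ p.toUntypedApp X = y
      refine ext_elem (p := p.untyped) ?_ ?_
      · rw [Category.assoc, toUntypedApp_lab, hℓ]
      · intro N m b h h'
        have h₂ : (m ≫ ℓ) ≫ p.lab X = b ≫ p.f := by
          rw [Category.assoc, hℓ, ← Category.assoc, h']
        have h₃ : ((m ≫ ℓ) ≫ p.toUntypedApp X) ≫ p.untyped.lab _ = b ≫ p.untyped.f := by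
          rw [Category.assoc, toUntypedApp_lab, h₂]
        refine (app_congr (p := p.untyped) (Category.assoc _ _ _).symm rfl h).trans ?_
        refine (app_toUntypedApp (m ≫ ℓ) b h₂ h₃).trans ?_
        exact hℓa m b h' h₂
  · intro V l l' _ hl
    change V ⟶ (p.extension.obj X).left at l l'
    change l ≫ p.toUntypedApp X = l' ≫ p.toUntypedApp X at hl
    have e : l ≫ p.lab X = l' ≫ p.lab X := by
      rw [← p.toUntypedApp_lab X, reassoc_of% hl]
    refine ext_elem e ?_
    intro N m b h h'
    have h₁ : ((m ≫ l) ≫ p.toUntypedApp X) ≫ p.untyped.lab _ = b ≫ p.f := by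
      rw [Category.assoc, toUntypedApp_lab, h]
    have h₂ : ((m ≫ l') ≫ p.toUntypedApp X) ≫ p.untyped.lab _ = b ≫ p.f := by
      rw [Category.assoc, toUntypedApp_lab, h']
    rw [← app_toUntypedApp (m ≫ l) b h h₁, ← app_toUntypedApp (m ≫ l') b h' h₂]
    refine app_congr ?_ rfl _
    rw [Category.assoc, Category.assoc, hl]

end Poly

/-- The invertibility of the structure map is Lambek's lemma; it allows trees to be taken apart. -/
lemma HasWTypes.exists_isInitialAlgebra [HasWTypes E] (p : Poly (⊤_ E) (⊤_ E)) :
    ∃ (W : Over (⊤_ E)) (w : p.extension.obj W ⟶ W), IsIso w ∧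
      IsInitialAlgebra p.extension w := by
  have := HasWTypes.hasInitial p
  let A := ⊥_ (Endofunctor.Algebra p.extension)
  refine ⟨A.a, A.str, Endofunctor.Algebra.Initial.str_isIso initialIsInitial, fun Y y ↦ ?_⟩
  let B : Endofunctor.Algebra p.extension := ⟨Y, y⟩
  refine ⟨(initial.to B).f, (initial.to B).h.symm, fun k hk ↦ ?_⟩
  let k' : A ⟶ B := ⟨k, hk.symm⟩
  exact congrArg Endofunctor.Algebra.Hom.f (initial.hom_ext k' (initial.to B))

end
end PolynomialFunctors

/-! ### Initial algebras in a slice, from W-types in one variable. -/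

namespace PolynomialFunctors

noncomputable section

variable {E : Type u} [Category.{v} E] [HasFiniteLimits E] [LocallyCartesianClosed E]

/-- A map of the base category as a map of objects over the terminal object. -/
abbrev overTop {X Y : Over (⊤_ E)} (f : X.left ⟶ Y.left) : X ⟶ Y :=
  Over.homMk f (terminal.hom_ext _ _)

/-- There is an object into which pairs of an element of `I` and of a tree of its elements embed. -/
lemma HasWTypes.exists_labelled [HasWTypes E] (q : Poly (⊤_ E) (⊤_ E)) (I : E) :
    ∃ (W' : Over (⊤_ E)) (w' : I ⨯ (q.extension.obj W').left ⟶ W'.left), Mono w' := by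
  -- The trees of `q'` are the trees of `q` with an additional element of `I` at every node.
  let q' : Poly (⊤_ E) (⊤_ E) :=
    ⟨I ⨯ q.B, I ⨯ q.A, terminal.from _, prod.map (𝟙 I) q.f, terminal.from _⟩
  obtain ⟨W, w, hw, -⟩ := HasWTypes.exists_isInitialAlgebra q'
  have hwl : IsIso w.left := inferInstanceAs (IsIso ((Over.forget _).map w))
  -- The positions of the label `(i, a)` are the pairs `(i, b)` with `b` a position of `a`. Thus `i`
  -- and an element of `q W` give an element of `q' W`, from which both can be read off.
  have hN : IsPullback (pullback.fst (prod.snd ≫ q.lab W) q.f)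
      (prod.lift (pullback.fst (prod.snd ≫ q.lab W) q.f ≫ prod.fst) (pullback.snd _ _))
      (prod.map (𝟙 I) (q.lab W)) (prod.map (𝟙 I) q.f) := by
    refine isPullback_of_exists ?_ (fun x y hxy ↦ ?_) (fun k k' h h' ↦ ?_)
    · apply Limits.prod.hom_ext
      · simp [Limits.prod.lift_fst]
      · simpa [Limits.prod.lift_fst, Limits.prod.lift_snd] using pullback.condition
    · have h₁ : x ≫ prod.fst = y ≫ prod.fst := by simpa using congrArg (· ≫ prod.fst) hxy
      have h₂ : x ≫ prod.snd ≫ q.lab W = (y ≫ prod.snd) ≫ q.f := by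
        simpa using congrArg (· ≫ prod.snd) hxy
      refine ⟨pullback.lift x (y ≫ prod.snd) h₂, pullback.lift_fst _ _ _, ?_⟩
      apply Limits.prod.hom_ext <;> simp [Limits.prod.lift_fst, Limits.prod.lift_snd,
        pullback.lift_fst_assoc, pullback.lift_snd, h₁]
    · apply pullback.hom_ext h
      simpa [Limits.prod.lift_fst, Limits.prod.lift_snd] using congrArg (· ≫ prod.snd) h'
  have hc : (pullback.fst (prod.snd ≫ q.lab W) q.f ≫ (prod.snd : I ⨯ _ ⟶ _)) ≫ q.lab W =
      pullback.snd _ _ ≫ q.f := by rw [Category.assoc]; exact pullback.condition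
  obtain ⟨j, hj, hja⟩ := Poly.exists_lam (p := q') (X := W)
    (Z := Over.mk (terminal.from (I ⨯ (q.extension.obj W).left))) (prod.map (𝟙 I) (q.lab W))
    (terminal.hom_ext _ _) hN (Poly.app (p := q) _ _ hc) (terminal.hom_ext _ _)
  refine ⟨W, j.left ≫ w.left, ?_⟩
  suffices Mono j.left from mono_comp _ _
  refine ⟨fun {V} k k' hk ↦ ?_⟩
  change V ⟶ I ⨯ (q.extension.obj W).left at k k'
  have hl : k ≫ prod.map (𝟙 I) (q.lab W) = k' ≫ prod.map (𝟙 I) (q.lab W) := by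
    rw [← hj]; exact (reassoc_of% hk) _
  have h₁ : k ≫ prod.fst = k' ≫ prod.fst := by simpa using congrArg (· ≫ prod.fst) hl
  have happ (k : V ⟶ I ⨯ (q.extension.obj W).left) {N : E} (m : N ⟶ V) (b : N ⟶ q.B)
      (h : (m ≫ k ≫ prod.snd) ≫ q.lab W = b ≫ q.f)
      (h' : ((m ≫ k) ≫ j.left) ≫ q'.lab W = prod.lift (m ≫ k ≫ prod.fst) b ≫ q'.f) :
      Poly.app (p := q) (m ≫ k ≫ prod.snd) b h =
        Poly.app (p := q') ((m ≫ k) ≫ j.left) (prod.lift (m ≫ k ≫ prod.fst) b) h' := by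
    have h₂ : (m ≫ k) ≫ prod.map (𝟙 I) (q.lab W) =
        prod.lift (m ≫ k ≫ prod.fst) b ≫ prod.map (𝟙 I) q.f := by
      rw [← hj, ← Category.assoc]; exact h'
    rw [hja (m ≫ k) _ h₂ h']
    refine Eq.trans ?_ (Poly.comp_app _ _ _ _).symm
    refine Poly.app_congr ?_ ?_ _
    · rw [IsPullback.lift_fst_assoc, Category.assoc]
    · have e := congrArg (· ≫ prod.snd) (hN.lift_snd (m ≫ k) (prod.lift (m ≫ k ≫ prod.fst) b) h₂)
      simpa [Limits.prod.lift_fst, Limits.prod.lift_snd] using e.symm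
  refine Limits.prod.hom_ext h₁ (Poly.ext_elem ?_ ?_)
  · simpa using congrArg (· ≫ prod.snd) hl
  · intro N m b h h'
    have hh (k : V ⟶ I ⨯ (q.extension.obj W).left) (h : (m ≫ k ≫ prod.snd) ≫ q.lab W = b ≫ q.f) :
        ((m ≫ k) ≫ j.left) ≫ q'.lab W = prod.lift (m ≫ k ≫ prod.fst) b ≫ q'.f := by
      refine (Category.assoc _ _ _).trans ((congrArg ((m ≫ k) ≫ ·) hj).trans ?_)
      apply Limits.prod.hom_ext
      · simp [q', Limits.prod.lift_fst]
      · simpa [q', Limits.prod.lift_snd] using h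
    rw [happ k m b h (hh k h), happ k' m b h' (hh k' h')]
    refine Poly.app_congr ?_ ?_ _
    · rw [Category.assoc, Category.assoc]; exact congrArg (m ≫ ·) hk
    · rw [h₁]

/-- Every polynomial endofunctor of a slice has an initial algebra. It consists of the untyped trees
which are correctly typed. -/
theorem Poly.exists_isInitialAlgebra [HasWTypes E] {I : E} (p : Poly I I) :
    ∃ (W : Over I) (w : p.extension.obj W ⟶ W), IsIso w ∧ IsInitialAlgebra p.extension w := by
  let q := p.untyped
  obtain ⟨W, w, hw, hW⟩ := HasWTypes.exists_isInitialAlgebra q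
  obtain ⟨W', w', hw'⟩ := HasWTypes.exists_labelled q I
  let v : W ⟶ q.extension.obj W := inv w
  have hwv : w.left ≫ v.left = 𝟙 _ := congrArg (fun t ↦ t.left) (IsIso.hom_inv_id w)
  have hvw : v.left ≫ w.left = 𝟙 _ := congrArg (fun t ↦ t.left) (IsIso.inv_hom_id w)
  -- label the trees with their types
  let α : q.extension.obj W' ⟶ W' := overTop (prod.lift (q.lab W' ≫ p.t) (𝟙 _) ≫ w')
  obtain ⟨fst, hfst, -⟩ := hW W' α
  -- label the trees with the types expected by their parents
  obtain ⟨β, hβl, hβ⟩ : ∃ β : q.extension.obj (q.extension.obj W') ⟶ q.extension.obj W',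
      β.left ≫ q.lab W' = q.lab _ ∧ ∀ {N : E} (m : N ⟶ (q.extension.obj (q.extension.obj W')).left)
        (b : N ⟶ q.B) (h : m ≫ q.lab _ = b ≫ q.f) (h' : (m ≫ β.left) ≫ q.lab _ = b ≫ q.f),
        Poly.app (p := q) (m ≫ β.left) b h' =
          prod.lift (b ≫ p.s) (Poly.app (p := q) m b h) ≫ w' := by
    obtain ⟨β, hβl, hβ⟩ := Poly.exists_lam (p := q) (X := W')
      (Z := q.extension.obj (q.extension.obj W')) (q.lab (q.extension.obj W'))
      (terminal.hom_ext _ _) (IsPullback.of_hasPullback _ _)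
      (prod.lift (pullback.snd _ _ ≫ p.s)
        (Poly.app (p := q) (pullback.fst (q.lab (q.extension.obj W')) q.f) (pullback.snd _ _)
          pullback.condition) ≫ w') (terminal.hom_ext _ _)
    refine ⟨β, hβl, fun m b h h' ↦ ?_⟩
    rw [hβ m b h h', ← Category.assoc]
    congr 1
    apply Limits.prod.hom_ext
    · rw [Category.assoc, Limits.prod.lift_fst, Limits.prod.lift_fst, IsPullback.lift_snd_assoc]
    · rw [Category.assoc, Limits.prod.lift_snd, Limits.prod.lift_snd, Poly.comp_app]
      exact Poly.app_congr (IsPullback.lift_fst _ _ _ _) (IsPullback.lift_snd _ _ _ _) _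
  -- The root has no parent and gets no type, so `snd` takes values in `q W'` and not in `W'`.
  obtain ⟨snd, hsnd, -⟩ := hW _ β
  have hfst' : v.left ≫ (q.extension.map fst).left ≫ α.left = fst.left := by
    have := congrArg (fun t ↦ v.left ≫ t.left) hfst
    dsimp only [Over.comp_left] at this
    rw [← this, reassoc_of% hvw]
  have hsnd' : v.left ≫ (q.extension.map snd).left ≫ β.left = snd.left := by
    have := congrArg (fun t ↦ v.left ≫ t.left) hsnd
    dsimp only [Over.comp_left] at this
    rw [← this, reassoc_of% hvw]
  have hα {N : E} (n : N ⟶ (q.extension.obj W').left) :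
      n ≫ α.left = prod.lift (n ≫ q.lab W' ≫ p.t) n ≫ w' := by
    change n ≫ prod.lift _ _ ≫ w' = _
    rw [← Category.assoc]
    congr 1
    apply Limits.prod.hom_ext <;> simp [Limits.prod.lift_fst, Limits.prod.lift_snd]
  -- As `w'` is mono, one equation in `W'` says both that the root of `x` has type `i` and that the
  -- two labellings agree below the root, which is the definition of a well typed tree.
  have hfst_iff {N : E} (x : N ⟶ W.left) (i : N ⟶ I) :
      x ≫ fst.left = prod.lift i (x ≫ snd.left) ≫ w' ↔
        x ≫ v.left ≫ q.lab W ≫ p.t = i ∧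
          x ≫ v.left ≫ (q.extension.map fst).left = x ≫ snd.left := by
    rw [← hfst', ← Category.assoc v.left, ← Category.assoc x, hα, cancel_mono]
    simp only [Category.assoc, Poly.map_lab_assoc]
    constructor
    · intro h
      exact ⟨by simpa [Limits.prod.lift_fst] using congrArg (· ≫ prod.fst) h,
        by simpa [Limits.prod.lift_snd] using congrArg (· ≫ prod.snd) h⟩
    · rintro ⟨h₁, h₂⟩
      rw [h₁, h₂]
  let e := equalizer.ι (v.left ≫ (q.extension.map fst).left) snd.left
  have he : e ≫ v.left ≫ (q.extension.map fst).left = e ≫ snd.left := equalizer.condition _ _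
  let V : Over I := Over.mk (e ≫ v.left ≫ q.lab W ≫ p.t)
  -- subtrees of correctly typed trees are correctly typed
  have hsub {N : E} (x : N ⟶ V.left) (b : N ⟶ q.B)
      (h : (x ≫ e ≫ v.left) ≫ q.lab W = b ≫ q.f) :
      Poly.app (p := q) (x ≫ e ≫ v.left) b h ≫ fst.left =
        prod.lift (b ≫ p.s) (Poly.app (p := q) (x ≫ e ≫ v.left) b h ≫ snd.left) ≫ w' := by
    have h₁ : ((x ≫ e ≫ v.left) ≫ (q.extension.map fst).left) ≫ q.lab W' = b ≫ q.f := by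
      rw [Category.assoc, Poly.map_lab, h]
    have h₂ : ((x ≫ e ≫ v.left) ≫ (q.extension.map snd).left) ≫ q.lab _ = b ≫ q.f := by
      rw [Category.assoc, Poly.map_lab, h]
    have e₁ : (x ≫ e ≫ v.left) ≫ (q.extension.map fst).left =
        ((x ≫ e ≫ v.left) ≫ (q.extension.map snd).left) ≫ β.left := by
      simp only [Category.assoc]
      rw [he, hsnd']
    rw [← Poly.app_map (p := q) fst _ b h₁, Poly.app_congr e₁ rfl h₁, hβ _ b h₂,
      Poly.app_map (p := q) snd _ b h₂]
  -- The decomposition of a tree restricts to well typed trees: by `hsub` and `hfst_iff` the subtree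
  -- at `b` is well typed, with root of type `p.s b`.
  obtain ⟨γ, hγl, hγ⟩ : ∃ γ : V ⟶ p.extension.obj V, γ.left ≫ p.lab V = e ≫ v.left ≫ q.lab W ∧
      ∀ {N : E} (x : N ⟶ V.left) (b : N ⟶ p.B) (h : (x ≫ e ≫ v.left) ≫ q.lab W = b ≫ q.f)
        (h' : (x ≫ γ.left) ≫ p.lab V = b ≫ p.f), Poly.app (p := p) (x ≫ γ.left) b h' ≫ e =
          Poly.app (p := q) (x ≫ e ≫ v.left) b h := by
    have hc : (pullback.fst (e ≫ v.left ≫ q.lab W) p.f ≫ e ≫ v.left) ≫ q.lab W =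
        pullback.snd _ _ ≫ q.f := by
      simp only [Category.assoc]; exact pullback.condition
    have hs := (hfst_iff _ _).1 (hsub _ _ hc)
    have hs' : Poly.app (p := q) _ _ hc ≫ v.left ≫ (q.extension.map fst).left =
      Poly.app (p := q) _ _ hc ≫ snd.left := hs.2
    obtain ⟨ℓ, hℓ⟩ : ∃ ℓ : pullback (e ≫ v.left ≫ q.lab W) p.f ⟶ V.left,
        ℓ ≫ e = Poly.app (p := q) _ _ hc := ⟨equalizer.lift _ hs', equalizer.lift_ι _ _⟩
    obtain ⟨γ, hγl, hγ⟩ := Poly.exists_lam (p := p) (X := V) (Z := V) (e ≫ v.left ≫ q.lab W)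
      (by simp [V]) (IsPullback.of_hasPullback _ _) ℓ (by
        change _ ≫ e ≫ v.left ≫ q.lab W ≫ p.t = _
        rw [reassoc_of% hℓ]
        exact hs.1)
    refine ⟨γ, hγl, fun x b h h' ↦ ?_⟩
    have h₁ : x ≫ e ≫ v.left ≫ q.lab W = b ≫ p.f := by simpa using h
    rw [hγ x b h₁ h', Category.assoc, hℓ]
    refine (Poly.comp_app (p := q) _ _ _ hc).trans ?_
    refine Poly.app_congr (p := q) ?_ ?_ _
    · exact IsPullback.lift_fst_assoc _ _ _ h₁ _
    · exact IsPullback.lift_snd _ _ _ h₁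
  let ε : (Poly.forgetType I).obj V ⟶ W := overTop e
  let x : (p.extension.obj V).left ⟶ (q.extension.obj W).left :=
    p.toUntypedApp V ≫ (q.extension.map ε).left
  have hxl : x ≫ q.lab W = p.lab V := by
    rw [Category.assoc, Poly.map_lab, Poly.toUntypedApp_lab]
  have hx {N : E} (m : N ⟶ (p.extension.obj V).left) (b : N ⟶ p.B) (h : m ≫ p.lab V = b ≫ p.f)
      (h' : (m ≫ x) ≫ q.lab W = b ≫ q.f) :
      Poly.app (p := q) (m ≫ x) b h' = Poly.app (p := p) m b h ≫ e := by
    have h₁ : (m ≫ p.toUntypedApp V) ≫ q.lab _ = b ≫ q.f := by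
      rw [Category.assoc, Poly.toUntypedApp_lab, h]
    have h₂ : ((m ≫ p.toUntypedApp V) ≫ (q.extension.map ε).left) ≫ q.lab _ = b ≫ q.f := by
      rw [Category.assoc, Poly.map_lab, h₁]
    refine (Poly.app_congr (Category.assoc _ _ _).symm rfl h').trans ?_
    refine (Poly.app_map (p := q) ε _ b h₂).trans ?_
    exact congrArg (· ≫ e) (Poly.app_toUntypedApp m b h h₁)
  -- A label with well typed subtrees of the types required at its positions is a well typed tree,
  -- so the structure map of `W` restricts to `V`.
  have hxw : (x ≫ w.left) ≫ v.left ≫ (q.extension.map fst).left = (x ≫ w.left) ≫ snd.left := by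
    rw [← hsnd']
    simp only [Category.assoc, reassoc_of% hwv]
    refine Poly.ext_elem (p := q) ?_ ?_
    · simp only [Category.assoc, Poly.map_lab, hβl]
    · intro N m b h h'
      have h₀ : (m ≫ x) ≫ q.lab W = b ≫ q.f := by
        rw [← h]; simp only [Category.assoc, Poly.map_lab]
      have h₀' : m ≫ p.lab V = b ≫ p.f := by rw [← hxl, ← Category.assoc, h₀]
      have h₁ : ((m ≫ x) ≫ (q.extension.map fst).left) ≫ q.lab _ = b ≫ q.f := by
        rw [Category.assoc, Poly.map_lab, h₀]
      have h₂ : ((m ≫ x) ≫ (q.extension.map snd).left) ≫ q.lab _ = b ≫ q.f := by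
        rw [Category.assoc, Poly.map_lab, h₀]
      have h₃ : (((m ≫ x) ≫ (q.extension.map snd).left) ≫ β.left) ≫ q.lab _ = b ≫ q.f := by
        rw [Category.assoc, hβl, h₂]
      rw [Poly.app_congr (n' := (m ≫ x) ≫ (q.extension.map fst).left) (by simp) rfl h,
        Poly.app_congr (n' := ((m ≫ x) ≫ (q.extension.map snd).left) ≫ β.left) (by simp) rfl h',
        Poly.app_map (p := q) fst _ b h₁, hβ _ b h₂, Poly.app_map (p := q) snd _ b h₂,
        hx m b h₀' h₀, hfst_iff]
      have h₄ : Poly.app m b h₀' ≫ e ≫ v.left ≫ q.lab W ≫ p.t = b ≫ p.s :=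
        Poly.app_hom (X := V) m b h₀'
      exact ⟨by simpa using h₄, by simpa using Poly.app m b h₀' ≫= he⟩
  let c : p.extension.obj V ⟶ V := Over.homMk (equalizer.lift (x ≫ w.left) hxw) (by
    change _ ≫ e ≫ v.left ≫ q.lab W ≫ p.t = _
    rw [equalizer.lift_ι_assoc, Category.assoc, reassoc_of% hwv, reassoc_of% hxl, Poly.lab_t])
  have hce : c.left ≫ e = x ≫ w.left := equalizer.lift_ι _ _
  have hγx : γ.left ≫ x = e ≫ v.left := by
    refine Poly.ext_elem (p := q) ?_ ?_
    · rw [Category.assoc, hxl, hγl, Category.assoc]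
    · intro N m b h h'
      have h₁ : (m ≫ γ.left) ≫ p.lab V = b ≫ p.f := by
        rw [← hxl]; simpa using h
      have h₂ : ((m ≫ γ.left) ≫ x) ≫ q.lab W = b ≫ q.f := by simpa using h
      rw [Poly.app_congr (Category.assoc _ _ _).symm rfl h, hx (m ≫ γ.left) b h₁ h₂,
        hγ m b h' h₁]
  have hγc : γ ≫ c = 𝟙 V := by
    ext
    rw [← cancel_mono e, Over.comp_left, Category.assoc, hce, reassoc_of% hγx, hvw]
    exact (Category.comp_id _).trans (Category.id_comp _).symm
  have hcγ : c ≫ γ = 𝟙 _ := by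
    refine Poly.hom_ext ?_ ?_
    · rw [Over.comp_left, Category.assoc, hγl, reassoc_of% hce, reassoc_of% hwv, hxl]
      exact (Category.id_comp _).symm
    · intro N m b h h'
      have h₁ : m ≫ p.lab V = b ≫ p.f := by simpa using h'
      have e₁ : (m ≫ c.left) ≫ e ≫ v.left = m ≫ x := by
        rw [Category.assoc, reassoc_of% hce, hwv, Category.comp_id]
      have h₂ : (m ≫ x) ≫ q.lab W = b ≫ q.f := by rw [Category.assoc, hxl, h₁]
      have h₃ : ((m ≫ c.left) ≫ e ≫ v.left) ≫ q.lab W = b ≫ q.f := by rw [e₁, h₂]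
      have h₄ : ((m ≫ c.left) ≫ γ.left) ≫ p.lab V = b ≫ p.f := by simpa using h
      rw [← cancel_mono e, Poly.app_congr (n' := (m ≫ c.left) ≫ γ.left) (by simp) rfl h,
        hγ _ b h₃ h₄, Poly.app_congr e₁ rfl h₃, hx m b h₁ h₂]
      congr 1
      exact Poly.app_congr (by simp) rfl _
  have hcI : IsIso c := ⟨γ, hcγ, hγc⟩
  refine ⟨V, c, hcI, fun Y y ↦ ?_⟩
  -- `V` lies over `W`, and the square of structure maps is a pullback because both are invertible.
  -- Recursion with `γ` the identity is initiality of `V`.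
  have key := IsInitialAlgebra.existsUnique_rec (terminal.from I) p.toUntyped
    p.toUntyped_equifibered q.preservesPullbacks hW ε (i₁ := c)
    (h₁ := p.toUntyped.app V ≫ q.extension.map ε)
    (IsPullback.of_vert_isIso ⟨Over.OverMorphism.ext hce.symm⟩) (𝟙 _)
    (by rw [CategoryTheory.Functor.map_id]; exact Category.id_comp _) y
  simpa using key

end
end PolynomialFunctors

/-! ### Extensivity and free algebras. -/

namespace PolynomialFunctors

noncomputable section

variable {E : Type u} [Category.{v} E]

/-- The maps `i` and `j` exhibit their codomain as a coproduct. -/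
def IsCoprod {X Y Z : E} (i : X ⟶ Z) (j : Y ⟶ Z) : Prop :=
  Nonempty (IsColimit (BinaryCofan.mk i j))

lemma IsCoprod.hom_ext {X Y Z : E} {i : X ⟶ Z} {j : Y ⟶ Z} (h : IsCoprod i j) {W : E}
    {a b : Z ⟶ W} (hi : i ≫ a = i ≫ b) (hj : j ≫ a = j ≫ b) : a = b :=
  BinaryCofan.IsColimit.hom_ext h.some hi hj

lemma IsCoprod.exists_desc {X Y Z : E} {i : X ⟶ Z} {j : Y ⟶ Z} (h : IsCoprod i j) {W : E}
    (a : X ⟶ W) (b : Y ⟶ W) : ∃ c : Z ⟶ W, i ≫ c = a ∧ j ≫ c = b :=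
  ⟨BinaryCofan.IsColimit.desc h.some a b, h.some.fac _ ⟨WalkingPair.left⟩,
    h.some.fac _ ⟨WalkingPair.right⟩⟩

lemma IsCoprod.comp_iso {X Y Z Z' : E} {i : X ⟶ Z} {j : Y ⟶ Z} (h : IsCoprod i j) (e : Z ⟶ Z')
    [IsIso e] : IsCoprod (i ≫ e) (j ≫ e) := by
  let e' : Z ≅ Z' := asIso e
  exact ⟨h.some.ofIsoColimit (BinaryCofan.ext e' rfl rfl)⟩

variable [FinitaryExtensive E]

lemma isCoprod_coprod (X Y : E) : IsCoprod (coprod.inl : X ⟶ X ⨿ Y) (coprod.inr : Y ⟶ X ⨿ Y) :=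
  ⟨coprodIsCoprod X Y⟩

/-- Extensivity in the van Kampen form. One direction recognises `X + P` as a polynomial functor;
the other makes leaves over composite trees a pullback. -/
lemma IsCoprod.isCoprod_iff {X Y Z X' Y' Z' : E} {i : X ⟶ Z} {j : Y ⟶ Z} (h : IsCoprod i j)
    {i' : X' ⟶ Z'} {j' : Y' ⟶ Z'} {a : X' ⟶ X} {b : Y' ⟶ Y} {c : Z' ⟶ Z}
    (hi : a ≫ i = i' ≫ c) (hj : b ≫ j = j' ≫ c) :
    IsCoprod i' j' ↔ IsPullback i' a c i ∧ IsPullback j' b c j :=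
  (BinaryCofan.isVanKampen_iff _).1 (FinitaryExtensive.vanKampen _ h.some) (BinaryCofan.mk i' j')
    a b c hi hj

lemma IsCoprod.mono_left {X Y Z : E} {i : X ⟶ Z} {j : Y ⟶ Z} (h : IsCoprod i j) : Mono i :=
  FinitaryExtensive.mono_inl_of_isColimit h.some

/-- Coproducts are disjoint. -/
lemma IsCoprod.disjoint {X Y Z : E} {i : X ⟶ Z} {j : Y ⟶ Z} (h : IsCoprod i j) {N : E}
    (x : N ⟶ X) (y : N ⟶ Y) (hxy : x ≫ i = y ≫ j) : Nonempty (IsInitial N) := by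
  have hp := FinitaryExtensive.isPullback_initial_to_binaryCofan h.some
  have := HasStrictInitialObjects.out (hp.lift x y hxy) initialIsInitial
  exact ⟨initialIsInitial.ofIso (asIso (hp.lift x y hxy)).symm⟩

namespace Poly

variable [HasFiniteLimits E] [LocallyCartesianClosed E] {I : E} (p : Poly I I) (X : Over I)

/-- The polynomial with an additional label without positions for each element of `X`. -/
abbrev adjoin : Poly I I :=
  ⟨p.B, p.A ⨿ X.left, p.s, p.f ≫ coprod.inl, coprod.desc p.t X.hom⟩

/-- The elements of the extension of `p.adjoin X` with a label in `p.A`. -/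
lemma exists_adjoin_inl : ∃ j : ∀ Z, p.extension.obj Z ⟶ (p.adjoin X).extension.obj Z,
    (∀ {Z Z'} (k : Z ⟶ Z'), j Z ≫ (p.adjoin X).extension.map k = p.extension.map k ≫ j Z') ∧
      ∀ Z, IsPullback (j Z).left (p.lab Z) ((p.adjoin X).lab Z) coprod.inl := by
  have hm : Mono (coprod.inl : p.A ⟶ p.A ⨿ X.left) := (isCoprod_coprod _ _).mono_left
  -- Since `coprod.inl` is mono, an old label has the same positions in `p.adjoin X` as in `p`.
  have hN (Z : Over I) : IsPullback (pullback.fst (p.lab Z) p.f) (pullback.snd (p.lab Z) p.f)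
      (p.lab Z ≫ coprod.inl) (p.adjoin X).f :=
    isPullback_of_exists (by rw [pullback.condition_assoc])
      (fun x y h ↦ ⟨pullback.lift x y (by simpa only [← Category.assoc, cancel_mono] using h),
        pullback.lift_fst _ _ _, pullback.lift_snd _ _ _⟩)
      (fun k k' h h' ↦ pullback.hom_ext h h')
  have hex (Z : Over I) : ∃ j : p.extension.obj Z ⟶ (p.adjoin X).extension.obj Z,
      j.left ≫ (p.adjoin X).lab Z = p.lab Z ≫ coprod.inl ∧
      ∀ {N : E} (m : N ⟶ (p.extension.obj Z).left) (b : N ⟶ p.B) (h : m ≫ p.lab Z = b ≫ p.f)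
        (h' : (m ≫ j.left) ≫ (p.adjoin X).lab Z = b ≫ (p.adjoin X).f),
        app (p := p.adjoin X) (m ≫ j.left) b h' = app (p := p) m b h := by
    obtain ⟨j, hj, hja⟩ := exists_lam (p := p.adjoin X) (Z := p.extension.obj Z) (X := Z)
      (p.lab Z ≫ coprod.inl) (by rw [Category.assoc, coprod.inl_desc, lab_t]) (hN Z) (app (p := p) _ _ pullback.condition)
      (app_hom _ _ _)
    refine ⟨j, hj, fun m b h h' ↦ ?_⟩
    have h₁ : m ≫ p.lab Z ≫ coprod.inl = b ≫ (p.adjoin X).f := by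
      rw [← hj, ← Category.assoc]; exact h'
    refine (hja m b h₁ h').trans ((comp_app _ _ _ _).trans ?_)
    exact app_congr (IsPullback.lift_fst _ _ _ _) (IsPullback.lift_snd _ _ _ _) _
  choose j hjl hja using hex
  refine ⟨j, fun {Z Z'} k ↦ ?_, fun Z ↦ isPullback_of_exists (hjl Z) (fun {V} x y h ↦ ?_) ?_⟩
  · refine hom_ext (by simp [hjl]) fun m b h h' ↦ ?_
    have h₁ : m ≫ p.lab Z = b ≫ p.f := by
      rw [← cancel_mono (coprod.inl : p.A ⟶ p.A ⨿ X.left)]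
      simpa [hjl] using h
    have h₂ : (m ≫ (j Z).left) ≫ (p.adjoin X).lab Z = b ≫ (p.adjoin X).f := by
      rw [Category.assoc, hjl, ← Category.assoc, h₁, Category.assoc]
    have h₃ : ((m ≫ (j Z).left) ≫ ((p.adjoin X).extension.map k).left) ≫ (p.adjoin X).lab Z' =
        b ≫ (p.adjoin X).f := by rw [Category.assoc, map_lab, h₂]
    have h₄ : (m ≫ (p.extension.map k).left) ≫ p.lab Z' = b ≫ p.f := by
      rw [Category.assoc, map_lab, h₁]
    have h₅ : ((m ≫ (p.extension.map k).left) ≫ (j Z').left) ≫ (p.adjoin X).lab Z' =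
        b ≫ (p.adjoin X).f := by rw [Category.assoc, hjl, ← Category.assoc, h₄, Category.assoc]
    refine (app_congr (Category.assoc _ _ _).symm rfl h).trans ?_
    refine (app_map k _ b h₃).trans ?_
    refine Eq.trans ?_ (app_congr (Category.assoc _ _ _).symm rfl h').symm
    refine Eq.trans ?_ (hja Z' _ b h₄ h₅).symm
    refine Eq.trans ?_ (app_map (p := p) k _ b h₄).symm
    rw [hja Z m b h₁ h₂]
  · have hc : (pullback.fst y p.f ≫ x) ≫ (p.adjoin X).lab Z = pullback.snd y p.f ≫
        (p.adjoin X).f := by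
      rw [Category.assoc, h, pullback.condition_assoc]
    obtain ⟨k, hk, hka⟩ := exists_lam (p := p) (X := Z) (Z := Over.mk (y ≫ p.t)) y rfl
      (IsPullback.of_hasPullback _ _) (app (p := p.adjoin X) _ _ hc) (app_hom _ _ _)
    refine ⟨k.left, ext_elem (by rw [Category.assoc, hjl, reassoc_of% hk, h]) ?_, hk⟩
    intro N m b h₁ h₂
    have h₃ : m ≫ y = b ≫ p.f := by
      rw [← cancel_mono (coprod.inl : p.A ⟶ p.A ⨿ X.left)]
      rw [Category.assoc, h] at h₂
      simpa using h₂
    have h₄ : (m ≫ k.left) ≫ p.lab Z = b ≫ p.f := by rw [Category.assoc, hk, h₃]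
    have h₅ : ((m ≫ k.left) ≫ (j Z).left) ≫ (p.adjoin X).lab Z = b ≫ (p.adjoin X).f := by
      rw [Category.assoc, hjl, ← Category.assoc, h₄, Category.assoc]
    refine (app_congr (Category.assoc _ _ _).symm rfl h₁).trans ?_
    refine (hja Z _ b h₄ h₅).trans ((hka m b h₃ h₄).trans ((comp_app _ _ _ _).trans ?_))
    exact app_congr (p := p.adjoin X) (IsPullback.lift_fst_assoc _ _ _ h₃ _)
      (IsPullback.lift_snd _ _ _ h₃) _
  · intro V k k' hk hk'
    refine ext_elem hk' fun m b h h' ↦ ?_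
    have h₁ : ((m ≫ k) ≫ (j Z).left) ≫ (p.adjoin X).lab Z = b ≫ (p.adjoin X).f := by
      rw [Category.assoc, hjl, ← Category.assoc, h, Category.assoc]
    have h₂ : ((m ≫ k') ≫ (j Z).left) ≫ (p.adjoin X).lab Z = b ≫ (p.adjoin X).f := by
      rw [Category.assoc, hjl, ← Category.assoc, h', Category.assoc]
    rw [← hja Z (m ≫ k) b h h₁, ← hja Z (m ≫ k') b h' h₂]
    exact app_congr (by rw [Category.assoc, Category.assoc, hk]) rfl _

/-- The elements of the extension of `p.adjoin X` with a label in `X`. -/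
lemma exists_adjoin_inr : ∃ i : ∀ Z, X ⟶ (p.adjoin X).extension.obj Z,
    (∀ {Z Z'} (k : Z ⟶ Z'), i Z ≫ (p.adjoin X).extension.map k = i Z') ∧
      ∀ Z, IsPullback (i Z).left (𝟙 _) ((p.adjoin X).lab Z) coprod.inr := by
  -- By disjointness a new label has positions only at initial stages, where any two values agree.
  -- An element with such a label is therefore determined by the label.
  have hdis {N : E} {x : N ⟶ X.left} {b : N ⟶ p.B} (h : x ≫ coprod.inr = b ≫ p.f ≫ coprod.inl) :
      Nonempty (IsInitial N) :=
    (isCoprod_coprod p.A X.left).disjoint (b ≫ p.f) x (by rw [h, Category.assoc])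
  have hin := (hdis (pullback.condition (f := (coprod.inr : X.left ⟶ p.A ⨿ X.left))
    (g := p.f ≫ coprod.inl))).some
  have hex (Z : Over I) := exists_lam (p := p.adjoin X) (Z := X) (X := Z)
    coprod.inr (coprod.inr_desc _ _) (IsPullback.of_hasPullback _ _) (hin.to _) (hin.hom_ext _ _)
  choose i hil _ using hex
  have hext {Z : Over I} {V : E} {k k' : V ⟶ ((p.adjoin X).extension.obj Z).left}
      (x : V ⟶ X.left) (hk : k ≫ (p.adjoin X).lab Z = x ≫ coprod.inr)
      (hk' : k' ≫ (p.adjoin X).lab Z = x ≫ coprod.inr) : k = k' := by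
    refine ext_elem (hk.trans hk'.symm) fun m b h _ ↦ ?_
    exact (hdis (x := m ≫ x) (b := b) (by rw [Category.assoc, ← hk, ← Category.assoc, h])).some.hom_ext
      _ _
  refine ⟨i, fun {Z Z'} k ↦ ?_, fun Z ↦ isPullback_of_exists (by rw [hil, Category.id_comp])
    (fun {V} x y h ↦ ⟨y, ?_, Category.comp_id _⟩) fun k k' _ h ↦ by simpa using h⟩
  · ext
    exact hext (𝟙 _) (by simp [hil]) (by simp [hil])
  · exact hext y (by rw [Category.assoc, hil]) h

/-- Every polynomial endofunctor of a slice has free algebras. -/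
theorem exists_isFreeAlgebra [HasWTypes E] : ∃ (W : Over I) (d : X ⟶ W)
    (w : p.extension.obj W ⟶ W), IsFreeAlgebra p.extension d w ∧ IsCoprod d.left w.left := by
  obtain ⟨j, hj, hjp⟩ := p.exists_adjoin_inl X
  obtain ⟨i, hi, hip⟩ := p.exists_adjoin_inr X
  -- Elements of the extension split as their labels do, so `p.adjoin X` is the functor `p + X` and
  -- its algebras are `p`-algebras under `X`.
  have hco (Z : Over I) : IsCoprod (j Z).left (i Z).left :=
    ((isCoprod_coprod p.A X.left).isCoprod_iff (hjp Z).w.symm (hip Z).w.symm).2 ⟨hjp Z, hip Z⟩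
  have hco' (Z : Over I) : IsCoprod (i Z).left (j Z).left :=
    ⟨BinaryCofan.isColimitFlip (hco Z).some⟩
  obtain ⟨W, w, hw, hW⟩ := (p.adjoin X).exists_isInitialAlgebra
  have hwl : IsIso w.left := inferInstanceAs (IsIso ((Over.forget _).map w))
  refine ⟨W, i W ≫ w, j W ≫ w, fun Y x y ↦ ?_, (hco' W).comp_iso w.left⟩
  obtain ⟨z, hzi, hzj⟩ := (hco' Y).exists_desc x.left y.left
  let z' : (p.adjoin X).extension.obj Y ⟶ Y := Over.homMk z ((hco' Y).hom_ext
    (by rw [reassoc_of% hzi, Over.w, Over.w]) (by rw [reassoc_of% hzj, Over.w, Over.w]))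
  have hi' : i Y ≫ z' = x := Over.OverMorphism.ext hzi
  have hj' : j Y ≫ z' = y := Over.OverMorphism.ext hzj
  obtain ⟨k, hk, hku⟩ := hW Y z'
  refine ⟨k, ⟨?_, ?_⟩, fun l hl ↦ hku l ?_⟩
  · rw [Category.assoc, hk, reassoc_of% (hi k), hi']
  · rw [Category.assoc, hk, reassoc_of% (hj k), hj']
  · ext
    apply (hco' W).hom_ext
    · rw [← Over.comp_left, ← Over.comp_left, reassoc_of% (hi l), hi', ← hl.1, Category.assoc]
    · rw [← Over.comp_left, ← Over.comp_left, reassoc_of% (hj l), hj', ← hl.2, Category.assoc]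

end Poly
end
end PolynomialFunctors

/-! ### The polynomial of trees and leaves computes free algebras. -/

namespace PolynomialFunctors

noncomputable section

variable {E : Type u} [Category.{v} E] [HasFiniteLimits E] [LocallyCartesianClosed E]

/-- A strength is compatible with the projections. -/
lemma Strength.app_map_tensorProj {I J : E} {F : Over I ⥤ Over J} (σ : Strength F) (K : E)
    (X : Over I) : σ.app K X ≫ F.map (tensorProj K X) = tensorProj K (F.obj X) := by
  have h (Y : Over I) : tensorProj K Y = tensorMap (terminal.from K) (𝟙 Y) ≫ tensorProj _ Y := by
    ext; simp
  have h' : tensorProj K (F.obj X) =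
      tensorMap (terminal.from K) (F.map (𝟙 X)) ≫ tensorProj _ (F.obj X) := by
    ext; simp
  rw [h, F.map_comp, ← Category.assoc, ← σ.naturality, Category.assoc, σ.unit, h']

/-- The functor `T` with the strength `τ` is, by the maps `η` and `ζ`, the functor of free
`P`-algebras; both maps are cartesian and strong. -/
structure FreeFunctor {I : E} (P : Over I ⥤ Over I) (σ : Strength P) (T : Over I ⥤ Over I)
    (τ : Strength T) where
  η : 𝟭 (Over I) ⟶ T
  ζ : T ⋙ P ⟶ T
  free (X : Over I) : IsFreeAlgebra P (η.app X) (ζ.app X)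
  η_cartesian : NatTrans.Equifibered η
  ζ_cartesian : NatTrans.Equifibered ζ
  η_strong : IsStrong (Strength.id I) τ η
  ζ_strong : IsStrong (τ.comp σ) τ ζ

namespace Poly

variable {I : E}

/-- A polynomial `q` whose labels are the trees built from `p` and whose positions are the leaves
of these trees: the tree `o` without nodes has one leaf, and a leaf of the tree `w n` is a leaf of
one of its subtrees. -/
structure Leaves (p q : Poly I I) where
  o : Over.mk (𝟙 I) ⟶ Over.mk q.t
  w : p.extension.obj (Over.mk q.t) ⟶ Over.mk q.t
  free : IsFreeAlgebra p.extension o w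
  i : I ⟶ q.B
  isPullback_i : IsPullback i (𝟙 I) q.f o.left
  i_s : i ≫ q.s = 𝟙 I
  j {M : E} (n : M ⟶ (p.extension.obj (Over.mk q.t)).left) (c : M ⟶ p.B) (β : M ⟶ q.B)
    (h : n ≫ p.lab _ = c ≫ p.f) (h' : app n c h = β ≫ q.f) : M ⟶ q.B
  comp_j {M N : E} (m : N ⟶ M) (n : M ⟶ (p.extension.obj (Over.mk q.t)).left) (c : M ⟶ p.B)
    (β : M ⟶ q.B) (h : n ≫ p.lab _ = c ≫ p.f) (h' : app n c h = β ≫ q.f)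
    (h₁ : (m ≫ n) ≫ p.lab _ = (m ≫ c) ≫ p.f) (h₁' : app (m ≫ n) (m ≫ c) h₁ = (m ≫ β) ≫ q.f) :
    m ≫ j n c β h h' = j (m ≫ n) (m ≫ c) (m ≫ β) h₁ h₁'
  j_f {M : E} (n : M ⟶ (p.extension.obj (Over.mk q.t)).left) (c : M ⟶ p.B) (β : M ⟶ q.B)
    (h : n ≫ p.lab _ = c ≫ p.f) (h' : app n c h = β ≫ q.f) : j n c β h h' ≫ q.f = n ≫ w.left
  j_s {M : E} (n : M ⟶ (p.extension.obj (Over.mk q.t)).left) (c : M ⟶ p.B) (β : M ⟶ q.B)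
    (h : n ≫ p.lab _ = c ≫ p.f) (h' : app n c h = β ≫ q.f) : j n c β h h' ≫ q.s = β ≫ q.s
  j_inj {M : E} {n : M ⟶ (p.extension.obj (Over.mk q.t)).left} {c c' : M ⟶ p.B} {β β' : M ⟶ q.B}
    {h : n ≫ p.lab _ = c ≫ p.f} {h' : app n c h = β ≫ q.f} {h₁ : n ≫ p.lab _ = c' ≫ p.f}
    {h₁' : app n c' h₁ = β' ≫ q.f} (e : j n c β h h' = j n c' β' h₁ h₁') : c = c' ∧ β = β'
  exists_j {M : E} (b : M ⟶ q.B) (n : M ⟶ (p.extension.obj (Over.mk q.t)).left)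
    (h : b ≫ q.f = n ≫ w.left) : ∃ c β h h', j n c β h h' = b

/-- If the middle map of a polynomial is invertible, then an element of the extension is a label
together with a single value. -/
lemma isPullback_lab_app {J K : E} (l : Poly J K) (r : l.A ⟶ l.B) (hr : r ≫ l.f = 𝟙 _)
    (hr' : l.f ≫ r = 𝟙 _) (X : Over J) :
    IsPullback (l.lab X) (app (𝟙 _) (l.lab X ≫ r) (by simp [hr])) (r ≫ l.s) X.hom := by
  have hb {N : E} {m : N ⟶ (l.extension.obj X).left} {b : N ⟶ l.B} (h : m ≫ l.lab X = b ≫ l.f) :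
      b = m ≫ l.lab X ≫ r := by
    rw [← Category.assoc, h, Category.assoc, hr', Category.comp_id]
  refine isPullback_of_exists (by simp) (fun {V} x y h ↦ ?_) fun {V} k k' h h' ↦ ?_
  · have : IsIso l.f := ⟨r, hr', hr⟩
    have hN : IsPullback (𝟙 V) (x ≫ r) x l.f := IsPullback.of_horiz_isIso ⟨by simp [hr]⟩
    obtain ⟨k, hk, hka⟩ := exists_lam (p := l) (X := X) (Z := Over.mk (x ≫ l.t)) x rfl hN
      y (by rw [← h, Category.assoc])
    refine ⟨k.left, hk, ?_⟩
    have h₁ : (𝟙 V ≫ k.left) ≫ l.lab X = (x ≫ r) ≫ l.f := by simp [hr, hk]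
    rw [comp_app]
    refine (app_congr (by simp) (by rw [← Category.assoc, hk]) _).trans
      ((hka (𝟙 V) (x ≫ r) (by simp [hr]) h₁).trans ?_)
    have h₂ : hN.lift (𝟙 V) (x ≫ r) (by simp [hr]) = 𝟙 V := by
      simpa using hN.lift_fst (𝟙 V) (x ≫ r) (by simp [hr])
    rw [h₂, Category.id_comp]
  · refine ext_elem h fun m b h₁ h₂ ↦ ?_
    rw [comp_app, comp_app] at h'
    have h₃ := congrArg (m ≫ ·) h'
    simp only [comp_app] at h₃
    refine (app_congr ?_ ?_ h₁).trans (h₃.trans (app_congr ?_ ?_ _))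
    · simp
    · simpa using hb h₁
    · simp
    · simp [hb h₂]

namespace Leaves

variable {p q : Poly I I} (l : Leaves p q)

/-- The label of an element of the extension, as a map of the slice. -/
abbrev labOver (q : Poly I I) (X : Over I) : q.extension.obj X ⟶ Over.mk q.t :=
  Over.homMk (q.lab X)

lemma j_inj' {M : E} {n n' : M ⟶ (p.extension.obj (Over.mk q.t)).left} {c c' : M ⟶ p.B}
    {β β' : M ⟶ q.B} {h : n ≫ p.lab _ = c ≫ p.f} {h' : app n c h = β ≫ q.f}
    {h₁ : n' ≫ p.lab _ = c' ≫ p.f} {h₁' : app n' c' h₁ = β' ≫ q.f} (hn : n = n')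
    (e : l.j n c β h h' = l.j n' c' β' h₁ h₁') : c = c' ∧ β = β' := by
  subst hn
  exact l.j_inj e

lemma j_congr {M : E} {n n' : M ⟶ (p.extension.obj (Over.mk q.t)).left} {c c' : M ⟶ p.B}
    {β β' : M ⟶ q.B} {h : n ≫ p.lab _ = c ≫ p.f} {h' : app n c h = β ≫ q.f}
    {h₁ : n' ≫ p.lab _ = c' ≫ p.f} {h₁' : app n' c' h₁ = β' ≫ q.f} (hn : n = n')
    (hc : c = c') (hβ : β = β') : l.j n c β h h' = l.j n' c' β' h₁ h₁' := by
  subst hn hc hβ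
  rfl

/-- The unit turns an element of `X` into the tree without nodes whose only leaf has that element as
value. -/
lemma exists_unit : ∃ η : ∀ X, X ⟶ q.extension.obj X,
    (∀ X, (η X).left ≫ q.lab X = X.hom ≫ l.o.left) ∧
    ∀ (X : Over I) {M : E} (m : M ⟶ X.left) (b : M ⟶ q.B) (h : (m ≫ (η X).left) ≫ q.lab X = b ≫ q.f),
      app (m ≫ (η X).left) b h = m := by
  have hex (X : Over I) : ∃ η : X ⟶ q.extension.obj X,
      η.left ≫ q.lab X = X.hom ≫ l.o.left ∧
      ∀ {M : E} (m : M ⟶ X.left) (b : M ⟶ q.B) (h : (m ≫ η.left) ≫ q.lab X = b ≫ q.f),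
        app (m ≫ η.left) b h = m := by
    have hN : IsPullback (𝟙 X.left) (X.hom ≫ l.i) (X.hom ≫ l.o.left) q.f :=
      ((IsPullback.of_vert_isIso ⟨by simp⟩ : IsPullback X.hom (𝟙 X.left) (𝟙 I) X.hom).paste_horiz
        l.isPullback_i).flip
    obtain ⟨k, hk, hka⟩ := exists_lam (p := q) (Z := X) (X := X) (X.hom ≫ l.o.left)
      (by rw [Category.assoc]; exact (congrArg (X.hom ≫ ·) (Over.w l.o)).trans (Category.comp_id _))
      hN (𝟙 _) (by simp [l.i_s])
    refine ⟨k, hk, fun m b h ↦ (hka m b (by rw [← hk, ← Category.assoc, h]) h).trans (hN.lift_fst _ _ _)⟩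
  choose η h h' using hex
  exact ⟨η, h, h'⟩

/-- The action grafts decorated trees onto a new root: the shape is given by `w`, and the leaf `j n
c β` keeps the value of the leaf `β` in the tree at position `c`. -/
lemma exists_mul : ∃ ζ : ∀ X, p.extension.obj (q.extension.obj X) ⟶ q.extension.obj X,
    (∀ X, (ζ X).left ≫ q.lab X = (p.extension.map (labOver q X)).left ≫ l.w.left) ∧
    ∀ (X : Over I) {M : E} (m : M ⟶ (p.extension.obj (q.extension.obj X)).left) (c : M ⟶ p.B)
      (β : M ⟶ q.B) (h : m ≫ p.lab _ = c ≫ p.f) (h' : app m c h ≫ q.lab X = β ≫ q.f) b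
      (h₁ : (m ≫ (p.extension.map (labOver q X)).left) ≫ p.lab _ = c ≫ p.f)
      (h₁' : app (m ≫ (p.extension.map (labOver q X)).left) c h₁ = β ≫ q.f)
      (_ : b = l.j _ _ _ h₁ h₁') (h₂ : (m ≫ (ζ X).left) ≫ q.lab X = b ≫ q.f),
      app (m ≫ (ζ X).left) b h₂ = app (app m c h) β h' := by
  have hex (X : Over I) : ∃ ζ : p.extension.obj (q.extension.obj X) ⟶ q.extension.obj X,
      ζ.left ≫ q.lab X = (p.extension.map (labOver q X)).left ≫ l.w.left ∧
      ∀ {M : E} (m : M ⟶ (p.extension.obj (q.extension.obj X)).left) (c : M ⟶ p.B)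
        (β : M ⟶ q.B) (h : m ≫ p.lab _ = c ≫ p.f) (h' : app m c h ≫ q.lab X = β ≫ q.f) b
        (h₁ : (m ≫ (p.extension.map (labOver q X)).left) ≫ p.lab _ = c ≫ p.f)
        (h₁' : app (m ≫ (p.extension.map (labOver q X)).left) c h₁ = β ≫ q.f)
        (_ : b = l.j _ _ _ h₁ h₁') (h₂ : (m ≫ ζ.left) ≫ q.lab X = b ≫ q.f),
        app (m ≫ ζ.left) b h₂ = app (app m c h) β h' := by
    have hN := IsPullback.of_hasPullback ((p.extension.map (labOver q X)).left ≫ l.w.left) q.f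
    -- The values are prescribed at the generic leaf of the composite tree, which splits into a
    -- position `c` of the root and a leaf `β` of the subtree there.
    obtain ⟨c, β, h, h', hj⟩ := l.exists_j (pullback.snd _ _)
      (pullback.fst _ _ ≫ (p.extension.map (labOver q X)).left)
      (by rw [Category.assoc]; exact hN.w.symm)
    have h₀ : pullback.fst ((p.extension.map (labOver q X)).left ≫ l.w.left) q.f ≫ p.lab _ =
        c ≫ p.f := by rw [← h, Category.assoc, map_lab]
    have h₀' : app _ c h₀ ≫ q.lab X = β ≫ q.f := by
      rw [← h', app_map]; rfl
    have hw := Over.w (p.extension.map (labOver q X) ≫ l.w)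
    obtain ⟨k, hk, hka⟩ := exists_lam (p := q) (Z := p.extension.obj (q.extension.obj X)) (X := X)
      ((p.extension.map (labOver q X)).left ≫ l.w.left) hw hN (app (app _ c h₀) β h₀')
      ((app_hom _ _ _).trans ((l.j_s _ _ _ h h').symm.trans (congrArg (· ≫ q.s) hj)))
    refine ⟨k, hk, fun m c' β' h₁ h₁' b h₂ h₂' e h₃ ↦ ?_⟩
    have h₄ : m ≫ (p.extension.map (labOver q X)).left ≫ l.w.left = b ≫ q.f := by
      rw [← h₃, Category.assoc, hk]
    refine (hka m b h₄ h₃).trans ?_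
    set r := hN.lift m b h₄
    have hr₁ : r ≫ pullback.fst _ _ = m := hN.lift_fst _ _ _
    have hr₂ : r ≫ pullback.snd _ _ = b := hN.lift_snd _ _ _
    have h₅ : (r ≫ pullback.fst _ _ ≫ (p.extension.map (labOver q X)).left) ≫ p.lab _ =
        (r ≫ c) ≫ p.f := by
      simp only [Category.assoc] at h ⊢
      rw [h]
    have h₅' : app (r ≫ pullback.fst _ _ ≫ (p.extension.map (labOver q X)).left) (r ≫ c) h₅ =
        (r ≫ β) ≫ q.f := by
      rw [Category.assoc, ← h', comp_app]
    -- The splitting of the generic leaf restricts along `r` to a splitting of `b`; injectivity of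
    -- `j` identifies it with the given one.
    have h₆ := l.comp_j r _ c β h h' h₅ h₅'
    rw [hj, hr₂, e] at h₆
    obtain ⟨hc, hβ⟩ := l.j_inj' (by rw [← Category.assoc, hr₁]) h₆
    rw [comp_app]
    exact app_congr ((comp_app _ _ _ _).trans (app_congr hr₁ hc.symm _)) hβ.symm _
  choose ζ h h' using hex
  exact ⟨ζ, h, h'⟩

/-- A tree without nodes has exactly one leaf, so an element of `q X` of that shape is the same as
its value there. -/
lemma isPullback_unit {X : Over I} {η : X ⟶ q.extension.obj X}
    (hη : η.left ≫ q.lab X = X.hom ≫ l.o.left)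
    (hηa : ∀ {M : E} (m : M ⟶ X.left) (b : M ⟶ q.B) (h : (m ≫ η.left) ≫ q.lab X = b ≫ q.f),
      app (m ≫ η.left) b h = m) :
    IsPullback η (Over.homMk X.hom) (labOver q X) l.o := by
  have hi : l.i ≫ q.f = l.o.left := l.isPullback_i.w.trans (Category.id_comp _)
  refine isPullback_of_left (isPullback_of_exists hη (fun {V} x y h ↦ ?_) fun {V} k k' h _ ↦ ?_)
  · have h₁ : x ≫ q.lab X = (y ≫ l.i) ≫ q.f := by rw [Category.assoc, hi]; exact h
    have h₂ : app x (y ≫ l.i) h₁ ≫ X.hom = y := by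
      rw [app_hom, Category.assoc, l.i_s]
      exact Category.comp_id y
    have h₃ : (app x (y ≫ l.i) h₁ ≫ η.left) ≫ q.lab X = x ≫ q.lab X := by
      rw [Category.assoc, hη, reassoc_of% h₂]
      exact h.symm
    refine ⟨app x (y ≫ l.i) h₁, ext_elem h₃ fun m b h₄ h₅ ↦ ?_, h₂⟩
    have h₆ : (m ≫ app x (y ≫ l.i) h₁) ≫ η.left = m ≫ app x (y ≫ l.i) h₁ ≫ η.left :=
      Category.assoc _ _ _
    have h₇ : m ≫ y ≫ l.i = b := by
      have h₈ : b ≫ q.f = (m ≫ y) ≫ l.o.left := by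
        rw [← h₅, Category.assoc, Category.assoc]
        exact congrArg (m ≫ ·) h
      have h₉ := l.isPullback_i.lift_fst b (m ≫ y) h₈
      have h₁₀ := l.isPullback_i.lift_snd b (m ≫ y) h₈
      rw [Category.comp_id] at h₁₀
      rw [h₁₀, Category.assoc] at h₉
      exact h₉
    refine (app_congr h₆.symm rfl h₄).trans ((hηa _ b (by rw [h₆, h₄])).trans ?_)
    rw [comp_app]
    exact app_congr rfl h₇ _
  · have h₁ : (k ≫ η.left) ≫ q.lab X = (k ≫ X.hom ≫ l.i) ≫ q.f := by
      rw [Category.assoc, hη, Category.assoc, Category.assoc, hi]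
    have h₂ : (k' ≫ η.left) ≫ q.lab X = (k ≫ X.hom ≫ l.i) ≫ q.f := by rw [← h₁, h]
    exact (hηa k _ h₁).symm.trans ((app_congr h rfl _).trans (hηa k' _ h₂))

/-- The leaves of `w n` are the pairs of a position of `n` and a leaf of the subtree there. Values
at the leaves of `w n` are therefore the same as a decoration of each subtree, that is, an element
of `p (q X)` over `n`. -/
lemma isPullback_mul {X : Over I} {ζ : p.extension.obj (q.extension.obj X) ⟶ q.extension.obj X}
    (hζ : ζ.left ≫ q.lab X = (p.extension.map (labOver q X)).left ≫ l.w.left)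
    (hζa : ∀ {M : E} (m : M ⟶ (p.extension.obj (q.extension.obj X)).left) (c : M ⟶ p.B)
      (β : M ⟶ q.B) (h : m ≫ p.lab _ = c ≫ p.f) (h' : app m c h ≫ q.lab X = β ≫ q.f) b
      (h₁ : (m ≫ (p.extension.map (labOver q X)).left) ≫ p.lab _ = c ≫ p.f)
      (h₁' : app (m ≫ (p.extension.map (labOver q X)).left) c h₁ = β ≫ q.f)
      (_ : b = l.j _ _ _ h₁ h₁') (h₂ : (m ≫ ζ.left) ≫ q.lab X = b ≫ q.f),
      app (m ≫ ζ.left) b h₂ = app (app m c h) β h') :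
    IsPullback ζ (p.extension.map (labOver q X)) (labOver q X) l.w := by
  refine isPullback_of_left (isPullback_of_exists hζ (fun {V} x y h ↦ ?_) fun {V} k k' h h' ↦ ?_)
  · have hd : (pullback.fst (y ≫ p.lab _) p.f ≫ y) ≫ p.lab _ =
        pullback.snd (y ≫ p.lab _) p.f ≫ p.f := by
      rw [Category.assoc, pullback.condition]
    let a : pullback (y ≫ p.lab _) p.f ⟶ q.A := app (X := Over.mk q.t) _ _ hd
    have ha : a = app (X := Over.mk q.t) _ _ hd := rfl
    have hM := IsPullback.of_hasPullback (y ≫ p.lab (Over.mk q.t)) p.f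
    have hN := IsPullback.of_hasPullback a q.f
    have h₁ : (pullback.fst a q.f ≫ pullback.fst (y ≫ p.lab _) p.f ≫ y) ≫ p.lab _ =
        (pullback.fst a q.f ≫ pullback.snd (y ≫ p.lab _) p.f) ≫ p.f := by
      rw [Category.assoc, hd, Category.assoc]
    have h₁' : app _ _ h₁ = pullback.snd a q.f ≫ q.f := by
      rw [← pullback.condition]
      exact (comp_app (X := Over.mk q.t) _ _ _ hd).symm
    have hg : (pullback.fst a q.f ≫ pullback.fst (y ≫ p.lab _) p.f ≫ x) ≫ q.lab X =
        l.j _ _ _ h₁ h₁' ≫ q.f := by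
      rw [l.j_f, Category.assoc, Category.assoc, Category.assoc, Category.assoc]
      exact congrArg (fun t ↦ pullback.fst a q.f ≫ pullback.fst (y ≫ p.lab _) p.f ≫ t) h
    -- `κ` decorates the subtree `a` at the generic position of `y`: the value at its leaf `β` is
    -- that of `x` at the corresponding leaf of the whole tree. Collecting `κ` over all positions
    -- gives `k`.
    obtain ⟨κ, hκ, hκa⟩ := exists_lam (p := q) (X := X) (Z := Over.mk (a ≫ q.t)) a rfl hN
      (app _ _ hg) (by rw [app_hom, l.j_s])
    obtain ⟨k, hk, hka⟩ := exists_lam (p := p) (X := q.extension.obj X)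
      (Z := Over.mk (y ≫ (p.extension.obj (Over.mk q.t)).hom)) (y ≫ p.lab _)
      (by rw [Category.assoc, lab_t]; rfl)
      hM κ.left ((Over.w κ).trans (app_hom _ _ _))
    have hκ' {M : E} (m : M ⟶ V) (c : M ⟶ p.B) (h₂ : m ≫ y ≫ p.lab _ = c ≫ p.f) :
        hM.lift m c h₂ ≫ a = app (m ≫ y) c (by rw [Category.assoc, h₂]) := by
      rw [ha, comp_app]
      exact app_congr (hM.lift_fst_assoc _ _ _ _) (hM.lift_snd _ _ _) _
    have hy : k.left ≫ (p.extension.map (labOver q X)).left = y := by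
      refine ext_elem (by rw [Category.assoc, map_lab, hk]) fun m c h₂ h₂' ↦ ?_
      have h₃ : ((m ≫ k.left) ≫ (p.extension.map (labOver q X)).left) ≫ p.lab _ = c ≫ p.f := by
        simp only [← h₂, Category.assoc]
      refine (app_congr (Category.assoc _ _ _).symm rfl h₂).trans
        ((app_map (labOver q X) (m ≫ k.left) c h₃).trans ?_)
      have h₄ : m ≫ y ≫ p.lab _ = c ≫ p.f := by rw [← h₂', Category.assoc]
      have h₅ : (m ≫ k.left) ≫ p.lab _ = c ≫ p.f := by rw [Category.assoc, hk, h₄]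
      refine (congrArg (· ≫ q.lab X) (hka m c h₄ h₅)).trans ?_
      rw [Category.assoc]
      exact (congrArg (_ ≫ ·) hκ).trans (hκ' m c h₄)
    have hx : (k.left ≫ ζ.left) ≫ q.lab X = x ≫ q.lab X := by
      rw [Category.assoc, hζ, reassoc_of% hy]
      exact h.symm
    refine ⟨k.left, ext_elem hx fun m b h₂ h₂' ↦ ?_, hy⟩
    have hy' : (m ≫ k.left) ≫ (p.extension.map (labOver q X)).left = m ≫ y := by
      rw [Category.assoc, hy]
    obtain ⟨c, β, h₃, h₃', hj⟩ := l.exists_j b (m ≫ y)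
      (by rw [← h₂', Category.assoc, Category.assoc]; exact congrArg (m ≫ ·) h)
    have h₄ : m ≫ y ≫ p.lab _ = c ≫ p.f := by rw [← h₃, Category.assoc]
    have h₅ : (m ≫ k.left) ≫ p.lab _ = c ≫ p.f := by rw [Category.assoc, hk, h₄]
    have h₆ : (hM.lift m c h₄ ≫ κ.left) ≫ q.lab X = β ≫ q.f := by
      rw [Category.assoc]
      exact (congrArg (_ ≫ ·) hκ).trans ((hκ' m c h₄).trans h₃')
    have h₆' : hM.lift m c h₄ ≫ a = β ≫ q.f := (hκ' m c h₄).trans h₃'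
    have e : app (m ≫ k.left) c h₅ = hM.lift m c h₄ ≫ κ.left := hka m c h₄ h₅
    have h₇ : ((m ≫ k.left) ≫ ζ.left) ≫ q.lab X = b ≫ q.f := by rw [Category.assoc m, h₂]
    refine (app_congr (Category.assoc _ _ _).symm rfl h₂).trans ((hζa (m ≫ k.left) c β h₅
      (by rw [e, h₆]) b (by rw [hy', h₃]) ((app_congr hy' rfl _).trans h₃')
      (hj.symm.trans (l.j_congr hy'.symm rfl rfl)) h₇).trans ?_)
    refine (app_congr e rfl _).trans ((hκa (hM.lift m c h₄) β h₆' h₆).trans ?_)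
    have h₈ := hN.lift_fst (hM.lift m c h₄) β h₆'
    have h₉ := hN.lift_snd (hM.lift m c h₄) β h₆'
    set r := hN.lift (hM.lift m c h₄) β h₆'
    have h₁₀ : (r ≫ pullback.fst a q.f ≫ pullback.fst (y ≫ p.lab _) p.f ≫ y) = m ≫ y := by
      rw [reassoc_of% h₈, hM.lift_fst_assoc]
    have h₁₁ : (r ≫ pullback.fst a q.f ≫ pullback.snd (y ≫ p.lab _) p.f) = c := by
      rw [reassoc_of% h₈, hM.lift_snd]
    rw [comp_app]
    refine app_congr ?_ ?_ _
    · rw [reassoc_of% h₈, hM.lift_fst_assoc]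
    · rw [← hj]
      exact (l.comp_j r _ _ _ h₁ h₁' (by rw [h₁₀, h₁₁, h₃])
        ((app_congr h₁₀ h₁₁ _).trans (h₃'.trans (congrArg (· ≫ q.f) h₉.symm)))).trans
        (l.j_congr h₁₀ h₁₁ h₉)
  · have hl : k ≫ p.lab _ = k' ≫ p.lab _ := by
      have := congrArg (· ≫ p.lab _) h'
      simpa only [Category.assoc, map_lab] using this
    refine ext_elem hl fun m c h₁ h₁' ↦ ext_elem ?_ fun m' β h₂ h₂' ↦ ?_
    · have e : (m ≫ k) ≫ (p.extension.map (labOver q X)).left =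
          (m ≫ k') ≫ (p.extension.map (labOver q X)).left := by
        rw [Category.assoc, Category.assoc, h']
      have h₃ : ((m ≫ k) ≫ (p.extension.map (labOver q X)).left) ≫ p.lab _ = c ≫ p.f := by
        rw [Category.assoc, map_lab, h₁]
      have h₃' : ((m ≫ k') ≫ (p.extension.map (labOver q X)).left) ≫ p.lab _ = c ≫ p.f := by
        rw [Category.assoc, map_lab, h₁']
      exact (app_map (labOver q X) (m ≫ k) c h₃).symm.trans
        ((app_congr e rfl _).trans (app_map (labOver q X) (m ≫ k') c h₃'))
    -- The value of `k` at position `c` and leaf `β` is recovered from `k ≫ ζ.left` at the leaf `j n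
    -- c β`.
    · have val {k : V ⟶ _} (h₁ : (m ≫ k) ≫ p.lab _ = c ≫ p.f)
          (h₂ : (m' ≫ app (m ≫ k) c h₁) ≫ q.lab X = β ≫ q.f) : ∃ h₃ h₃' h₄,
          app (m' ≫ app (m ≫ k) c h₁) β h₂ = app ((m' ≫ m ≫ k) ≫ ζ.left)
            (l.j ((m' ≫ m ≫ k) ≫ (p.extension.map (labOver q X)).left) (m' ≫ c) β h₃ h₃') h₄ := by
        have h₅ : (m' ≫ m ≫ k) ≫ p.lab _ = (m' ≫ c) ≫ p.f := by
          rw [Category.assoc, h₁, Category.assoc]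
        have h₃ : ((m' ≫ m ≫ k) ≫ (p.extension.map (labOver q X)).left) ≫ p.lab _ =
            (m' ≫ c) ≫ p.f := by rw [Category.assoc, map_lab, h₅]
        have h₆ : app (m' ≫ m ≫ k) (m' ≫ c) h₅ ≫ q.lab X = β ≫ q.f := by
          rw [← comp_app m' (m ≫ k) c h₁, h₂]
        have h₃' : app ((m' ≫ m ≫ k) ≫ (p.extension.map (labOver q X)).left) (m' ≫ c) h₃ =
          β ≫ q.f := (app_map (labOver q X) _ _ h₃).trans h₆
        have h₄ : ((m' ≫ m ≫ k) ≫ ζ.left) ≫ q.lab X =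
            l.j ((m' ≫ m ≫ k) ≫ (p.extension.map (labOver q X)).left) (m' ≫ c) β h₃ h₃' ≫ q.f := by
          rw [l.j_f, Category.assoc, hζ, Category.assoc _ _ l.w.left]
        refine ⟨h₃, h₃', h₄, Eq.symm ((hζa _ _ β h₅ h₆ _ h₃ h₃' rfl h₄).trans ?_)⟩
        exact app_congr (comp_app _ _ _ _).symm rfl _
      obtain ⟨_, _, h₄, e⟩ := val h₁ h₂
      obtain ⟨_, _, _, e'⟩ := val h₁' h₂'
      rw [e, e']
      refine app_congr ?_ (l.j_congr ?_ rfl rfl) h₄ <;> simp only [Category.assoc, h, h']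

lemma labOver_map (q : Poly I I) {X Y : Over I} (k : X ⟶ Y) :
    q.extension.map k ≫ labOver q Y = labOver q X :=
  Over.OverMorphism.ext (map_lab k)

/-- By the two pullback lemmas the unit and action of `q X` are pulled back from `o` and `w` along
the label. This yields freeness, by recursion over the free algebra of shapes, and cartesianness, by
cancelling pullbacks. Strongness is compared on labels and values. -/
theorem nonempty_freeFunctor (l : Leaves p q) :
    Nonempty (FreeFunctor p.extension p.strength q.extension q.strength) := by
  obtain ⟨η, hη, hηa⟩ := l.exists_unit
  obtain ⟨ζ, hζ, hζa⟩ := l.exists_mul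
  have hηp (X : Over I) := l.isPullback_unit (hη X) (hηa X)
  have hζp (X : Over I) := l.isPullback_mul (hζ X) (hζa X)
  have hηn {X Y : Over I} (k : X ⟶ Y) : k ≫ η Y = η X ≫ q.extension.map k := by
    refine hom_ext (by simp [hη]) fun m b h h' ↦ ?_
    refine (app_congr (Category.assoc _ _ _).symm rfl h).trans ((hηa Y _ b ?_).trans
      (Eq.trans ?_ (app_congr (Category.assoc _ _ _).symm rfl h').symm))
    · rw [← h]; simp
    · refine Eq.trans ?_ (app_map k _ b ?_).symm
      · rw [hηa]
      · rw [← h']; simp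
  have hζn {X Y : Over I} (k : X ⟶ Y) :
      p.extension.map (q.extension.map k) ≫ ζ Y = ζ X ≫ q.extension.map k := by
    have hl : p.extension.map (q.extension.map k) ≫ p.extension.map (labOver q Y) =
        p.extension.map (labOver q X) := by rw [← Functor.map_comp, labOver_map]
    have hl' := congrArg (fun x ↦ x.left) hl
    simp only [Over.comp_left] at hl'
    refine hom_ext (by simp [hζ, reassoc_of% hl']) fun m b h h' ↦ ?_
    have h₀ : (m ≫ (ζ X).left) ≫ q.lab X = b ≫ q.f := by
      rw [← h']; simp
    obtain ⟨c, β, h₁, h₁', hj⟩ := l.exists_j b (m ≫ (p.extension.map (labOver q X)).left)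
      (by rw [← h₀, Category.assoc, Category.assoc, hζ])
    have h₂ : m ≫ p.lab _ = c ≫ p.f := by rw [← h₁]; simp
    have h₂' : app m c h₂ ≫ q.lab X = β ≫ q.f := by
      rw [← h₁']; exact (app_map (labOver q X) m c h₁).symm
    have h₃ : (m ≫ (p.extension.map (q.extension.map k)).left) ≫ p.lab _ = c ≫ p.f := by
      rw [← h₂]; simp
    have h₃' : app _ c h₃ = app m c h₂ ≫ (q.extension.map k).left := app_map _ m c h₃
    have h₄ : (m ≫ (p.extension.map (q.extension.map k)).left) ≫
        (p.extension.map (labOver q Y)).left = m ≫ (p.extension.map (labOver q X)).left := by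
      rw [Category.assoc, hl']
    refine (app_congr (Category.assoc _ _ _).symm rfl h).trans ((hζa Y _ c β h₃
      (by rw [h₃', Category.assoc, map_lab, h₂']) b (by rw [h₄, h₁]) ((app_congr h₄ rfl _).trans h₁')
      (hj.symm.trans (l.j_congr h₄.symm rfl rfl)) (by rw [← h]; simp)).trans
      (Eq.trans ?_ (app_congr (Category.assoc _ _ _).symm rfl h').symm))
    refine Eq.trans ?_ (app_map k _ b (by rw [← h']; simp)).symm
    refine Eq.trans ?_ (congrArg (· ≫ k.left) (hζa X m c β h₂ h₂' b h₁ h₁' hj.symm h₀)).symm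
    exact (app_congr h₃' rfl _).trans (app_map k _ β (by rw [Category.assoc, map_lab, h₂']))
  have hproj (K : E) (X : Over I) : q.strength.app K X ≫ labOver q (tensorObj K X) =
      tensorProj K (q.extension.obj X) ≫ labOver q X := by
    ext
    exact strength_lab K X
  let η' : 𝟭 (Over I) ⟶ q.extension := { app := η, naturality := fun _ _ k ↦ hηn k }
  let ζ' : q.extension ⋙ p.extension ⟶ q.extension :=
    { app := ζ, naturality := fun _ _ k ↦ hζn k }
  refine ⟨η', ζ', fun X Y x y ↦ ?_, fun X Y k ↦ ?_, fun X Y k ↦ ?_, fun K X ↦ ?_, fun K X ↦ ?_⟩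
  -- The part of `q X` over composite shapes is `p (q X)` itself, so `γ` is the identity.
  · have h := l.free.existsUnique_rec p.preservesPullbacks (labOver q X) (hηp X).flip (hζp X).flip
      (𝟙 _) (Category.id_comp _) x y
    simpa only [Category.id_comp] using h
  · refine (IsPullback.of_right ?_ (η'.naturality k) (hηp Y).flip)
    have e : k ≫ Over.homMk Y.hom = (Over.homMk X.hom : X ⟶ Over.mk (𝟙 I)) := by ext; simp
    have e' : q.extension.map k ≫ labOver q Y = labOver q X := labOver_map q k
    exact e ▸ e' ▸ (hηp X).flip
  · refine (IsPullback.of_right ?_ (ζ'.naturality k) (hζp Y).flip)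
    have e : p.extension.map (q.extension.map k) ≫ p.extension.map (labOver q Y) =
        p.extension.map (labOver q X) := by rw [← Functor.map_comp, labOver_map]
    have e' : q.extension.map k ≫ labOver q Y = labOver q X := labOver_map q k
    exact e ▸ e' ▸ (hζp X).flip
  · change tensorMap (𝟙 K) (η X) ≫ q.strength.app K X = 𝟙 _ ≫ η (tensorObj K X)
    rw [Category.id_comp]
    refine hom_ext (by simp [hη]) fun m b h h' ↦ ?_
    rw [hηa]
    refine (app_congr (Category.assoc _ _ _).symm rfl h).trans ((app_strength K X _ b ?_).trans ?_)
    · rw [← h]; simp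
    · apply tensor_hom_ext
      · simp
      · rw [tensorLift_snd]
        refine (app_congr ?_ rfl _).trans (hηa X (m ≫ tensorSnd K X) b ?_)
        · simp
        · rw [← h]; simp
  · change tensorMap (𝟙 K) (ζ X) ≫ q.strength.app K X =
      (p.strength.app K _ ≫ p.extension.map (q.strength.app K X)) ≫ ζ (tensorObj K X)
    have hl : (p.strength.app K _ ≫ p.extension.map (q.strength.app K X)) ≫
        p.extension.map (labOver q (tensorObj K X)) =
        tensorProj K _ ≫ p.extension.map (labOver q X) := by
      rw [Category.assoc, ← Functor.map_comp, hproj, Functor.map_comp,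
        reassoc_of% (p.strength.app_map_tensorProj K (q.extension.obj X))]
    have hl' := congrArg (fun x ↦ x.left) hl
    simp only [Over.comp_left, Category.assoc, tensorProj_left] at hl'
    refine hom_ext (by simp [hζ, reassoc_of% hl']) fun m b h h' ↦ ?_
    have h₀ : ((m ≫ tensorSnd K _) ≫ (ζ X).left) ≫ q.lab X = b ≫ q.f := by
      rw [← h]; simp
    obtain ⟨c, β, h₁, h₁', hj⟩ := l.exists_j b
      ((m ≫ tensorSnd K _) ≫ (p.extension.map (labOver q X)).left)
      (by rw [← h₀, Category.assoc _ (ζ X).left, hζ, ← Category.assoc])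
    have h₂ : (m ≫ tensorSnd K _) ≫ p.lab _ = c ≫ p.f := by rw [← h₁]; simp
    have h₂' : app _ c h₂ ≫ q.lab X = β ≫ q.f := by
      rw [← h₁']; exact (app_map (labOver q X) _ c h₁).symm
    have h₃ : (m ≫ (p.strength.app K (q.extension.obj X)).left) ≫ p.lab _ = c ≫ p.f := by
      rw [← h₂]; simp
    have h₃' : app _ c h₃ = tensorLift (m ≫ tensorFst K _) (app (m ≫ tensorSnd K _) c h₂) :=
      app_strength K _ m c h₃
    have h₄ : ((m ≫ (p.strength.app K (q.extension.obj X)).left) ≫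
        (p.extension.map (q.strength.app K X)).left) ≫ p.lab _ = c ≫ p.f := by
      rw [← h₃]; simp
    have h₄' : app _ c h₄ = app _ c h₃ ≫ (q.strength.app K X).left := app_map _ _ c h₄
    have h₅ : ((m ≫ (p.strength.app K (q.extension.obj X)).left) ≫
        (p.extension.map (q.strength.app K X)).left) ≫
        (p.extension.map (labOver q (tensorObj K X))).left =
        (m ≫ tensorSnd K _) ≫ (p.extension.map (labOver q X)).left := by
      simp only [Category.assoc, hl']
    have hs : (tensorMap (𝟙 K) (ζ X) ≫ q.strength.app K X).left =
        (tensorMap (𝟙 K) (ζ X)).left ≫ (q.strength.app K X).left := rfl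
    have h₆ : ((m ≫ (tensorMap (𝟙 K) (ζ X)).left) ≫ (q.strength.app K X).left) ≫ q.lab _ =
        b ≫ q.f := by rw [← h, hs, Category.assoc m]
    have h₇ : (((m ≫ (p.strength.app K (q.extension.obj X)).left) ≫
        (p.extension.map (q.strength.app K X)).left) ≫ (ζ (tensorObj K X)).left) ≫ q.lab _ =
        b ≫ q.f := by rw [← h']; simp
    have h₈ : (tensorLift (m ≫ tensorFst K _) (app (m ≫ tensorSnd K _) c h₂) ≫
        (q.strength.app K X).left) ≫ q.lab _ = β ≫ q.f := by
      rw [Category.assoc, strength_lab, ← Category.assoc]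
      exact (congrArg (· ≫ q.lab X) (tensorLift_snd _ _)).trans h₂'
    have h₉ : app _ c h₄ ≫ q.lab _ = β ≫ q.f := by rw [h₄', h₃', h₈]
    refine (app_congr (Category.assoc _ _ _).symm rfl h).trans ((app_strength K X _ b h₆).trans
      (Eq.trans ?_ ((app_congr (by simp) rfl h').trans (hζa _ _ c β h₄ h₉ b (by rw [h₅, h₁])
        ((app_congr h₅ rfl _).trans h₁') (hj.symm.trans (l.j_congr h₅.symm rfl rfl)) h₇)).symm))
    refine Eq.trans ?_ ((app_congr (h₄'.trans (congrArg (· ≫ (q.strength.app K X).left) h₃'))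
      rfl _).trans (app_strength K X _ β h₈)).symm
    apply tensor_hom_ext
    · simp
    · rw [tensorLift_snd, tensorLift_snd]
      refine (app_congr ?_ rfl _).trans ((hζa X _ c β h₂ h₂' b h₁ h₁' hj.symm h₀).trans
        (app_congr ?_ rfl _))
      · simp
      · simp

end Leaves

variable [FinitaryExtensive E] [HasWTypes E]

/-- Leaves of trees are generated by the leaf of the tree without nodes and by passing from a
subtree to the whole tree. They therefore form a free algebra over the object of trees, and
extensivity turns its two constructors into the required bijections. -/
theorem exists_leaves (p : Poly I I) : ∃ q, Nonempty (Leaves p q) := by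
  obtain ⟨W, o, w, hW, hco⟩ := p.exists_isFreeAlgebra (Over.mk (𝟙 I))
  have hc := pullback.condition (f := p.lab W) (g := p.f)
  -- In `l`, labels and positions are both pairs of an element `n` of `p W` and a position of `n`;
  -- `l.s` is the subtree there and `l.t` is the tree `w n`. The middle map is invertible, so each
  -- label has one position.
  obtain ⟨l, r, hr, hr', d, c, hd, hs, ht⟩ : ∃ (l : Poly W.left W.left) (r : l.A ⟶ l.B)
      (_ : r ≫ l.f = 𝟙 _) (_ : l.f ≫ r = 𝟙 _) (d : l.A ⟶ (p.extension.obj W).left) (c : l.A ⟶ p.B)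
      (hd : IsPullback d c (p.lab W) p.f), r ≫ l.s = app d c hd.w ∧ l.t = d ≫ w.left :=
    ⟨⟨_, _, app _ _ hc, 𝟙 _, pullback.fst _ _ ≫ w.left⟩, 𝟙 _, Category.id_comp _,
      Category.id_comp _, pullback.fst _ _, pullback.snd _ _, IsPullback.of_hasPullback _ _,
      Category.id_comp _, rfl⟩
  obtain ⟨B, i, j, hB, hco'⟩ := l.exists_isFreeAlgebra (Over.mk o.left)
  have hpb := l.isPullback_lab_app r hr hr' B
  set v := app (𝟙 _) (l.lab B ≫ r) (by simp [hr]) with hv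
  -- `W` is a coproduct of `I` and `p W`, and `B` is a coproduct of `I` and `l B` lying over it, so
  -- both squares are pullbacks: `hi` describes the leaf of a tree without nodes, `hj` the leaves of
  -- a composite tree.
  obtain ⟨hi, hj⟩ := (hco.isCoprod_iff (i' := i.left) (j' := j.left) (a := 𝟙 I)
    (b := l.lab B ≫ d) (c := B.hom) (by simp)
    (by rw [Category.assoc, ← ht, lab_t, Over.w])).1 hco'
  -- The type of a leaf is defined by recursion into the `l`-algebra `W × I` over `W`, whose action
  -- carries the type unchanged from the subtree.
  let Y : Over W.left := Over.mk (prod.fst : W.left ⨯ I ⟶ W.left)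
  obtain ⟨k, ⟨hki, hkj⟩, -⟩ := hB Y (Over.homMk (prod.lift o.left (𝟙 I)) (prod.lift_fst _ _))
    (Over.homMk (prod.lift (l.extension.obj Y).hom
      (app (𝟙 _) (l.lab Y ≫ r) (by simp [hr]) ≫ prod.snd)) (prod.lift_fst _ _))
  have his : i.left ≫ k.left ≫ prod.snd = 𝟙 I := by
    have e := congrArg (fun x ↦ x.left ≫ prod.snd) hki
    rw [← Category.assoc, ← Over.comp_left]
    exact e.trans (prod.lift_snd _ _)
  have hjs : j.left ≫ k.left ≫ prod.snd = v ≫ k.left ≫ prod.snd := by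
    have e := congrArg (fun x ↦ x.left ≫ prod.snd) hkj
    rw [← Category.assoc, ← Over.comp_left]
    refine e.trans ?_
    rw [Over.comp_left, Category.assoc]
    refine (congrArg (_ ≫ ·) (prod.lift_snd _ _)).trans ?_
    rw [← Category.assoc, ← Category.assoc v, comp_app]
    congr 1
    refine (app_congr (p := l) (n' := 𝟙 _ ≫ (l.extension.map k).left) (b' := l.lab B ≫ r)
      (by simp) (by simp) _).trans (app_map (p := l) k (𝟙 _) (l.lab B ≫ r) _)
  generalize k.left ≫ prod.snd = s at his hjs
  have hl {M : E} (n : M ⟶ (p.extension.obj W).left) (c' : M ⟶ p.B) (β : M ⟶ B.left)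
      (h : n ≫ p.lab _ = c' ≫ p.f) (h' : app n c' h = β ≫ B.hom) :
      hd.lift n c' h ≫ r ≫ l.s = β ≫ B.hom := by
    rw [hs, comp_app, ← h']
    exact app_congr (hd.lift_fst _ _ _) (hd.lift_snd _ _ _) _
  have hinj {M : E} {n : M ⟶ (p.extension.obj W).left} {c₁ c₂ : M ⟶ p.B} {β₁ β₂ : M ⟶ B.left}
      (h₁ : n ≫ p.lab _ = c₁ ≫ p.f) (h₁' : app n c₁ h₁ = β₁ ≫ B.hom)
      (h₂ : n ≫ p.lab _ = c₂ ≫ p.f) (h₂' : app n c₂ h₂ = β₂ ≫ B.hom)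
      (e : hpb.lift (hd.lift n c₁ h₁) β₁ (hl _ _ _ h₁ h₁') ≫ j.left =
        hpb.lift (hd.lift n c₂ h₂) β₂ (hl _ _ _ h₂ h₂') ≫ j.left) : c₁ = c₂ ∧ β₁ = β₂ := by
    have e' : hpb.lift (hd.lift n c₁ h₁) β₁ (hl _ _ _ h₁ h₁') =
        hpb.lift (hd.lift n c₂ h₂) β₂ (hl _ _ _ h₂ h₂') := by
      refine hj.hom_ext e ?_
      rw [hpb.lift_fst_assoc, hpb.lift_fst_assoc, hd.lift_fst, hd.lift_fst]
    constructor
    · have := congrArg (fun x ↦ (x ≫ l.lab B) ≫ c) e'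
      simpa only [hpb.lift_fst, hd.lift_snd] using this
    · have := congrArg (· ≫ v) e'
      simpa only [hpb.lift_snd] using this
  refine ⟨⟨B.left, W.left, s, B.hom, W.hom⟩, ⟨{
    o := o
    w := w
    free := hW
    i := i.left
    isPullback_i := hi
    i_s := his
    j := fun n c β h h' ↦ hpb.lift (hd.lift n c h) β (hl n c β h h') ≫ j.left
    comp_j := fun m n c' β h h' h₁ h₁' ↦ ?_
    j_f := fun n c β h h' ↦ ?_
    j_s := fun n c β h h' ↦ ?_
    j_inj := @fun _ _ _ _ _ _ h h' h₁ h₁' e ↦ hinj h h' h₁ h₁' e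
    exists_j := fun b n h ↦ ?_ }⟩⟩
  · rw [← Category.assoc]
    congr 1
    apply hpb.hom_ext
    · rw [Category.assoc, hpb.lift_fst, hpb.lift_fst]
      apply hd.hom_ext
      · rw [Category.assoc, hd.lift_fst, hd.lift_fst]
      · rw [Category.assoc, hd.lift_snd, hd.lift_snd]
    · rw [Category.assoc, hpb.lift_snd, hpb.lift_snd]
  · rw [Category.assoc]
    refine (congrArg (_ ≫ ·) hj.w).trans ?_
    rw [Category.assoc, hpb.lift_fst_assoc, hd.lift_fst_assoc]
  · rw [Category.assoc]
    refine (congrArg (_ ≫ ·) hjs).trans ?_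
    rw [hpb.lift_snd_assoc]
  · have h₁ : (hj.lift b n h ≫ l.lab B ≫ d) ≫ p.lab W = (hj.lift b n h ≫ l.lab B ≫ c) ≫ p.f := by
      simp only [Category.assoc, hd.w]
    have hn := hj.lift_snd b n h
    have h₂ : n ≫ p.lab W = (hj.lift b n h ≫ l.lab B ≫ c) ≫ p.f := by rw [← h₁, hn]
    have h₃ : hd.lift n _ h₂ = hj.lift b n h ≫ l.lab B := by
      apply hd.hom_ext
      · rw [hd.lift_fst, Category.assoc, hn]
      · rw [hd.lift_snd, Category.assoc]
    have h₅ : (hj.lift b n h ≫ v) ≫ B.hom = app n (hj.lift b n h ≫ l.lab B ≫ c) h₂ := by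
      rw [Category.assoc, ← hpb.w, ← reassoc_of% h₃, hs, comp_app]
      exact app_congr (hd.lift_fst _ _ _) (hd.lift_snd _ _ _) _
    have h₄ : app n (hj.lift b n h ≫ l.lab B ≫ c) h₂ = (hj.lift b n h ≫ v) ≫ B.hom := h₅.symm
    refine ⟨_, _, h₂, h₄, ?_⟩
    refine Eq.trans ?_ (hj.lift_fst b n h)
    congr 1
    apply hpb.hom_ext
    · rw [hpb.lift_fst, h₃]
    · rw [hpb.lift_snd]

end Poly
end
end PolynomialFunctors

/-! ### The monad of free algebras. -/

namespace PolynomialFunctors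

noncomputable section

variable {E : Type u} [Category.{v} E] [HasFiniteLimits E] [LocallyCartesianClosed E]

lemma IsFreeAlgebra.hom_ext {I : E} {P : Over I ⥤ Over I} {D W : Over I} {d : D ⟶ W}
    {w : P.obj W ⟶ W} (hW : IsFreeAlgebra P d w) {Y : Over I} (y : P.obj Y ⟶ Y) {k k' : W ⟶ Y}
    (hd : d ≫ k = d ≫ k') (hk : w ≫ k = P.map k ≫ y) (hk' : w ≫ k' = P.map k' ≫ y) : k = k' :=
  (hW Y (d ≫ k') y).unique ⟨hd, hk⟩ ⟨rfl, hk'⟩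

/-- A morphism between free algebras that is compatible with the generators is invertible. -/
lemma IsFreeAlgebra.isIso {I : E} {P : Over I ⥤ Over I} {D W W' : Over I} {d : D ⟶ W}
    {w : P.obj W ⟶ W} (hW : IsFreeAlgebra P d w) {d' : D ⟶ W'} {w' : P.obj W' ⟶ W'}
    (hW' : IsFreeAlgebra P d' w') (k : W ⟶ W') (hd : d ≫ k = d') (hk : w ≫ k = P.map k ≫ w') :
    IsIso k := by
  obtain ⟨l, ⟨hl, hl'⟩, -⟩ := hW' W d w
  refine ⟨l, hW.hom_ext w ?_ ?_ ?_, hW'.hom_ext w' ?_ ?_ ?_⟩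
  · rw [reassoc_of% hd, hl, Category.comp_id]
  · rw [reassoc_of% hk, hl', P.map_comp, Category.assoc]
  · rw [Category.comp_id, CategoryTheory.Functor.map_id, Category.id_comp]
  · rw [reassoc_of% hl, hd, Category.comp_id]
  · rw [reassoc_of% hl', hk, P.map_comp, Category.assoc]
  · rw [Category.comp_id, CategoryTheory.Functor.map_id, Category.id_comp]

/-- Maps of free algebras along an adjunction. -/
lemma IsFreeAlgebra.existsUnique_along {I : E} {P : Over I ⥤ Over I} {D W : Over I} {d : D ⟶ W}
    {w : P.obj W ⟶ W} (hW : IsFreeAlgebra P d w) {C : Type*} [Category* C] {S : Over I ⥤ C}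
    {R : C ⥤ Over I} (adj : S ⊣ R) {Q : C ⥤ C} (φ : P ⋙ S ⟶ S ⋙ Q) {Z : C} (a : S.obj D ⟶ Z)
    (z : Q.obj Z ⟶ Z) :
    ∃! k : S.obj W ⟶ Z, S.map d ≫ k = a ∧ S.map w ≫ k = φ.app W ≫ Q.map k ≫ z := by
  -- Transposition turns the two equations for `S W ⟶ Z` into those of an algebra map to `R Z`,
  -- whose structure is the transpose of `φ` followed by `Q` of the counit and `z`.
  have key (k : W ⟶ R.obj Z) : (d ≫ k = adj.homEquiv _ _ a ∧ w ≫ k = P.map k ≫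
        adj.homEquiv _ _ (φ.app (R.obj Z) ≫ Q.map (adj.counit.app Z) ≫ z)) ↔
      S.map d ≫ (adj.homEquiv _ _).symm k = a ∧ S.map w ≫ (adj.homEquiv _ _).symm k =
        φ.app W ≫ Q.map ((adj.homEquiv _ _).symm k) ≫ z := by
    rw [← adj.homEquiv_naturality_left_symm, ← adj.homEquiv_naturality_left_symm,
      Equiv.symm_apply_eq, ← adj.homEquiv_naturality_left, Equiv.symm_apply_eq]
    have h := φ.naturality_assoc k (Q.map (adj.counit.app Z) ≫ z)
    dsimp at h
    rw [h, adj.homEquiv_counit, Q.map_comp, Category.assoc]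
  obtain ⟨k, hk, hku⟩ := hW (R.obj Z) (adj.homEquiv _ _ a)
    (adj.homEquiv _ _ (φ.app (R.obj Z) ≫ Q.map (adj.counit.app Z) ≫ z))
  refine ⟨(adj.homEquiv _ _).symm k, (key k).1 hk, fun l hl ↦ ?_⟩
  rw [Equiv.eq_symm_apply]
  refine hku _ ((key _).2 ?_)
  simpa using hl

/-- This places `K ⊗ W` over a free algebra `W` with the pullback squares that recursion requires.
-/
lemma isPullback_tensorProj {I : E} (K : E) {X Y : Over I} (g : X ⟶ Y) :
    IsPullback (tensorProj K X) (tensorMap (𝟙 K) g) g (tensorProj K Y) := by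
  refine isPullback_of_left (isPullback_of_exists (by simp) (fun {V} x y h ↦
    ⟨tensorLift (y ≫ tensorFst K Y) x, by simp, ?_⟩) fun {V} k k' h h' ↦ ?_)
  · apply tensor_hom_ext <;> simp [h]
  · apply tensor_hom_ext
    · simpa using congrArg (· ≫ tensorFst K Y) h'
    · simpa using h

namespace FreeFunctor

variable {I : E} {P : Over I ⥤ Over I} {σ : Strength P} {T : Over I ⥤ Over I} {τ : Strength T}

/-- Free algebras depend only on the functor up to isomorphism. -/
def ofIso (F : FreeFunctor P σ T τ) {P' : Over I ⥤ Over I} {σ' : Strength P'} (e : P ≅ P')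
    (he : IsStrong σ σ' e.hom) : FreeFunctor P' σ' T τ where
  η := F.η
  ζ := Functor.whiskerLeft T e.inv ≫ F.ζ
  free X Y x y := by
    obtain ⟨k, ⟨hk, hk'⟩, hku⟩ := F.free X Y x (e.hom.app Y ≫ y)
    refine ⟨k, ⟨hk, ?_⟩, fun l hl ↦ hku l ⟨hl.1, ?_⟩⟩
    · dsimp
      rw [Category.assoc, hk', ← e.inv.naturality_assoc, e.inv_hom_id_app_assoc]
    · have h := hl.2
      dsimp at h
      rw [Category.assoc] at h
      rw [e.hom.naturality_assoc, ← h, e.hom_inv_id_app_assoc]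
  η_cartesian := F.η_cartesian
  ζ_cartesian := (NatTrans.Equifibered.of_isIso _).comp F.ζ_cartesian
  η_strong := F.η_strong
  ζ_strong := (he.inv.whiskerLeft τ).comp F.ζ_strong

variable (F : FreeFunctor P σ T τ)

section lift

variable {J : E} {G N : Over J ⥤ Over I} (x : G ⟶ N) (ν : N ⋙ P ⟶ N)

/-- The natural transformation defined on free algebras by its values on generators. -/
def lift : G ⋙ T ⟶ N where
  app Y := (F.free (G.obj Y) (N.obj Y) (x.app Y) (ν.app Y)).choose
  naturality Y Y' f := by
    obtain ⟨⟨h, h'⟩, -⟩ := (F.free (G.obj Y) (N.obj Y) (x.app Y) (ν.app Y)).choose_spec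
    obtain ⟨⟨k, k'⟩, -⟩ := (F.free (G.obj Y') (N.obj Y') (x.app Y') (ν.app Y')).choose_spec
    have hη := F.η.naturality (G.map f)
    have hζ := F.ζ.naturality (G.map f)
    have hν := ν.naturality f
    dsimp at hη hζ hν ⊢
    refine (F.free (G.obj Y)).hom_ext (ν.app Y') ?_ ?_ ?_
    · rw [← reassoc_of% hη, k, reassoc_of% h, x.naturality]
    · rw [← reassoc_of% hζ, k', P.map_comp, Category.assoc]
    · rw [reassoc_of% h', P.map_comp, Category.assoc, hν]

lemma η_lift (Y : Over J) : F.η.app (G.obj Y) ≫ (F.lift x ν).app Y = x.app Y :=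
  (F.free (G.obj Y) (N.obj Y) (x.app Y) (ν.app Y)).choose_spec.1.1

lemma ζ_lift (Y : Over J) :
    F.ζ.app (G.obj Y) ≫ (F.lift x ν).app Y = P.map ((F.lift x ν).app Y) ≫ ν.app Y :=
  (F.free (G.obj Y) (N.obj Y) (x.app Y) (ν.app Y)).choose_spec.1.2

variable {x ν}

/-- The pullback `V` of the lift along `N.map f` is itself a free algebra on `G Y`, by recursion
over the free algebra on `G Y'`. The comparison from `T (G Y)` to `V` is then a map of free algebras
fixing the generators, hence invertible. -/
lemma lift_cartesian (hP : PreservesPullbacks P) (hx : NatTrans.Equifibered x)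
    (hν : NatTrans.Equifibered ν) : NatTrans.Equifibered (F.lift x ν) := fun Y Y' f ↦ by
  let ρ := F.lift x ν
  let V := pullback (ρ.app Y') (N.map f)
  have hV : IsPullback (pullback.fst _ _ : V ⟶ _) (pullback.snd _ _) (ρ.app Y') (N.map f) :=
    IsPullback.of_hasPullback _ _
  have hη := F.η.naturality (G.map f)
  have hζ := F.ζ.naturality (G.map f)
  have hρ := ρ.naturality f
  have hνn := ν.naturality f
  dsimp at hη hζ hρ hνn
  let d : G.obj Y ⟶ V := hV.lift (G.map f ≫ F.η.app _) (x.app Y)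
    (by rw [Category.assoc, F.η_lift, x.naturality])
  let w : P.obj V ⟶ V := hV.lift (P.map (pullback.fst _ _) ≫ F.ζ.app _)
    (P.map (pullback.snd _ _) ≫ ν.app Y)
    (by rw [Category.assoc, Category.assoc, ← hνn, F.ζ_lift, ← P.map_comp_assoc,
      ← P.map_comp_assoc, hV.w])
  -- Pasted with `hV` this square becomes the naturality square of `x`; for `hw` the outer square is
  -- made from `P` of `hV` and the naturality square of `ν`.
  have hd : IsPullback (G.map f) d (F.η.app _) (pullback.fst _ _) := by
    refine (IsPullback.of_right (h₁₂ := pullback.snd _ _) (h₂₂ := ρ.app Y') ?_ ?_ hV.flip).flip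
    · rw [hV.lift_snd, F.η_lift]
      exact (hx f).flip
    · exact hV.lift_fst _ _ _
  have hw : IsPullback (P.map (pullback.fst _ _)) w (F.ζ.app _) (pullback.fst _ _) := by
    refine (IsPullback.of_right (h₁₂ := pullback.snd _ _) (h₂₂ := ρ.app Y') ?_ ?_ hV.flip).flip
    · rw [hV.lift_snd, F.ζ_lift]
      exact (hP hV.flip).paste_horiz (hν f).flip
    · exact hV.lift_fst _ _ _
  have hVf : IsFreeAlgebra P d w := fun Z z₀ z ↦ by
    simpa only [Category.id_comp] using (F.free (G.obj Y')).existsUnique_rec hP _ hd hw (𝟙 _)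
      (Category.id_comp _) z₀ z
  let k : T.obj (G.obj Y) ⟶ V := hV.lift (T.map (G.map f)) (ρ.app Y) hρ
  have : IsIso k := by
    refine (F.free (G.obj Y)).isIso hVf k (hV.hom_ext ?_ ?_) (hV.hom_ext ?_ ?_)
    · rw [Category.assoc, hV.lift_fst, hV.lift_fst, hη]
    · rw [Category.assoc, hV.lift_snd, hV.lift_snd, F.η_lift]
    · rw [Category.assoc, hV.lift_fst, Category.assoc, hV.lift_fst, ← P.map_comp_assoc,
        hV.lift_fst, hζ]
    · rw [Category.assoc, hV.lift_snd, Category.assoc, hV.lift_snd, ← P.map_comp_assoc,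
        hV.lift_snd, F.ζ_lift]
  exact IsPullback.of_iso_pullback ⟨hρ⟩ (asIso k) (hV.lift_fst _ _ _) (hV.lift_snd _ _ _)

/-- Both sides are maps out of `K ⊗ T (G Y)`, which lies over `T (G Y)`, and satisfy the same
recursion, where `γ` is the strength of `P`. -/
lemma lift_strong (hP : PreservesPullbacks P) {s : Strength G} {n : Strength N}
    (hx : IsStrong s n x) (hν : IsStrong (n.comp σ) n ν) :
    IsStrong (s.comp τ) n (F.lift x ν) := fun K Y ↦ by
  refine ((F.free (G.obj Y)).existsUnique_rec hP (tensorProj K (T.obj (G.obj Y)))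
    (isPullback_tensorProj K (F.η.app _)) (isPullback_tensorProj K (F.ζ.app _)) (σ.app K _)
    (σ.app_map_tensorProj K _) (tensorMap (𝟙 K) (x.app Y) ≫ n.app K Y)
    (ν.app (tensorObj K Y))).unique ⟨?_, ?_⟩ ⟨?_, ?_⟩
  · rw [← Category.assoc, ← tensorMap_comp, Category.id_comp, F.η_lift]
  · have h := hν K Y
    have h' := σ.naturality (𝟙 K) ((F.lift x ν).app Y)
    dsimp [Strength.comp] at h h'
    rw [← Category.assoc, ← tensorMap_comp, Category.id_comp, F.ζ_lift, ← Category.comp_id (𝟙 K),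
      tensorMap_comp, Category.assoc, h, Category.comp_id, P.map_comp]
    simp only [Category.assoc]
    rw [reassoc_of% h']
  · have h := F.η_strong K (G.obj Y)
    have h' := F.η.naturality (s.app K Y)
    dsimp [Strength.comp, Strength.id] at h h' ⊢
    rw [Category.id_comp] at h
    simp only [Category.assoc]
    rw [reassoc_of% h, ← reassoc_of% h', F.η_lift, hx K Y]
  · have h := F.ζ_strong K (G.obj Y)
    have h' := F.ζ.naturality (s.app K Y)
    dsimp [Strength.comp] at h h' ⊢
    simp only [Category.assoc, P.map_comp]
    simp only [Category.assoc] at h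
    rw [reassoc_of% h, ← reassoc_of% h', F.ζ_lift]

end lift

/-- The components of the unit. -/
def unit (X : Over I) : X ⟶ T.obj X := F.η.app X

/-- The components of the algebra structure. -/
def act (X : Over I) : P.obj (T.obj X) ⟶ T.obj X := F.ζ.app X

/-- The components of the multiplication of the monad of free algebras. -/
def join (X : Over I) : T.obj (T.obj X) ⟶ T.obj X := (F.lift (𝟙 T) F.ζ).app X

lemma free' (X : Over I) : IsFreeAlgebra P (F.unit X) (F.act X) := F.free X

lemma unit_join (X : Over I) : F.unit (T.obj X) ≫ F.join X = 𝟙 (T.obj X) :=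
  F.η_lift (𝟙 T) F.ζ X

lemma act_join (X : Over I) : F.act (T.obj X) ≫ F.join X = P.map (F.join X) ≫ F.act X :=
  F.ζ_lift (𝟙 T) F.ζ X

lemma unit_naturality {X Y : Over I} (k : X ⟶ Y) : F.unit X ≫ T.map k = k ≫ F.unit Y :=
  (F.η.naturality k).symm

lemma act_naturality {X Y : Over I} (k : X ⟶ Y) :
    F.act X ≫ T.map k = P.map (T.map k) ≫ F.act Y :=
  (F.ζ.naturality k).symm

/-- Like associativity below, this compares two algebra maps that agree on generators. -/
lemma map_unit_join (X : Over I) : T.map (F.unit X) ≫ F.join X = 𝟙 (T.obj X) := by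
  refine (F.free' X).hom_ext (F.act X) ?_ ?_ ?_
  · rw [reassoc_of% F.unit_naturality, F.unit_join]
  · rw [reassoc_of% F.act_naturality, F.act_join, P.map_comp, Category.assoc]
  · simp

lemma join_assoc (X : Over I) :
    T.map (F.join X) ≫ F.join X = F.join (T.obj X) ≫ F.join X := by
  refine (F.free' _).hom_ext (F.act X) ?_ ?_ ?_
  · rw [reassoc_of% F.unit_naturality, F.unit_join, reassoc_of% F.unit_join, Category.comp_id]
  · rw [reassoc_of% F.act_naturality, F.act_join, P.map_comp, Category.assoc]
  · rw [reassoc_of% F.act_join, F.act_join, P.map_comp, Category.assoc]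

/-- The monad of free algebras. -/
def monad : CategoryTheory.Monad (Over I) where
  toFunctor := T
  η := F.η
  μ := F.lift (𝟙 T) F.ζ
  left_unit X := F.unit_join X
  right_unit X := F.map_unit_join X
  assoc X := F.join_assoc X

lemma μ_cartesian (hP : PreservesPullbacks P) : NatTrans.Equifibered F.monad.μ :=
  F.lift_cartesian hP (NatTrans.Equifibered.of_isIso (𝟙 _)) F.ζ_cartesian

lemma μ_strong (hP : PreservesPullbacks P) : IsStrong (τ.comp τ) τ F.monad.μ :=
  F.lift_strong hP (fun K X ↦ by simp [tensorMap_id]) F.ζ_strong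

/-- The inclusion of the endofunctor into its free monad. -/
def α : P ⟶ T := P.leftUnitor.inv ≫ Functor.whiskerRight F.η P ≫ F.ζ

lemma α_app (X : Over I) : F.α.app X = P.map (F.unit X) ≫ F.act X :=
  Category.id_comp _

lemma α_cartesian (hP : PreservesPullbacks P) : NatTrans.Equifibered F.α :=
  (NatTrans.Equifibered.of_isIso _).comp <|
    (PreservesPullbacks.equifibered_whiskerRight F.η_cartesian hP).comp F.ζ_cartesian

lemma α_strong : IsStrong σ τ F.α :=
  (IsStrong.leftUnitor σ).inv.comp <| (F.η_strong.whiskerRight σ).comp F.ζ_strong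

/-- The action is recovered from `α` and the multiplication, so a monad map that is prescribed on
`α` is prescribed on the action. -/
lemma α_join (X : Over I) : F.α.app (T.obj X) ≫ F.join X = F.act X := by
  rw [F.α_app, Category.assoc, F.act_join, ← P.map_comp_assoc, F.unit_join, P.map_id,
    Category.id_comp]

/-! ### Monad maps as solutions of recursion equations. -/

section along

variable {C : Type*} [Category* C] {S : Over I ⥤ C} {R : C ⥤ Over I} (adj : S ⊣ R)
  {Q : C ⥤ C} {e : ∀ Z, Z ⟶ Q.obj Z} {m : ∀ Z, Q.obj (Q.obj Z) ⟶ Q.obj Z}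
  (he : ∀ {Y Z} (k : Y ⟶ Z), k ≫ e Z = e Y ≫ Q.map k)
  (hm : ∀ {Y Z} (k : Y ⟶ Z), Q.map (Q.map k) ≫ m Z = m Y ≫ Q.map k)
  (hu : ∀ Z, e (Q.obj Z) ≫ m Z = 𝟙 _) (hu' : ∀ Z, Q.map (e Z) ≫ m Z = 𝟙 _)
  (ha : ∀ Z, Q.map (m Z) ≫ m Z = m (Q.obj Z) ≫ m Z)
  (φ : P ⋙ S ⟶ S ⋙ Q) {ψ : ∀ X, S.obj (T.obj X) ⟶ Q.obj (S.obj X)}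

include adj he hm hu hu' ha in
/-- A monad map out of the monad of free algebras is determined by its compatibility with the unit
and the algebra structure. -/
lemma isMonadMap_iff :
    ((∀ X, S.map (F.unit X) ≫ ψ X = e (S.obj X)) ∧
      (∀ X, S.map (F.join X) ≫ ψ X = ψ (T.obj X) ≫ Q.map (ψ X) ≫ m (S.obj X)) ∧
      ∀ X, S.map (F.α.app X) ≫ ψ X = φ.app X) ↔
    ∀ X, S.map (F.unit X) ≫ ψ X = e (S.obj X) ∧
      S.map (F.act X) ≫ ψ X = φ.app (T.obj X) ≫ Q.map (ψ X) ≫ m (S.obj X) := by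
  have hφ {X Y : Over I} (k : X ⟶ Y) : S.map (P.map k) ≫ φ.app Y = φ.app X ≫ Q.map (S.map k) :=
    φ.naturality k
  refine ⟨fun ⟨h₁, h₂, h₃⟩ X ↦ ⟨h₁ X, ?_⟩, fun h ↦ ⟨fun X ↦ (h X).1, fun X ↦ ?_, fun X ↦ ?_⟩⟩
  · rw [← F.α_join, S.map_comp, Category.assoc, h₂, reassoc_of% h₃]
  -- Both sides of the multiplication axiom solve the recursion on `T (T X)` with value `ψ X` on
  -- generators.
  · refine ((F.free' (T.obj X)).existsUnique_along adj φ (ψ X) (m (S.obj X))).unique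
      ⟨?_, ?_⟩ ⟨?_, ?_⟩
    · rw [← S.map_comp_assoc, F.unit_join, S.map_id, Category.id_comp]
    · rw [← S.map_comp_assoc, F.act_join, S.map_comp, Category.assoc, (h X).2, reassoc_of% hφ,
        Q.map_comp, Category.assoc]
    · rw [reassoc_of% (h (T.obj X)).1, ← reassoc_of% he, hu, Category.comp_id]
    · rw [reassoc_of% (h (T.obj X)).2, ← reassoc_of% hm]
      simp only [Q.map_comp, Category.assoc, ha]
  · rw [F.α_app, S.map_comp, Category.assoc, (h X).2, reassoc_of% hφ, ← Q.map_comp_assoc, (h X).1,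
      hu', Category.comp_id]

end along

/-! ### Extending a transformation to the free monad along an adjunction. -/

section extend

variable {J : E} {S : Over I ⥤ Over J} {R : Over J ⥤ Over I} (adj : S ⊣ R)
  {Q : Over J ⥤ Over J} (e : 𝟭 _ ⟶ Q) (m : Q ⋙ Q ⟶ Q) (φ : P ⋙ S ⟶ S ⋙ Q)

/-- The natural transformation `P R ⟶ R Q` corresponding to `S P ⟶ Q S`. -/
def mate : R ⋙ P ⟶ Q ⋙ R :=
  (R ⋙ P).rightUnitor.inv ≫ Functor.whiskerLeft (R ⋙ P) adj.unit ≫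
    (Functor.associator (R ⋙ P) S R).inv ≫
    Functor.whiskerRight ((Functor.associator R P S).hom ≫ Functor.whiskerLeft R φ ≫
      (Functor.associator R S Q).inv ≫ Functor.whiskerRight adj.counit Q ≫ Q.leftUnitor.hom) R

lemma map_mate_counit (Z : Over J) : S.map ((mate adj φ).app Z) ≫ adj.counit.app (Q.obj Z) =
    φ.app (R.obj Z) ≫ Q.map (adj.counit.app Z) := by
  simp [mate]

/-- The values of `extend` on generators. -/
def extendUnit : 𝟭 (Over I) ⟶ (S ⋙ Q) ⋙ R :=
  adj.unit ≫ Functor.whiskerRight (S.rightUnitor.inv ≫ Functor.whiskerLeft S e) R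

lemma map_extendUnit_counit (X : Over I) :
    S.map ((extendUnit adj e).app X) ≫ adj.counit.app (Q.obj (S.obj X)) = e.app (S.obj X) := by
  simp [extendUnit]

/-- The algebra structure that defines `extend`. -/
def extendAct : ((S ⋙ Q) ⋙ R) ⋙ P ⟶ (S ⋙ Q) ⋙ R :=
  (Functor.associator (S ⋙ Q) R P).hom ≫ Functor.whiskerLeft (S ⋙ Q) (mate adj φ) ≫
    (Functor.associator (S ⋙ Q) Q R).inv ≫
    Functor.whiskerRight ((Functor.associator S Q Q).hom ≫ Functor.whiskerLeft S m) R

lemma map_extendAct_counit (X : Over I) :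
    S.map ((extendAct adj m φ).app X) ≫ adj.counit.app (Q.obj (S.obj X)) =
      φ.app (R.obj (Q.obj (S.obj X))) ≫ Q.map (adj.counit.app (Q.obj (S.obj X))) ≫
        m.app (S.obj X) := by
  have h : (extendAct adj m φ).app X = (mate adj φ).app (Q.obj (S.obj X)) ≫
      R.map (m.app (S.obj X)) := by simp [extendAct]
  rw [h, S.map_comp, Category.assoc]
  have h' := adj.counit.naturality (m.app (S.obj X))
  dsimp at h'
  rw [h', reassoc_of% (map_mate_counit adj φ)]

/-- The natural transformation out of the monad of free algebras induced by a natural transformation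
`φ` from `P` to a monad, relative to an adjunction. -/
def extend : T ⋙ S ⟶ S ⋙ Q :=
  Functor.whiskerRight (T.leftUnitor.inv ≫ F.lift (extendUnit adj e) (extendAct adj m φ)) S ≫
    (Functor.associator (S ⋙ Q) R S).hom ≫ Functor.whiskerLeft (S ⋙ Q) adj.counit ≫
    (S ⋙ Q).rightUnitor.hom

lemma extend_app (X : Over I) : (F.extend adj e m φ).app X =
    S.map ((F.lift (extendUnit adj e) (extendAct adj m φ)).app X) ≫
      adj.counit.app (Q.obj (S.obj X)) := by
  simp [extend]

/-- Together with `map_act_extend` this supplies the recursion equations of `isMonadMap_iff`. -/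
lemma map_unit_extend (X : Over I) :
    S.map (F.unit X) ≫ (F.extend adj e m φ).app X = e.app (S.obj X) := by
  rw [F.extend_app, ← map_extendUnit_counit adj, ← S.map_comp_assoc]
  exact congrArg (fun t ↦ S.map t ≫ _) (F.η_lift (extendUnit adj e) (extendAct adj m φ) X)

lemma map_act_extend (X : Over I) :
    S.map (F.act X) ≫ (F.extend adj e m φ).app X = φ.app (T.obj X) ≫
      Q.map ((F.extend adj e m φ).app X) ≫ m.app (S.obj X) := by
  have h := φ.naturality ((F.lift (extendUnit adj e) (extendAct adj m φ)).app X)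
  dsimp at h
  rw [F.extend_app, ← S.map_comp_assoc]
  refine (congrArg (fun t ↦ S.map t ≫ _)
    (F.ζ_lift (extendUnit adj e) (extendAct adj m φ) X)).trans ?_
  refine (congrArg (· ≫ _) (S.map_comp _ _)).trans ?_
  rw [Category.assoc, map_extendAct_counit, reassoc_of% h, Q.map_comp, Category.assoc]

variable {e m φ}

/-- The extension is built by whiskering and composition from `e`, `m`, `φ`, the unit, the counit
and a lift, and all the functors involved preserve pullbacks; `R` does so as a right adjoint. -/
lemma extend_cartesian (hP : PreservesPullbacks P) (hS : PreservesPullbacks S)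
    (hQ : PreservesPullbacks Q) (hη : NatTrans.Equifibered adj.unit)
    (hε : NatTrans.Equifibered adj.counit) (he : NatTrans.Equifibered e)
    (hm : NatTrans.Equifibered m) (hφ : NatTrans.Equifibered φ) :
    NatTrans.Equifibered (F.extend adj e m φ) := by
  have : R.IsRightAdjoint := adj.isRightAdjoint
  have hR : PreservesPullbacks R := preservesPullbacks_of_isRightAdjoint R
  have hmate : NatTrans.Equifibered (mate adj φ) :=
    (NatTrans.Equifibered.of_isIso _).comp <| (hη.whiskerLeft _).comp <|
      (NatTrans.Equifibered.of_isIso _).comp <| PreservesPullbacks.equifibered_whiskerRight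
      ((NatTrans.Equifibered.of_isIso _).comp <| (hφ.whiskerLeft _).comp <|
        (NatTrans.Equifibered.of_isIso _).comp <|
        (PreservesPullbacks.equifibered_whiskerRight hε hQ).comp
        (NatTrans.Equifibered.of_isIso _)) hR
  have hu : NatTrans.Equifibered (extendUnit adj e) :=
    hη.comp <| PreservesPullbacks.equifibered_whiskerRight
      ((NatTrans.Equifibered.of_isIso _).comp (he.whiskerLeft _)) hR
  have ha : NatTrans.Equifibered (extendAct adj m φ) :=
    (NatTrans.Equifibered.of_isIso _).comp <| (hmate.whiskerLeft _).comp <|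
      (NatTrans.Equifibered.of_isIso _).comp <| PreservesPullbacks.equifibered_whiskerRight
      ((NatTrans.Equifibered.of_isIso _).comp (hm.whiskerLeft _)) hR
  exact (PreservesPullbacks.equifibered_whiskerRight
    ((NatTrans.Equifibered.of_isIso _).comp (F.lift_cartesian hP hu ha)) hS).comp <|
    (NatTrans.Equifibered.of_isIso _).comp <| (hε.whiskerLeft _).comp
    (NatTrans.Equifibered.of_isIso _)

lemma extend_strong (hP : PreservesPullbacks P) {s : Strength S} {r : Strength R} {q : Strength Q}
    (hη : IsStrong (Strength.id I) (s.comp r) adj.unit)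
    (hε : IsStrong (r.comp s) (Strength.id J) adj.counit)
    (he : IsStrong (Strength.id J) q e) (hm : IsStrong (q.comp q) q m)
    (hφ : IsStrong (σ.comp s) (s.comp q) φ) :
    IsStrong (τ.comp s) (s.comp q) (F.extend adj e m φ) := by
  have hmate : IsStrong (r.comp σ) (q.comp r) (mate adj φ) :=
    (IsStrong.rightUnitor _).inv.comp <| (hη.whiskerLeft _).comp <|
      (IsStrong.associator _ _ _).inv.comp <| IsStrong.whiskerRight
      ((IsStrong.associator _ _ _).comp <| (hφ.whiskerLeft _).comp <|
        (IsStrong.associator _ _ _).inv.comp <| (hε.whiskerRight _).comp <|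
        IsStrong.leftUnitor _) _
  have hu : IsStrong (Strength.id I) ((s.comp q).comp r) (extendUnit adj e) :=
    hη.comp <| ((IsStrong.rightUnitor _).inv.comp (he.whiskerLeft _)).whiskerRight _
  have ha : IsStrong (((s.comp q).comp r).comp σ) ((s.comp q).comp r) (extendAct adj m φ) :=
    (IsStrong.associator _ _ _).comp <| (hmate.whiskerLeft _).comp <|
      (IsStrong.associator _ _ _).inv.comp <|
      ((IsStrong.associator _ _ _).comp (hm.whiskerLeft _)).whiskerRight _
  exact (((IsStrong.leftUnitor _).inv.comp (F.lift_strong hP hu ha)).whiskerRight s).comp <|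
    (IsStrong.associator _ _ _).comp <| (hε.whiskerLeft _).comp <| IsStrong.rightUnitor _

end extend

end FreeFunctor
end
end PolynomialFunctors

/-! ### Change of base, and the universal property for polynomial monads. -/

namespace PolynomialFunctors

noncomputable section

variable {E : Type u} [Category.{v} E] [HasFiniteLimits E] [LocallyCartesianClosed E]

section mapPullbackAdj

variable {I J : E} (u : I ⟶ J)

lemma mapPullbackAdj_unit_fst (X : Over I) :
    ((Over.mapPullbackAdj u).unit.app X).left ≫ Strength.pullbackFst u _ = 𝟙 _ := by
  simpa [Over.mapPullbackAdj, Strength.pullbackFst] using pullback.lift_fst _ _ _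

lemma mapPullbackAdj_counit_left (Z : Over J) :
    ((Over.mapPullbackAdj u).counit.app Z).left = Strength.pullbackFst u Z := by
  simp [Over.mapPullbackAdj, Strength.pullbackFst]

/-- An element of `u^* Σ_u X` is an element of `X` with an index that has the same image under `u`
as its type. It comes from the unit when the index is the type, a condition that maps over `I`
preserve and reflect. -/
lemma mapPullbackAdj_unit_cartesian : NatTrans.Equifibered (Over.mapPullbackAdj u).unit := by
  intro X Y f
  let a (X : Over I) : X ⟶ (Over.pullback u).obj ((Over.map u).obj X) :=
    (Over.mapPullbackAdj u).unit.app X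
  have ha (X : Over I) : (a X).left ≫ Strength.pullbackFst u ((Over.map u).obj X) = 𝟙 X.left :=
    mapPullbackAdj_unit_fst u X
  have hn : f ≫ a Y = a X ≫ (Over.pullback u).map ((Over.map u).map f) :=
    (Over.mapPullbackAdj u).unit.naturality f
  have hf : ((Over.pullback u).map ((Over.map u).map f)).left ≫ Strength.pullbackFst u _ =
      Strength.pullbackFst u _ ≫ f.left := Strength.pullback_map_fst u ((Over.map u).map f)
  change IsPullback f (a X) (a Y) ((Over.pullback u).map ((Over.map u).map f))
  clear_value a
  refine isPullback_of_left (isPullback_of_exists (congrArg (fun t ↦ t.left) hn)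
    (fun {V} x y h ↦ ?_) fun {V} k k' _ h ↦ ?_)
  · have h₃ : (y ≫ Strength.pullbackFst u ((Over.map u).obj X)) ≫ f.left = x := by
      rw [Category.assoc, ← hf, ← Category.assoc, ← h, Category.assoc, ha, Category.comp_id]
    refine ⟨y ≫ Strength.pullbackFst u _, h₃, Strength.pullback_hom_ext_left ?_ ?_⟩
    · rw [Category.assoc, ha, Category.comp_id]
    · have h₄ := congrArg (· ≫ ((Over.pullback u).obj ((Over.map u).obj Y)).hom) h
      have h₅ : f.left ≫ Y.hom = X.hom := Over.w f
      simp only [Category.assoc, Over.w] at h₄ ⊢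
      rw [← h₄, ← h₃, Category.assoc, Category.assoc, h₅]
  · simpa only [Category.assoc, ha, Category.comp_id] using
      congrArg (· ≫ Strength.pullbackFst u _) h

/-- The counit at `X` is the base change of `u` along `X.hom`, so its naturality squares are
pullbacks by cancellation. -/
lemma mapPullbackAdj_counit_cartesian : NatTrans.Equifibered (Over.mapPullbackAdj u).counit := by
  intro X Y f
  have hc (X : Over J) := mapPullbackAdj_counit_left u X
  refine isPullback_of_left ?_
  rw [hc, hc]
  change IsPullback ((Over.pullback u).map f).left (Strength.pullbackFst u X)
    (Strength.pullbackFst u Y) f.left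
  refine isPullback_of_exists (Strength.pullback_map_fst u f)
    (fun {V} x y h ↦ ?_) fun {V} k k' h h' ↦ ?_
  · have h₁ : y ≫ X.hom = (x ≫ ((Over.pullback u).obj Y).hom) ≫ u := by
      rw [← Over.w f, ← Category.assoc, ← h, Category.assoc, Strength.pullbackFst_hom,
        Category.assoc]
    refine ⟨pbLift y (x ≫ ((Over.pullback u).obj Y).hom) h₁,
      Strength.pullback_hom_ext_left ?_ ?_, pbLift_fst _ _ _⟩
    · rw [Category.assoc, Strength.pullback_map_fst, ← Category.assoc, pbLift_fst, h]
    · rw [Category.assoc, Over.w, pbLift_hom]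
  · refine Strength.pullback_hom_ext_left h' ?_
    rw [← Over.w ((Over.pullback u).map f), ← Category.assoc, h, Category.assoc]

lemma mapPullbackAdj_unit_strong : IsStrong (Strength.id I)
    ((Strength.depSum u).comp (Strength.pullback u)) (Over.mapPullbackAdj u).unit := by
  intro K X
  let a (X : Over I) : X ⟶ (Over.pullback u).obj ((Over.map u).obj X) :=
    (Over.mapPullbackAdj u).unit.app X
  have ha (X : Over I) : (a X).left ≫ Strength.pullbackFst u ((Over.map u).obj X) = 𝟙 X.left :=
    mapPullbackAdj_unit_fst u X
  change tensorMap (𝟙 K) (a X) ≫ (Strength.pullback u).app K ((Over.map u).obj X) ≫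
    (Over.pullback u).map ((Strength.depSum u).app K X) = 𝟙 _ ≫ a (tensorObj K X)
  rw [Category.id_comp]
  clear_value a
  have h₁ : ((Strength.pullback u).app K ((Over.map u).obj X)).left ≫ Strength.pullbackFst u _ =
      tensorLift (tensorFst K _) (tensorSnd K _ ≫ Strength.pullbackFst u _) :=
    Strength.pullbackLift_fst _ _ _
  refine Strength.pullback_hom_ext ?_
  rw [ha]
  simp only [Over.comp_left, Category.assoc, Strength.pullback_map_fst]
  rw [reassoc_of% h₁]
  refine tensor_hom_ext (I := I) (X := X) ?_ ?_
  · have h₂ : ((Strength.depSum u).app K X).left ≫ tensorFst K X = tensorFst K _ :=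
      tensorLift_fst _ _
    rw [Category.assoc, Category.assoc, h₂]
    refine (congrArg (_ ≫ ·) (tensorLift_fst _ _)).trans ?_
    simp
  · have h₂ : ((Strength.depSum u).app K X).left ≫ tensorSnd K X = tensorSnd K _ :=
      tensorLift_snd _ _
    rw [Category.assoc, Category.assoc, h₂]
    refine (congrArg (_ ≫ ·) (tensorLift_snd _ _)).trans ?_
    rw [tensorMap_snd_assoc, Category.assoc, ha]
    simp

lemma mapPullbackAdj_counit_strong : IsStrong ((Strength.pullback u).comp (Strength.depSum u))
    (Strength.id J) (Over.mapPullbackAdj u).counit := by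
  intro K X
  let c (X : Over J) : (Over.map u).obj ((Over.pullback u).obj X) ⟶ X :=
    (Over.mapPullbackAdj u).counit.app X
  have hc (X : Over J) : (c X).left = Strength.pullbackFst u X := mapPullbackAdj_counit_left u X
  change tensorMap (𝟙 K) (c X) ≫ 𝟙 _ = ((Strength.depSum u).app K _ ≫
    (Over.map u).map ((Strength.pullback u).app K X)) ≫ c (tensorObj K X)
  clear_value c
  have h₁ : ((Over.map u).map ((Strength.pullback u).app K X)).left ≫
      Strength.pullbackFst u (tensorObj K X) =
      tensorLift (tensorFst K ((Over.pullback u).obj X))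
        (tensorSnd K ((Over.pullback u).obj X) ≫ Strength.pullbackFst u _) :=
    Strength.pullbackLift_fst _ _ _
  rw [Category.comp_id]
  ext
  rw [Over.comp_left, Over.comp_left, hc, Category.assoc, h₁]
  apply tensor_hom_ext
  · simp [Strength.depSum]
  · simp [Strength.depSum, hc]

end mapPullbackAdj

lemma IsPolynomial.preservesPullbacks {I J : E} {F : Over I ⥤ Over J} {σ : Strength F}
    (h : IsPolynomial σ) : PreservesPullbacks F := by
  obtain ⟨p, e, -⟩ := h
  exact p.preservesPullbacks.of_iso e

/-- Every polynomial endofunctor has free algebras, given by a polynomial functor. -/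
theorem IsPolynomial.exists_freeFunctor [FinitaryExtensive E] [HasWTypes E] {I : E}
    {P : Over I ⥤ Over I} {σ : Strength P} (h : IsPolynomial σ) :
    ∃ q : Poly I I, Nonempty (FreeFunctor P σ q.extension q.strength) := by
  obtain ⟨p, e, he⟩ := h
  obtain ⟨q, ⟨l⟩⟩ := p.exists_leaves
  obtain ⟨F⟩ := l.nonempty_freeFunctor
  exact ⟨q, ⟨F.ofIso e he⟩⟩

namespace FreeFunctor

variable {I : E} {P : Over I ⥤ Over I} {σ : Strength P} {T : Over I ⥤ Over I} {τ : Strength T}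
  (F : FreeFunctor P σ T τ)

/-- The extension and its uniqueness are used with the identity adjunction; neither requires the
target monad or the transformation to be cartesian or strong. -/
theorem isFreeMonad : IsFreeMonad P F.monad F.α := by
  intro T' φ
  let φ' : P ⋙ 𝟭 _ ⟶ 𝟭 _ ⋙ T'.toFunctor := P.rightUnitor.hom ≫ φ ≫ T'.toFunctor.leftUnitor.inv
  have hφ' (X : Over I) : φ'.app X = φ.app X := by simp [φ']
  have hiff (ψ : ∀ X, T.obj X ⟶ T'.obj X) :=
    F.isMonadMap_iff (S := 𝟭 _) Adjunction.id (e := T'.η.app) (m := T'.μ.app) (T'.η.naturality ·)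
      (T'.μ.naturality ·) T'.left_unit T'.right_unit T'.assoc φ' (ψ := ψ)
  let ε := F.extend Adjunction.id T'.η T'.μ φ'
  have hε := (hiff ε.app).2 fun X ↦
    ⟨F.map_unit_extend Adjunction.id T'.η T'.μ φ' X, F.map_act_extend Adjunction.id T'.η T'.μ φ' X⟩
  refine ⟨{ app := fun X ↦ ε.app X, naturality := ?_, app_η := hε.1, app_μ := ?_ }, ?_, ?_⟩
  · exact fun _ _ k ↦ ε.naturality k
  -- `app_μ` composes the two copies of the map in the other order; naturality exchanges them.
  · intro X
    refine (hε.2.1 X).trans ?_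
    exact (Category.assoc _ _ _).symm.trans
      (congrArg (· ≫ T'.μ.app X) (ε.naturality (ε.app X)).symm)
  · ext X : 2
    exact (hε.2.2 X).trans (hφ' X)
  · intro ψ hψ
    have hψ' := (hiff ψ.app).1 ⟨ψ.app_η, fun X ↦ ?_, fun X ↦ ?_⟩
    · ext X : 2
      exact ((F.free' X).existsUnique_along Adjunction.id φ' (T'.η.app X) (T'.μ.app X)).unique
        (hψ' X) ((hiff ε.app).1 hε X)
    · refine (ψ.app_μ X).trans ?_
      exact (congrArg (· ≫ T'.μ.app X) (ψ.naturality (ψ.app X))).trans (Category.assoc _ _ _)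
    · rw [hφ', ← hψ]
      rfl

variable (hP : PreservesPullbacks P) (hT : IsPolynomial τ)

/-- The monad of free algebras as a polynomial monad. -/
def polynomialMonad : PolynomialMonad I where
  monad := F.monad
  strength := τ
  isPolynomial := hT
  unit_cartesian := F.η_cartesian
  mul_cartesian := F.μ_cartesian hP
  unit_strong := F.η_strong
  mul_strong := F.μ_strong hP

end FreeFunctor

namespace PolyEnd

lemma Hom.nat_eq {P Q : PolyEnd E} {u : P.base ⟶ Q.base}
    {φ ψ : P.functor ⋙ Over.map u ⟶ Over.map u ⋙ Q.functor} {hc hs hc' hs'}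
    (h : (⟨u, φ, hc, hs⟩ : Hom P Q) = ⟨u, ψ, hc', hs'⟩) : φ = ψ := by
  simpa using h

/-- Precomposition with a map over the identity produces the base map `𝟙 I ≫ u`. The coherence
isomorphisms cancel, once `Over.mapCongr` corrects this base to `u`. -/
lemma mapId_comp_app {I J : E} (u : I ⟶ J) {F G : Over I ⥤ Over I} {R : Over J ⥤ Over J}
    (α : F ⟶ G) (ψ : G ⋙ Over.map u ⟶ Over.map u ⋙ R) (X : Over I) :
    ((Over.mapComp (𝟙 I) u).hom.app (F.obj X) ≫
      (Over.map u).map ((Over.mapId I).hom.app (F.obj X) ≫ α.app X ≫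
        G.map ((Over.mapId I).inv.app X)) ≫ ψ.app ((Over.map (𝟙 I)).obj X) ≫
      R.map ((Over.mapComp (𝟙 I) u).inv.app X)) ≫
        R.map ((Over.mapCongr _ _ (Category.id_comp u)).hom.app X) =
      (Over.mapCongr _ _ (Category.id_comp u)).hom.app (F.obj X) ≫
        (Over.map u).map (α.app X) ≫ ψ.app X := by
  have hψ := ψ.naturality ((Over.mapId I).inv.app X)
  dsimp only [Functor.comp_map] at hψ
  simp only [Functor.map_comp, Category.assoc]
  rw [reassoc_of% hψ, ← R.map_comp, ← R.map_comp, coh_id_left_inv,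
    reassoc_of% (coh_id_left u (F.obj X))]
  refine congrArg (fun t ↦ _ ≫ _ ≫ t) ?_
  exact (congrArg _ (R.map_id _)).trans (Category.comp_id _)

lemma Hom.ofFibre_comp_app {I : E} {F G : Over I ⥤ Over I} {σ : Strength F} {τ : Strength G}
    (hF : IsPolynomial σ) (hG : IsPolynomial τ) (α : F ⟶ G) (hc : NatTrans.Equifibered α)
    (hs : IsStrong σ τ α) {R : PolyEnd E} (ψ : Hom ⟨I, G, τ, hG⟩ R) (X : Over I) :
    ((Hom.ofFibre hF hG α hc hs).comp ψ).nat.app X ≫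
        R.functor.map ((Over.mapCongr _ _ (Category.id_comp ψ.base)).hom.app X) =
      (Over.mapCongr _ _ (Category.id_comp ψ.base)).hom.app (F.obj X) ≫
        (Over.map ψ.base).map (α.app X) ≫ ψ.nat.app X := by
  have h₁ := Hom.comp_app (Hom.ofFibre hF hG α hc hs) ψ X
  rw [Hom.ofFibre_app] at h₁
  exact (congrArg (· ≫ R.functor.map ((Over.mapCongr _ _ (Category.id_comp ψ.base)).hom.app X))
    h₁).trans (mapId_comp_app ψ.base α ψ.nat X)

end PolyEnd

lemma PolyEnd.preservesPullbacks (P : PolyEnd E) : PreservesPullbacks P.functor :=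
  P.isPolynomial.preservesPullbacks

namespace FreeFunctor

variable {P : PolyEnd E} {T : Over P.base ⥤ Over P.base} {τ : Strength T}
  (F : FreeFunctor P.functor P.strength T τ) (hT : IsPolynomial τ)

/-- The monad of free algebras as an object of the category of polynomial monads. -/
abbrev polyMnd : PolyMnd E := ⟨P.base, F.polynomialMonad P.preservesPullbacks hT⟩

/-- The inclusion of a polynomial endofunctor into its free monad. -/
abbrev incl : P ⟶ (F.polyMnd hT).toPolyEnd :=
  PolyEnd.Hom.ofFibre P.isPolynomial hT F.α (F.α_cartesian P.preservesPullbacks) F.α_strong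

lemma isMonadMap_iff' {T' : PolyMnd E} {u : P.base ⟶ T'.base}
    (φ : P.functor ⋙ Over.map u ⟶ Over.map u ⋙ T'.monad.toFunctor)
    (ψ : T ⋙ Over.map u ⟶ Over.map u ⋙ T'.monad.toFunctor) :
    (PolyMnd.IsMonadMap (S := F.polyMnd hT) (T := T') u ψ ∧
        ∀ X, (Over.map u).map (F.α.app X) ≫ ψ.app X = φ.app X) ↔
      ∀ X, (Over.map u).map (F.unit X) ≫ ψ.app X = T'.monad.η.app ((Over.map u).obj X) ∧
        (Over.map u).map (F.act X) ≫ ψ.app X = φ.app (T.obj X) ≫ T'.monad.map (ψ.app X) ≫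
          T'.monad.μ.app ((Over.map u).obj X) :=
  (and_assoc.trans (F.isMonadMap_iff (Over.mapPullbackAdj u) (e := T'.monad.η.app)
    (m := T'.monad.μ.app) (T'.monad.η.naturality ·) (T'.monad.μ.naturality ·) T'.monad.left_unit
    T'.monad.right_unit T'.monad.assoc φ (ψ := ψ.app)))

/-- The extension along `Σ_u ⊣ u^*` is cartesian and strong because the unit and counit of this
adjunction are. -/
lemma exists_polyMnd_hom {T' : PolyMnd E} (φ : P ⟶ T'.toPolyEnd) :
    ∃ ψ : F.polyMnd hT ⟶ T', F.incl hT ≫ ψ.toHom = φ := by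
  obtain ⟨u, φ, hc, hs⟩ := φ
  let ψ := F.extend (Over.mapPullbackAdj u) T'.monad.η T'.monad.μ φ
  have hψ := (F.isMonadMap_iff' hT φ ψ).2 fun X ↦
    ⟨F.map_unit_extend (Over.mapPullbackAdj u) T'.monad.η T'.monad.μ φ X,
      F.map_act_extend (Over.mapPullbackAdj u) T'.monad.η T'.monad.μ φ X⟩
  have hψc : NatTrans.Equifibered ψ := F.extend_cartesian _ P.preservesPullbacks
    (preservesPullbacks_map u) T'.toPolyEnd.preservesPullbacks (mapPullbackAdj_unit_cartesian u)
    (mapPullbackAdj_counit_cartesian u) T'.mon.unit_cartesian T'.mon.mul_cartesian hc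
  have hψs : IsStrong (τ.comp (Strength.depSum u)) ((Strength.depSum u).comp T'.mon.strength) ψ :=
    F.extend_strong _ P.preservesPullbacks (mapPullbackAdj_unit_strong u)
      (mapPullbackAdj_counit_strong u) T'.mon.unit_strong T'.mon.mul_strong hs
  let ψ' : PolyEnd.Hom (F.polyMnd hT).toPolyEnd T'.toPolyEnd := ⟨u, ψ, hψc, hψs⟩
  have h : (F.incl hT).comp ψ' = ⟨u, φ, hc, hs⟩ := by
    refine PolyEnd.Hom.ext_of_app (Category.id_comp u) fun X ↦ ?_
    have h₁ := PolyEnd.Hom.ofFibre_comp_app P.isPolynomial hT F.α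
      (F.α_cartesian P.preservesPullbacks) F.α_strong ψ' X
    have h₂ := hψ.2 X
    exact h₁.trans (congrArg (_ ≫ ·) h₂)
  exact ⟨⟨ψ', hψ.1⟩, h⟩

/-- Equal restrictions along the inclusion force equal base maps. Both transformations then solve
the same recursion, for their common restriction to `P`. -/
lemma polyMnd_hom_ext {T' : PolyMnd E} {ψ ψ' : F.polyMnd hT ⟶ T'}
    (h : F.incl hT ≫ ψ.toHom = F.incl hT ≫ ψ'.toHom) : ψ = ψ' := by
  obtain ⟨⟨u, ψ, hc, hs⟩, hψ⟩ := ψ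
  obtain ⟨⟨u', ψ', hc', hs'⟩, hψ'⟩ := ψ'
  have hu : 𝟙 _ ≫ u = 𝟙 _ ≫ u' := congrArg PolyEnd.Hom.base h
  rw [Category.id_comp, Category.id_comp] at hu
  subst hu
  change T ⋙ Over.map u ⟶ Over.map u ⋙ T'.monad.toFunctor at ψ
  change T ⋙ Over.map u ⟶ Over.map u ⋙ T'.monad.toFunctor at ψ'
  have hα (X : Over P.base) : (Over.map u).map (F.α.app X) ≫ ψ.app X =
      (Over.map u).map (F.α.app X) ≫ ψ'.app X := by
    have h₁ := congrArg (fun t ↦ t.app X) (PolyEnd.Hom.nat_eq h)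
    have h₂ := PolyEnd.Hom.ofFibre_comp_app P.isPolynomial hT F.α
      (F.α_cartesian P.preservesPullbacks) F.α_strong (R := T'.toPolyEnd) ⟨u, ψ, hc, hs⟩ X
    have h₃ := PolyEnd.Hom.ofFibre_comp_app P.isPolynomial hT F.α
      (F.α_cartesian P.preservesPullbacks) F.α_strong (R := T'.toPolyEnd) ⟨u, ψ', hc', hs'⟩ X
    exact (cancel_epi ((Over.mapCongr _ _ (Category.id_comp u)).hom.app _)).1
      (h₂.symm.trans ((congrArg (· ≫ _) h₁).trans h₃))
  suffices ψ = ψ' by subst this; rfl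
  let φ : P.functor ⋙ Over.map u ⟶ Over.map u ⋙ T'.monad.toFunctor :=
    Functor.whiskerRight F.α (Over.map u) ≫ ψ
  ext X : 2
  exact ((F.free' X).existsUnique_along (Over.mapPullbackAdj u) φ _ (T'.monad.μ.app _)).unique
    ((F.isMonadMap_iff' hT φ ψ).1 ⟨hψ, fun X ↦ rfl⟩ X)
    ((F.isMonadMap_iff' hT φ ψ').1 ⟨hψ', fun X ↦ (hα X).symm⟩ X)

end FreeFunctor

/-- One construction of free algebras serves both universal properties: among all monads on the
slice, and among polynomial monads over varying bases. -/
theorem exists_free_polynomialMonad [FinitaryExtensive E] [HasWTypes E] (P : PolyEnd E) :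
    ∃ (T : PolynomialMonad P.base) (α : P.functor ⟶ T.monad.toFunctor)
      (hc : NatTrans.Equifibered α) (hs : IsStrong P.strength T.strength α),
      IsFreeMonad P.functor T.monad α ∧
      ∀ (T' : PolyMnd E) (φ : P ⟶ (polyForget E).obj T'),
        ∃! ψ : (⟨P.base, T⟩ : PolyMnd E) ⟶ T',
          PolyEnd.Hom.ofFibre P.isPolynomial T.isPolynomial α hc hs ≫ (polyForget E).map ψ = φ := by
  obtain ⟨q, ⟨F⟩⟩ := P.isPolynomial.exists_freeFunctor
  have hq : IsPolynomial q.strength :=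
    ⟨q, Iso.refl _, fun K X ↦ by simp [tensorMap_id]⟩
  refine ⟨F.polynomialMonad P.preservesPullbacks hq, F.α, F.α_cartesian P.preservesPullbacks,
    F.α_strong, F.isFreeMonad, fun T' φ ↦ ?_⟩
  obtain ⟨ψ, hψ⟩ := F.exists_polyMnd_hom hq φ
  exact ⟨ψ, hψ, fun ψ' hψ' ↦ F.polyMnd_hom_ext hq (hψ'.trans hψ.symm)⟩

end
end PolynomialFunctors

/-! ### The main theorem. -/

open PolynomialFunctors

theorem mainTheorem8 {E : Type u} [Category.{v} E] [HasFiniteLimits E]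
    [LocallyCartesianClosed E] [FinitaryExtensive E] [HasWTypes E] :
    (polyForget E).IsRightAdjoint ∧
    ∀ P : PolyEnd E, ∃ (T : PolynomialMonad P.base) (α : P.functor ⟶ T.monad.toFunctor)
      (hc : NatTrans.Equifibered α) (hs : IsStrong P.strength T.strength α),
      IsFreeMonad P.functor T.monad α ∧
      ∀ (T' : PolyMnd E) (φ : P ⟶ (polyForget E).obj T'),
        ∃! ψ : (⟨P.base, T⟩ : PolyMnd E) ⟶ T',
          PolyEnd.Hom.ofFibre P.isPolynomial T.isPolynomial α hc hs ≫ (polyForget E).map ψ = φ := by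
  refine ⟨?_, exists_free_polynomialMonad⟩
  -- The universal property says that the inclusion of `P` into its free monad is initial among
  -- arrows from `P` to the forgetful functor, which is the pointwise criterion for a left adjoint.
  have (P : PolyEnd E) : HasInitial (StructuredArrow P (polyForget E)) := by
    obtain ⟨T, α, hc, hs, -, h⟩ := exists_free_polynomialMonad P
    choose ψ hψ hu using h
    let A : StructuredArrow P (polyForget E) :=
      StructuredArrow.mk (Y := (⟨P.base, T⟩ : PolyMnd E))
        (show P ⟶ (polyForget E).obj ⟨P.base, T⟩ from
          PolyEnd.Hom.ofFibre P.isPolynomial T.isPolynomial α hc hs)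
    exact (IsInitial.ofUniqueHom (X := A) (fun B ↦ StructuredArrow.homMk (ψ B.right B.hom)
      (hψ B.right B.hom)) fun B m ↦ StructuredArrow.ext _ _
        (hu B.right B.hom m.right (StructuredArrow.w m))).hasInitial
  exact isRightAdjointOfStructuredArrowInitials _
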